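/- Queries are Boolean conjunctive queries without constants, over a finite relational vocabulary in which every relation symbol is declared endogenous or exogenous. A \emph{contingency set} for a query $q$ and a finite database $D$ is a set $\Gamma\subseteq D$ of tuples of endogenous relations with $D\setminus\Gamma\not\models q$, and $\mathrm{RES}(q)$ is the set of pairs $(D,k)$ such that $D\models q$ and there is a contingency set $\Gamma$ with $|\Gamma|\le k$ ($q$ is fixed, $(D,k)$ is the input). A \emph{triad} of $q$ is a set of three endogenous atoms of $q$ any two of which are joined by a path of atoms of $q$, consecutive ones linked by a common variable, such that no linking variable occurs in the third atom; $q$ is \emph{pseudo-linear} if it has no triad. An endogenous relation $A$ \emph{dominates} another endogenous relation $B$ in $q$ if there is a map $f$ from the argument positions of $A$ to those of $B$ such that for every $B$-atom $B(v_1,\dots,v_n)$ of $q$, also $A(v_{f(1)},\dots,v_{f(m)})$ is an atom of $q$. \textbf{Proposition.} Let $q$ be a connected query all of whose atoms are unary or binary, such that exactly two atoms of $q$ have the relation symbol $R$ and every other relation symbol occurs in at most one atom. Suppose that $q$ contains, up to the names of the variables and of $A$, the query $z_3 :- R(x,x),R(x,y),A(y)$ with $x\neq y$, and that $q$ is pseudo-linear,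 possibly only after dominated relations have been relabelled as exogenous, one after the other. Then $\mathrm{RES}(q)$ is in $\mathrm{P}$. Moreover, tuples $R(a,b)$ with $a\ne b$ are never needed in a minimum contingency set: if $D\models q$ and $\Gamma$ is a contingency set for $q$ and $D$, then there is a contingency set $\Gamma'$ for $q$ and $D$ with $|\Gamma'|\le|\Gamma|$ that contains no tuple $R(a,b)$ with $a\neq b$. -/

import Mathlib

/-! ### Conjunctive queries, databases, resilience -/

/-- A relation symbol of the vocabulary `Fin ℓ` (with arities `ar`) together with a tuple of
arguments of the right length. With variables as arguments this is an atom of a query, with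
constants as arguments it is a tuple (fact) of a database. Variables and constants are both
named by natural numbers. -/
abbrev RelTuple {ℓ : ℕ} (ar : Fin ℓ → ℕ) : Type := (r : Fin ℓ) × (Fin (ar r) → ℕ)

/-- A database instance: a finite set of facts. -/
abbrev Database {ℓ : ℕ} (ar : Fin ℓ → ℕ) : Type := Finset (RelTuple ar)

/-- A Boolean conjunctive query (all variables are existentially quantified): its set of atoms,
and the set of relation symbols that are declared exogenous. All others are endogenous. -/
structure Query {ℓ : ℕ} (ar : Fin ℓ → ℕ) where
  body : Finset (RelTuple ar)
  exo : Finset (Fin ℓ)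

namespace RelTuple

variable {ℓ : ℕ} {ar : Fin ℓ → ℕ}

/-- The set of variables occurring in an atom. -/
def vars (g : RelTuple ar) : Set ℕ := Set.range g.2

/-- The fact that results from an atom when the variables are replaced by constants. -/
def subst (w : ℕ → ℕ) (g : RelTuple ar) : RelTuple ar := ⟨g.1, fun i => w (g.2 i)⟩

end RelTuple

namespace Query

variable {ℓ : ℕ} {ar : Fin ℓ → ℕ}

/-- `D ⊨ q`. -/
def Sat (q : Query ar) (D : Database ar) : Prop :=
  ∃ w : ℕ → ℕ, ∀ g ∈ q.body, RelTuple.subst w g ∈ D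

/-- `Γ` is a contingency set for `q` and `D`: a set of endogenous tuples of `D` whose removal
makes `q` false. -/
def IsContingencySet (q : Query ar) (D Γ : Database ar) : Prop :=
  Γ ⊆ D ∧ (∀ t ∈ Γ, t.1 ∉ q.exo) ∧ ¬ q.Sat (D \ Γ)

/-- The decision problem `RES(q)`: pairs `(D, k)` such that `D ⊨ q` and there is a contingency
set with at most `k` tuples. -/
def Res (q : Query ar) : Set (Database ar × ℕ) :=
  {p | q.Sat p.1 ∧ ∃ Γ : Database ar, q.IsContingencySet p.1 Γ ∧ Γ.card ≤ p.2}

/-- The number of atoms of `q` with relation symbol `S`. -/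
def atomCount (q : Query ar) (S : Fin ℓ) : ℕ := (q.body.filter (fun g => g.1 = S)).card

/-- A binary query has only unary and binary atoms. -/
def IsBinary (q : Query ar) : Prop := ∀ g ∈ q.body, ar g.1 = 1 ∨ ar g.1 = 2

/-- `S(v₁,…,vₙ)` is an atom of `q`, where `l = [v₁,…,vₙ]`; in particular `S` has arity `n`. -/
def HasAtom (q : Query ar) (S : Fin ℓ) (l : List ℕ) : Prop :=
  ∃ v : Fin (ar S) → ℕ, (⟨S, v⟩ : RelTuple ar) ∈ q.body ∧ List.ofFn v = l

/-- `q` contains `z₃ :- R(x,x), R(x,y), A(y)`, where `x`, `y` are distinct variables. -/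
def ContainsZ3 (q : Query ar) (R : Fin ℓ) : Prop :=
  ∃ (A : Fin ℓ) (x y : ℕ), x ≠ y ∧ q.HasAtom R [x, x] ∧ q.HasAtom R [x, y] ∧ q.HasAtom A [y]

/-- One step in the dual hypergraph of `q` from an atom to an atom along a common variable that
does not lie in `X`. -/
def Step (q : Query ar) (X : Set ℕ) (g h : RelTuple ar) : Prop :=
  g ∈ q.body ∧ h ∈ q.body ∧ ∃ x, x ∈ g.vars ∧ x ∈ h.vars ∧ x ∉ X

/-- There is a path from `g` to `h` in the dual hypergraph of `q` that uses no variable of `X`. -/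
def PathAvoiding (q : Query ar) (X : Set ℕ) : RelTuple ar → RelTuple ar → Prop :=
  Relation.ReflTransGen (q.Step X)

/-- The atoms of `q` are connected via variables. -/
def Connected (q : Query ar) : Prop :=
  ∀ g ∈ q.body, ∀ h ∈ q.body, q.PathAvoiding ∅ g h

/-- A triad: three endogenous atoms such that any two of them are joined by a path that uses no
variable of the third. -/
def HasTriad (q : Query ar) : Prop :=
  ∃ S : Fin 3 → RelTuple ar, Function.Injective S ∧
    (∀ i, S i ∈ q.body ∧ (S i).1 ∉ q.exo) ∧
    ∀ i j k : Fin 3, i ≠ j → i ≠ k → j ≠ k → q.PathAvoiding (S k).vars (S i) (S j)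

/-- A query is pseudo-linear if it has no triad. -/
def PseudoLinear (q : Query ar) : Prop := ¬ q.HasTriad

/-- Domination with self-joins: `A` and `B` are different endogenous relations, and for a map `f`
from the positions of `A` to those of `B`, each `B`-atom `B(v)` of `q` comes with the `A`-atom
whose `i`-th argument is the `f i`-th argument of `B(v)`. -/
def Dominates (q : Query ar) (A B : Fin ℓ) : Prop :=
  A ≠ B ∧ A ∉ q.exo ∧ B ∉ q.exo ∧
    ∃ f : Fin (ar A) → Fin (ar B), ∀ v : Fin (ar B) → ℕ,
      (⟨B, v⟩ : RelTuple ar) ∈ q.body → (⟨A, fun i => v (f i)⟩ : RelTuple ar) ∈ q.body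

/-- `q'` results from `q` by labelling one dominated relation exogenous. -/
def MarkDominated (q q' : Query ar) : Prop :=
  ∃ A B : Fin ℓ, q.Dominates A B ∧ q'.body = q.body ∧ q'.exo = insert B q.exo

end Query

/-! ### Polynomial time

Random access machines with unit cost, whose only arithmetic is addition and (truncated)
subtraction, so that numbers grow by at most one bit per step; deciding in polynomially many steps
(in the bit length of the input) is then the same as for Turing machines. -/

/-- A machine state: finitely many registers `0, 1, 2, …` are addressed by a given program
directly, and the memory is addressed indirectly. All cells hold natural numbers. -/
structure RAMState where
  reg : ℕ → ℕ
  mem : ℕ → ℕ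

/-- Structured programs for the machine. -/
inductive RAMProg : Type
  /-- `reg d := c` -/
  | const (d c : ℕ)
  /-- `reg d := reg a + reg b` -/
  | add (d a b : ℕ)
  /-- `reg d := reg a - reg b`, truncated at `0` -/
  | sub (d a b : ℕ)
  /-- `reg d := mem[reg a]` -/
  | load (d a : ℕ)
  /-- `mem[reg a] := reg b` -/
  | store (a b : ℕ)
  /-- first `p`, then `p'` -/
  | seq (p p' : RAMProg)
  /-- `p` if `reg a ≠ 0`, else `p'` -/
  | ite (a : ℕ) (p p' : RAMProg)
  /-- repeat `p` as long as `reg a ≠ 0` -/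
  | loop (a : ℕ) (p : RAMProg)

/-- `Exec p s s' t`: the program `p`, started in state `s`, halts in state `s'` after `t` steps.
Each assignment and each test of a register costs one step. -/
inductive RAMProg.Exec : RAMProg → RAMState → RAMState → ℕ → Prop
  | const (d c : ℕ) (s : RAMState) :
      Exec (.const d c) s { s with reg := Function.update s.reg d c } 1
  | add (d a b : ℕ) (s : RAMState) :
      Exec (.add d a b) s { s with reg := Function.update s.reg d (s.reg a + s.reg b) } 1
  | sub (d a b : ℕ) (s : RAMState) :
      Exec (.sub d a b) s { s with reg := Function.update s.reg d (s.reg a - s.reg b) } 1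
  | load (d a : ℕ) (s : RAMState) :
      Exec (.load d a) s { s with reg := Function.update s.reg d (s.mem (s.reg a)) } 1
  | store (a b : ℕ) (s : RAMState) :
      Exec (.store a b) s { s with mem := Function.update s.mem (s.reg a) (s.reg b) } 1
  | seq {p p' : RAMProg} {s s' s'' : RAMState} {t t' : ℕ} :
      Exec p s s' t → Exec p' s' s'' t' → Exec (.seq p p') s s'' (t + t')
  | ite_true {a : ℕ} {p p' : RAMProg} {s s' : RAMState} {t : ℕ} :
      s.reg a ≠ 0 → Exec p s s' t → Exec (.ite a p p') s s' (t + 1)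
  | ite_false {a : ℕ} {p p' : RAMProg} {s s' : RAMState} {t : ℕ} :
      s.reg a = 0 → Exec p' s s' t → Exec (.ite a p p') s s' (t + 1)
  | loop_true {a : ℕ} {p : RAMProg} {s s' s'' : RAMState} {t t' : ℕ} :
      s.reg a ≠ 0 → Exec p s s' t → Exec (.loop a p) s' s'' t' →
        Exec (.loop a p) s s'' (t + t' + 1)
  | loop_false {a : ℕ} {p : RAMProg} {s : RAMState} :
      s.reg a = 0 → Exec (.loop a p) s s 1

/-- The initial state: the input word is in the memory, its length is in register `0`. -/
def RAMState.init (w : List ℕ) : RAMState where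
  reg := fun i => if i = 0 then w.length else 0
  mem := fun i => w.getD i 0

/-- The size of an input word: the total number of bits, plus one separator for each number. -/
def inputSize (w : List ℕ) : ℕ := (w.map (fun x => Nat.size x + 1)).sum

/-- The class `P`: some program halts on every input word after a number of steps that is
polynomial in the size of the input, and accepts (`reg 0 ≠ 0`) exactly the words of `L`. -/
def InP (L : Set (List ℕ)) : Prop :=
  ∃ (p : RAMProg) (P : Polynomial ℕ), ∀ w : List ℕ, ∃ (s : RAMState) (t : ℕ),
    p.Exec (RAMState.init w) s t ∧ t ≤ P.eval (inputSize w) ∧ (s.reg 0 ≠ 0 ↔ w ∈ L)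

/-- The input word for the bound `k` and a database that is listed as `l`: first `k`, then, for
each fact, the number of its relation symbol followed by its arguments. -/
def encodeInstance {ℓ : ℕ} {ar : Fin ℓ → ℕ} (l : List (RelTuple ar)) (k : ℕ) : List ℕ :=
  k :: l.flatMap (fun t => (t.1 : ℕ) :: List.ofFn t.2)

/-- `RES(q)` as a language: all words that encode an instance `(D, k) ∈ RES(q)`. -/
def Query.resLanguage {ℓ : ℕ} {ar : Fin ℓ → ℕ} (q : Query ar) : Set (List ℕ) :=
  {w | ∃ (l : List (RelTuple ar)) (k : ℕ), w = encodeInstance l k ∧ (l.toFinset, k) ∈ q.Res}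

/-! In every witness the fact for `R(x,y)` comes together with the loop for `R(x,x)` at the same
first constant. Replacing each `R(a,b)` in a contingency set by `R(a,a)` thus keeps it a hitting set
for the witnesses and does not enlarge it (`exists_contingencySet_of_loops`). Domination works in
the same way: a fact of the dominated relation is exchanged for the dominating fact of the same
witness. What remains is a minimum hitting set problem for the images of a set `E` of atoms, namely
the endogenous atoms left after domination, without `R(x,y)`. Their relation symbols are pairwise
different, so a fact reveals the atom it comes from.

Without triads, among any three atoms of `E` one separates the other two. As atoms have at most two
variables, this yields a linear order of `E` in which each atom separates those on its left from
those on its right (`exists_separatingOrder`). Two witnesses that agree on an atom of `E` can then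
be recombined there (`Witness.splice`), so witnesses behave like the paths of a layered graph on the
facts, and hitting sets are vertex cuts. Splitting each inner vertex into two copies joined by an
edge turns minimum cuts into minimum vertex covers of a bipartite graph, up to the number of inner
vertices (`exists_hitting_iff_exists_cover`).

The size of such a cover is found by an auction: unmatched left vertices bid for their cheapest
neighbours, and when bidding stops, a gap in the prices shows a cover as large as the current
matching (`Inv.exists_cover_iff`). Prices are bounded by the number `n` of vertices, so there are at
most `n²` bids.

For membership in `P`, the algorithm is written in a small language whose loops all run over the
numbers below the input length; compiled programs have a polynomial time bound by construction
(`inP_of_run`). The query is fixed, so witnesses can be searched by one nested loop per atom. -/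

/-! ### Separation in graphs and linear orders without triads -/

namespace Separation

variable {V : Type*} {adj : V → V → Prop}

/-- Connectedness by a path that avoids `X`. -/
def Conn (adj : V → V → Prop) (X : Set V) : V → V → Prop :=
  Relation.ReflTransGen (fun u v => u ∉ X ∧ v ∉ X ∧ adj u v)

/-- Some path from `a` to `c` avoids `b`. -/
def Linked (adj : V → V → Prop) (b a c : Set V) : Prop :=
  ∃ u ∈ a, ∃ v ∈ c, u ∉ b ∧ v ∉ b ∧ Conn adj b u v

theorem Conn.symm (hs : ∀ u v, adj u v → adj v u) {X : Set V} {u v : V} (h : Conn adj X u v) :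
    Conn adj X v u := by
  induction h with
  | refl => exact .refl
  | tail _ h ih => exact .head ⟨h.2.1, h.1, hs _ _ h.2.2⟩ ih

theorem Linked.symm (hs : ∀ u v, adj u v → adj v u) {a b c : Set V} (h : Linked adj b a c) :
    Linked adj b c a := by
  obtain ⟨u, hu, v, hv, hub, hvb, h⟩ := h
  exact ⟨v, hv, u, hu, hvb, hub, h.symm hs⟩

theorem Linked.trans {a b c d : Set V} (hc : ∀ u ∈ c, ∀ v ∈ c, adj u v)
    (h : Linked adj b a c) (h' : Linked adj b c d) : Linked adj b a d := by
  obtain ⟨u, hu, v, hv, hub, hvb, h⟩ := h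
  obtain ⟨u', hu', v', hv', hub', hvb', h'⟩ := h'
  exact ⟨u, hu, v', hv', hub, hvb', (h.tail ⟨hvb, hub', hc _ hv _ hu'⟩).trans h'⟩

/-- A path either has a point in `m`, where it falls into two pieces, or avoids `m`. This compares a
path avoiding one element of the order with a second element. -/
theorem Linked.split {X a c : Set V} (m : Set V) (h : Linked adj X a c) :
    (Linked adj X a m ∧ Linked adj X m c) ∨ Linked adj m a c := by
  obtain ⟨u, hu, v, hv, huX, hvX, h⟩ := h
  have key : ∀ w, Conn adj X u w → (∃ y ∈ m, y ∉ X ∧ Conn adj X u y ∧ Conn adj X y w) ∨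
      (u ∉ m ∧ w ∉ m ∧ Conn adj m u w) := by
    intro w hw
    induction hw with
    | refl =>
      by_cases hm : u ∈ m
      · exact .inl ⟨u, hm, huX, .refl, .refl⟩
      · exact .inr ⟨hm, hm, .refl⟩
    | @tail b c hb hbc ih =>
      rcases ih with ⟨y, hy, hyX, h1, h2⟩ | ⟨h1, h2, h3⟩
      · exact .inl ⟨y, hy, hyX, h1, h2.tail hbc⟩
      · by_cases hm : c ∈ m
        · exact .inl ⟨c, hm, hbc.2.1, hb.tail hbc, .refl⟩
        · exact .inr ⟨h1, hm, h3.tail ⟨h2, hm, hbc.2.2⟩⟩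
  rcases key v h with ⟨y, hy, hyX, h1, h2⟩ | ⟨h1, h2, h3⟩
  · exact .inl ⟨⟨u, hu, y, hy, huX, hyX, h1⟩, ⟨y, hy, v, hv, hyX, hvX, h2⟩⟩
  · exact .inr ⟨u, hu, v, hv, h1, h2, h3⟩

/-- A path that enters `b ∪ c` although neither `b` nor `c` can be reached first enters
`b ∩ c`. -/
theorem Linked.exists_mem_inter {X a b c : Set V} (h : Linked adj X a b)
    (hb : ¬ Linked adj c a b) (hc : ¬ Linked adj b a c) : ∃ x, x ∈ b ∧ x ∈ c ∧ x ∉ X := by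
  obtain ⟨u, hu, v, hv, huX, hvX, h⟩ := h
  -- As long as neither set has been touched, the path avoids both; touching just one of them next
  -- would give one of the two forbidden links.
  have key : ∀ w, Conn adj X u w → (∃ x, x ∈ b ∧ x ∈ c ∧ x ∉ X) ∨
      (w ∉ b ∧ w ∉ c ∧ u ∉ b ∧ u ∉ c ∧ Conn adj b u w ∧ Conn adj c u w) := by
    intro w hw
    induction hw with
    | refl =>
      by_cases h1 : u ∈ b <;> by_cases h2 : u ∈ c
      · exact .inl ⟨u, h1, h2, huX⟩
      · exact (hb ⟨u, hu, u, h1, h2, h2, .refl⟩).elim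
      · exact (hc ⟨u, hu, u, h2, h1, h1, .refl⟩).elim
      · exact .inr ⟨h1, h2, h1, h2, .refl, .refl⟩
    | @tail y z hy hyz ih =>
      rcases ih with h1 | ⟨h1, h2, h3, h4, h5, h6⟩
      · exact .inl h1
      · by_cases hzb : z ∈ b <;> by_cases hzc : z ∈ c
        · exact .inl ⟨z, hzb, hzc, hyz.2.1⟩
        · exact (hb ⟨u, hu, z, hzb, h4, hzc, h6.tail ⟨h2, hzc, hyz.2.2⟩⟩).elim
        · exact (hc ⟨u, hu, z, hzc, h3, hzb, h5.tail ⟨h1, hzb, hyz.2.2⟩⟩).elim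
        · exact .inr ⟨hzb, hzc, h3, h4, h5.tail ⟨h1, hzb, hyz.2.2⟩,
            h6.tail ⟨h2, hzc, hyz.2.2⟩⟩
  rcases key v h with h1 | h1
  · exact h1
  · exact (h1.1 hv).elim

variable {α : Type*} {vs : α → Set V}

/-- The positions `pos` order `E` in such a way that each element separates those on its left from
those on its right. -/
def SeparatingOrder (adj : V → V → Prop) (vs : α → Set V) (E : Finset α) (pos : α → ℤ) : Prop :=
  (∀ a ∈ E, ∀ b ∈ E, pos a = pos b → a = b) ∧
    ∀ a ∈ E, ∀ b ∈ E, ∀ c ∈ E, pos a < pos b → pos b < pos c →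
      ¬ Linked adj (vs b) (vs a) (vs c)

theorem SeparatingOrder.neg (hs : ∀ u v, adj u v → adj v u) {E : Finset α} {pos : α → ℤ}
    (h : SeparatingOrder adj vs E pos) : SeparatingOrder adj vs E (fun a => - pos a) :=
  ⟨fun a ha b hb hab => h.1 a ha b hb (neg_injective hab), fun a ha b hb c hc hab hbc hl =>
    h.2 c hc b hb a ha (by simpa using hbc) (by simpa using hab) (hl.symm hs)⟩

/-- `z` hangs off an element `f` of `E` that meets another element `l` of `E`. -/
def Dangling (adj : V → V → Prop) (vs : α → Set V) (E : Finset α) (z : α) : Prop :=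
  ∃ l ∈ E, ∃ f ∈ E, ∃ x, l ≠ z ∧ f ≠ z ∧ l ≠ f ∧ x ∈ vs l ∧ x ∈ vs f ∧ x ∉ vs z ∧
    Linked adj (vs l) (vs z) (vs f) ∧ ∀ e ∈ E, e ≠ z → e ≠ f → ¬ Linked adj (vs f) (vs z) (vs e)

/-- The heart of the insertion step. -/
theorem dangling_of_linked (hs : ∀ u v, adj u v → adj v u) {E E' : Finset α}
    (hcl : ∀ a ∈ E, ∀ u ∈ vs a, ∀ v ∈ vs a, adj u v)
    {z l r k h : α} (hE : ∀ e, e ∈ E' ↔ e ∈ E ∧ e ≠ z) {pos : α → ℤ}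
    (hz : z ∈ E) (hpos : SeparatingOrder adj vs E' pos)
    (hl : l ∈ E') (hr : r ∈ E') (hk : k ∈ E') (hh : h ∈ E')
    (hlk : pos l < pos k) (hzk : Linked adj (vs l) (vs z) (vs k))
    (hhr : pos h < pos r) (hzh : Linked adj (vs r) (vs z) (vs h))
    (hfree : ∀ e ∈ E', pos l < pos e → pos e < pos r → ∀ e' ∈ E', pos e ≠ pos e' →
      ¬ Linked adj (vs e) (vs z) (vs e'))
    (hlr : Linked adj (vs z) (vs l) (vs r)) (hn : ¬ Linked adj (vs l) (vs z) (vs r)) :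
    Dangling adj vs E z := by
  -- If `k` came after `r`, the path from `z` to `k` avoiding `l` would either meet `r`, against
  -- `hn`, or avoid `r` and so connect `h` with `k` past `r`.
  have hkr : pos k < pos r := by
    by_contra hc
    rcases (not_lt.1 hc).lt_or_eq with hc | hc
    · rcases hzk.split (vs r) with h1 | h1
      · exact hn h1.1
      · exact hpos.2 h hh r hr k hk hhr hc ((hzh.symm hs).trans (hcl z hz) h1)
    · exact hn (hpos.1 r hr k hk hc ▸ hzk)
  have hf := hfree k hk hlk hkr
  have h1 : ¬ Linked adj (vs k) (vs r) (vs l) := fun hx =>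
    hpos.2 l hl k hk r hr hlk hkr (hx.symm hs)
  have h2 : ¬ Linked adj (vs l) (vs r) (vs k) := fun hx =>
    hn (hzk.trans (hcl k ((hE k).1 hk).1) (hx.symm hs))
  -- `k` cuts `r` off from `l`, and `l` cuts `r` off from `k`; hence the path from `r` to `l` that
  -- avoids `z` reaches both at the same point.
  obtain ⟨x, hx1, hx2, hx3⟩ := (hlr.symm hs).exists_mem_inter h1 h2
  refine ⟨l, ((hE l).1 hl).1, k, ((hE k).1 hk).1, x, ((hE l).1 hl).2, ((hE k).1 hk).2, ?_, hx1,
    hx2, hx3, hzk, fun e he hez hek => hf e ((hE e).2 ⟨he, hez⟩) fun hp => hek ?_⟩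
  · rintro rfl
    exact lt_irrefl _ hlk
  · exact (hpos.1 k hk e ((hE e).2 ⟨he, hez⟩) hp).symm

/-- Each old element that fails to separate `z` from something on one of its sides forces `z` to
that side. These demands are compatible and leave an interval of possible places. If `z` separates
left from right at none of them, its two neighbouring constraints are linked past `z`, which
produces a triad or makes `z` dangle. -/
theorem exists_insert [DecidableEq α] (hs : ∀ u v, adj u v → adj v u) {E : Finset α}
    (hcl : ∀ a ∈ E, ∀ u ∈ vs a, ∀ v ∈ vs a, adj u v)
    (htri : ∀ a ∈ E, ∀ b ∈ E, ∀ c ∈ E, a ≠ b → b ≠ c → a ≠ c →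
      Linked adj (vs a) (vs b) (vs c) → Linked adj (vs b) (vs a) (vs c) →
        ¬ Linked adj (vs c) (vs a) (vs b)) {z : α} (hz : z ∈ E) (hd : ¬ Dangling adj vs E z)
    {pos : α → ℤ} (hpos : SeparatingOrder adj vs (E.erase z) pos) :
    ∃ pos' : α → ℤ, SeparatingOrder adj vs E pos' := by
  classical
  set E' := E.erase z with hE'
  have hE : ∀ e, e ∈ E' ↔ e ∈ E ∧ e ≠ z := fun e => by simp [hE', and_comm]
  -- it suffices to find a position for `z`
  suffices H : ∃ κ : ℤ, (∀ e ∈ E', ∀ e' ∈ E', Linked adj (vs e) (vs z) (vs e') →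
      (pos e < pos e' → pos e < κ) ∧ (pos e' < pos e → κ ≤ pos e)) ∧
      ∀ a ∈ E', ∀ b ∈ E', pos a < κ → κ ≤ pos b → ¬ Linked adj (vs z) (vs a) (vs b) by
    obtain ⟨κ, h1, h2⟩ := H
    have hsplit : ∀ e ∈ E, e = z ∨ (e ∈ E' ∧ e ≠ z) := fun e he => by
      by_cases h : e = z
      · exact .inl h
      · exact .inr ⟨(hE e).2 ⟨he, h⟩, h⟩
    -- Doubling the old positions leaves an odd number free for `z`, just before the elements at `κ`
    -- or later.
    refine ⟨fun e => if e = z then 2 * κ - 1 else 2 * pos e, ?_, ?_⟩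
    · intro a ha b hb hab
      rcases hsplit a ha with rfl | ⟨ha, ha'⟩ <;> rcases hsplit b hb with rfl | ⟨hb, hb'⟩
      · rfl
      · simp [hb'] at hab; omega
      · simp [ha'] at hab; omega
      · simp only [ha', hb', if_false] at hab
        exact hpos.1 a ha b hb (by omega)
    · intro a ha b hb c hc hab hbc hl
      rcases hsplit a ha with rfl | ⟨ha, ha'⟩ <;> rcases hsplit b hb with rfl | ⟨hb, hb'⟩ <;>
        rcases hsplit c hc with rfl | ⟨hc, hc'⟩
      all_goals simp only [if_true, if_false, *] at hab hbc
      · omega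
      · omega
      · omega
      · have := (h1 b hb c hc hl).1 (by omega)
        omega
      · omega
      · exact h2 a ha c hc (by omega) (by omega) hl
      · have := (h1 b hb a ha (hl.symm hs)).2 (by omega)
        omega
      · exact hpos.2 a ha b hb c hc (by omega) (by omega) hl
  -- `z` must come after the elements of `right` and before those of `left`.
  set right := E'.filter fun e => ∃ k ∈ E', pos e < pos k ∧ Linked adj (vs e) (vs z) (vs k)
    with hright
  set left := E'.filter fun e => ∃ k ∈ E', pos k < pos e ∧ Linked adj (vs e) (vs z) (vs k)
    with hleft
  have memr : ∀ e, e ∈ right ↔ e ∈ E' ∧ ∃ k ∈ E', pos e < pos k ∧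
      Linked adj (vs e) (vs z) (vs k) := fun e => by rw [hright, Finset.mem_filter]
  have meml : ∀ e, e ∈ left ↔ e ∈ E' ∧ ∃ k ∈ E', pos k < pos e ∧
      Linked adj (vs e) (vs z) (vs k) := fun e => by rw [hleft, Finset.mem_filter]
  -- Without demands from one side, `z` can go to the end of the order, where it has nothing to
  -- separate.
  rcases right.eq_empty_or_nonempty with h0 | hne
  · obtain ⟨κ, hκ⟩ : ∃ κ : ℤ, ∀ e ∈ E', κ ≤ pos e := by
      obtain ⟨κ, hκ⟩ := (E'.image pos).bddBelow
      exact ⟨κ, fun e he => hκ (by simpa using ⟨e, he, rfl⟩)⟩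
    refine ⟨κ, fun e he e' he' hl => ⟨fun hlt => ?_, fun _ => hκ e he⟩, fun a ha b hb h1 _ => ?_⟩
    · have : e ∈ right := (memr e).2 ⟨he, e', he', hlt, hl⟩
      simp [h0] at this
    · have := hκ a ha
      omega
  rcases left.eq_empty_or_nonempty with h0' | hne'
  · obtain ⟨κ, hκ⟩ : ∃ κ : ℤ, ∀ e ∈ E', pos e ≤ κ := by
      obtain ⟨κ, hκ⟩ := (E'.image pos).bddAbove
      exact ⟨κ, fun e he => hκ (by simpa using ⟨e, he, rfl⟩)⟩
    refine ⟨κ + 1, fun e he e' he' hl => ⟨fun hlt => ?_, fun hlt => ?_⟩, fun a ha b hb _ h1 => ?_⟩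
    · have := hκ e he
      omega
    · have : e ∈ left := (meml e).2 ⟨he, e', he', hlt, hl⟩
      simp [h0'] at this
    · have := hκ b hb
      omega
  obtain ⟨l, hl, hlmax⟩ := right.exists_max_image pos hne
  obtain ⟨r, hr, hrmin⟩ := left.exists_min_image pos hne'
  obtain ⟨hlE, k, hk, hlk, hzk⟩ := (memr l).1 hl
  obtain ⟨hrE, h, hh, hhr, hzh⟩ := (meml r).1 hr
  -- Otherwise links from `z` to both sides of `l`, or of `r`, combine to a link across that
  -- element.
  have hlr : pos l < pos r := by
    by_contra hc
    rcases (not_lt.1 hc).lt_or_eq with hc | hc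
    · rcases hzk.split (vs r) with h1 | h1
      · exact hpos.2 r hrE l hlE k hk hc hlk ((h1.1.symm hs).trans (hcl z hz) hzk)
      · exact hpos.2 h hh r hrE k hk hhr (hc.trans hlk) ((hzh.symm hs).trans (hcl z hz) h1)
    · obtain rfl := hpos.1 r hrE l hlE hc
      exact hpos.2 h hh r hrE k hk hhr hlk ((hzh.symm hs).trans (hcl z hz) hzk)
  by_contra hcon
  push Not at hcon
  -- All cuts in this interval meet the demands of the old elements, so each can fail only because a
  -- link avoiding `z` bridges it.
  have hbad : ∀ κ : ℤ, pos l < κ → κ ≤ pos r →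
      ∃ a ∈ E', ∃ b ∈ E', pos a < κ ∧ κ ≤ pos b ∧ Linked adj (vs z) (vs a) (vs b) := by
    intro κ h1 h2
    refine hcon κ fun e he e' he' hle => ⟨fun hlt => ?_, fun hlt => ?_⟩
    · have := hlmax e ((memr e).2 ⟨he, e', he', hlt, hle⟩)
      omega
    · have := hrmin e ((meml e).2 ⟨he, e', he', hlt, hle⟩)
      omega
  have hlrz : Linked adj (vs z) (vs l) (vs r) := by
    by_contra hno
    -- Take the last element before `r` that can be reached from `l` avoiding `z`. The cut right
    -- after it is bridged too, and the bridge cannot bypass `m`, so a still later element is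
    -- reached; by maximality it is `r` or lies beyond `r`, and then the path passes `r`.
    obtain ⟨m, hm, hmax⟩ := (E'.filter fun e => pos e < pos r ∧
      (e = l ∨ Linked adj (vs z) (vs l) (vs e))).exists_max_image pos
        ⟨l, by simp [hlE, hlr]⟩
    simp only [Finset.mem_filter] at hm hmax
    obtain ⟨hmE, hmr, hml⟩ := hm
    have hlm : pos l ≤ pos m := hmax l ⟨hlE, hlr, .inl rfl⟩
    obtain ⟨a, ha, b, hb, h1, h2, h3⟩ := hbad (pos m + 1) (by omega) (by omega)
    have hmb : Linked adj (vs z) (vs m) (vs b) := by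
      rcases eq_or_ne a m with rfl | hne
      · exact h3
      · have ham : pos a < pos m := lt_of_le_of_ne (by omega) fun h => hne (hpos.1 a ha m hmE h)
        rcases h3.split (vs m) with h4 | h4
        · exact h4.2
        · exact (hpos.2 a ha m hmE b hb ham (by omega) h4).elim
    have hlb : Linked adj (vs z) (vs l) (vs b) := by
      rcases hml with rfl | hml
      · exact hmb
      · exact hml.trans (hcl m ((hE m).1 hmE).1) hmb
    rcases lt_trichotomy (pos b) (pos r) with hbr | hbr | hbr
    · have := hmax b ⟨hb, hbr, .inr hlb⟩
      omega
    · exact hno (hpos.1 b hb r hrE hbr ▸ hlb)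
    · rcases hlb.split (vs r) with h4 | h4
      · exact hno h4.1
      · exact hpos.2 l hlE r hrE b hb hlr hbr h4
  have hfree : ∀ e ∈ E', pos l < pos e → pos e < pos r → ∀ e' ∈ E', pos e ≠ pos e' →
      ¬ Linked adj (vs e) (vs z) (vs e') := by
    intro e he h1 h2 e' he' hne hle
    rcases lt_or_gt_of_ne hne with hlt | hlt
    · have := hlmax e ((memr e).2 ⟨he, e', he', hlt, hle⟩)
      omega
    · have := hrmin e ((meml e).2 ⟨he, e', he', hlt, hle⟩)
      omega
  -- If both links exist, `l`, `z` and `r` violate `htri`; if one is missing, `z` dangles, where the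
  -- second case is the mirror image of the first.
  by_cases hn : Linked adj (vs l) (vs z) (vs r)
  · by_cases hn' : Linked adj (vs r) (vs z) (vs l)
    · refine htri l ((hE l).1 hlE).1 z hz r ((hE r).1 hrE).1 ((hE l).1 hlE).2
        ((hE r).1 hrE).2.symm ?_ hn hlrz (hn'.symm hs)
      rintro rfl
      exact lt_irrefl _ hlr
    · refine hd (dangling_of_linked hs hcl hE hz (hpos.neg hs) hrE hlE hh hk (by simpa using hhr) hzh
        (by simpa using hlk) hzk ?_ (hlrz.symm hs) hn')
      intro e he h1 h2 e' he' hne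
      exact hfree e he (by simpa using h2) (by simpa using h1) e' he' (by simpa using hne)
  · exact hd (dangling_of_linked hs hcl hE hz hpos hlE hrE hk hh hlk hzk hhr hzh hfree hlrz hn)

/-- This is where sets of at most two elements matter: `f'` is used up by a point common to `l`,
`f`, `f'` and a point outside `f`, which leaves no way for `z` to reach `f` without meeting `l`. -/
theorem not_dangling_of_dangling (hs : ∀ u v, adj u v → adj v u) {E : Finset α}
    (hcard : ∀ a ∈ E, ∀ x ∈ vs a, ∀ y ∈ vs a, x ≠ y → ∀ z ∈ vs a, z = x ∨ z = y)
    {z l f : α} {x : V} (hz : z ∈ E) (hl : l ∈ E) (hfz : f ≠ z) (hlf : l ≠ f)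
    (hxl : x ∈ vs l) (hxf : x ∈ vs f) (hxz : x ∉ vs z) (hzf : Linked adj (vs l) (vs z) (vs f))
    (hfree : ∀ e ∈ E, e ≠ z → e ≠ f → ¬ Linked adj (vs f) (vs z) (vs e)) :
    ¬ Dangling adj vs E f := by
  rintro ⟨l', hl', f', hf', x', hlf', hff', hlf'', hxl', hxf', hxf'', hff, hfree'⟩
  -- `f'` separates `f` from all other elements, so a point that `f` shares with `l` must belong to
  -- `f'`.
  have hxf3 : x ∈ vs f' := by
    by_contra hx
    refine hfree' l hl hlf ?_ ⟨x, hxf, x, hxl, hx, hx, .refl⟩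
    rintro rfl
    exact hx hxl
  have hfz' : f' ≠ z := by
    rintro rfl
    exact hxz hxf3
  have hne : x ≠ x' := by
    rintro rfl
    exact hxf'' hxf
  have h1 : ¬ Linked adj (vs f) (vs z) (vs f') := hfree f' hf' hfz' hff'
  have h2 : ¬ Linked adj (vs f') (vs z) (vs f) := fun h =>
    hfree' z hz hfz.symm hfz'.symm (h.symm hs)
  -- The path from `z` to `f` avoiding `l` enters `f` and `f'` together at `y`. Of the two points of
  -- `f'`, `x` lies in `l` and `x'` lies outside `f`.
  obtain ⟨y, hy1, hy2, hy3⟩ := hzf.exists_mem_inter h2 h1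
  rcases hcard f' hf' x hxf3 x' hxf' hne y hy2 with rfl | rfl
  · exact hy3 hxl
  · exact hxf'' hy1

/-- If among any three of the sets `vs a` one separates the other two and these sets are cliques
with at most two elements, then `E` can be ordered linearly. -/
theorem exists_separatingOrder [DecidableEq α] (hs : ∀ u v, adj u v → adj v u) (E : Finset α)
    (hcl : ∀ a ∈ E, ∀ u ∈ vs a, ∀ v ∈ vs a, adj u v)
    (hcard : ∀ a ∈ E, ∀ x ∈ vs a, ∀ y ∈ vs a, x ≠ y → ∀ z ∈ vs a, z = x ∨ z = y)
    (htri : ∀ a ∈ E, ∀ b ∈ E, ∀ c ∈ E, a ≠ b → b ≠ c → a ≠ c →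
      Linked adj (vs a) (vs b) (vs c) → Linked adj (vs b) (vs a) (vs c) →
        ¬ Linked adj (vs c) (vs a) (vs b)) :
    ∃ pos : α → ℤ, SeparatingOrder adj vs E pos := by
  induction hn : E.card generalizing E with
  | zero =>
    rw [Finset.card_eq_zero] at hn
    subst hn
    exact ⟨fun _ => 0, by simp [SeparatingOrder]⟩
  | succ n ih =>
    -- If an arbitrary element dangles, the one it hangs off does not and is removed instead.
    obtain ⟨z, hz, hd⟩ : ∃ z ∈ E, ¬ Dangling adj vs E z := by
      obtain ⟨z, hz⟩ : E.Nonempty := Finset.card_pos.1 (by omega)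
      by_cases hd : Dangling adj vs E z
      · obtain ⟨l, hl, f, hf, x, -, hfz, hlf, hxl, hxf, hxz, hzf, hfree⟩ := hd
        exact ⟨f, hf, not_dangling_of_dangling hs hcard hz hl hfz hlf hxl hxf hxz hzf hfree⟩
      · exact ⟨z, hz, hd⟩
    obtain ⟨pos, hpos⟩ := ih (E.erase z) (fun a ha => hcl a (Finset.mem_of_mem_erase ha))
      (fun a ha => hcard a (Finset.mem_of_mem_erase ha))
      (fun a ha b hb c hc => htri a (Finset.mem_of_mem_erase ha) b (Finset.mem_of_mem_erase hb) c
        (Finset.mem_of_mem_erase hc)) (by rw [Finset.card_erase_of_mem hz, hn]; rfl)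
    exact exists_insert hs hcl htri hz hd hpos

end Separation

/-! ### Hitting sets of pseudo-linear queries -/

namespace Query

open Separation

variable {ℓ : ℕ} {ar : Fin ℓ → ℕ}

/-- `w` is a witness for `D ⊨ q`. -/
def Witness (q : Query ar) (D : Database ar) (w : ℕ → ℕ) : Prop :=
  ∀ g ∈ q.body, RelTuple.subst w g ∈ D

/-- The facts in `Γ` meet each witness in the image of some atom in `E`. -/
def Hits (q : Query ar) (D : Database ar) (E : Finset (RelTuple ar)) (Γ : Finset (RelTuple ar)) :
    Prop :=
  ∀ w, q.Witness D w → ∃ e ∈ E, RelTuple.subst w e ∈ Γ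

/-- The endogenous atoms. -/
def endo (q : Query ar) : Finset (RelTuple ar) := q.body.filter fun g => g.1 ∉ q.exo

theorem mem_endo {q : Query ar} {g : RelTuple ar} : g ∈ q.endo ↔ g ∈ q.body ∧ g.1 ∉ q.exo := by
  simp [endo]

theorem IsContingencySet.hits {q : Query ar} {D Γ : Database ar} (h : q.IsContingencySet D Γ) :
    q.Hits D q.endo Γ := by
  intro w hw
  by_contra hc
  push Not at hc
  refine h.2.2 ⟨w, fun g hg => Finset.mem_sdiff.2 ⟨hw g hg, fun hΓ => ?_⟩⟩
  have hexo : g.1 ∉ q.exo := h.2.1 (RelTuple.subst w g) hΓ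
  exact hc g (mem_endo.2 ⟨hg, hexo⟩) hΓ

theorem Hits.isContingencySet {q : Query ar} {D Γ : Database ar} (h : q.Hits D q.endo Γ) :
    q.IsContingencySet D (Γ.filter fun t => t ∈ D ∧ t.1 ∉ q.exo) := by
  refine ⟨fun t ht => (Finset.mem_filter.1 ht).2.1, fun t ht => (Finset.mem_filter.1 ht).2.2, ?_⟩
  rintro ⟨w, hw⟩
  have hw' : q.Witness D w := fun g hg => (Finset.mem_sdiff.1 (hw g hg)).1
  obtain ⟨e, he, hΓ⟩ := h w hw'
  have he' := mem_endo.1 he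
  exact (Finset.mem_sdiff.1 (hw e he'.1)).2 (Finset.mem_filter.2 ⟨hΓ, hw' e he'.1, he'.2⟩)

/-- The common form of both exchange arguments, domination and loops: the map on facts must match a
map on atoms uniformly in the witness. -/
theorem Hits.image {q : Query ar} {D : Database ar} {E E' Γ : Finset (RelTuple ar)}
    (h : q.Hits D E Γ) (φ : RelTuple ar → RelTuple ar)
    (hφ : ∀ e ∈ E, ∃ e' ∈ E', ∀ w, φ (RelTuple.subst w e) = RelTuple.subst w e') :
    q.Hits D E' (Γ.image φ) := by
  intro w hw
  obtain ⟨e, he, hΓ⟩ := h w hw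
  obtain ⟨e', he', h'⟩ := hφ e he
  exact ⟨e', he', h' w ▸ Finset.mem_image_of_mem φ hΓ⟩

theorem Hits.mono {q : Query ar} {D : Database ar} {E E' Γ : Finset (RelTuple ar)}
    (h : q.Hits D E Γ) (hE : E ⊆ E') : q.Hits D E' Γ := fun w hw =>
  let ⟨e, he, h'⟩ := h w hw
  ⟨e, hE he, h'⟩

/-- The position map `f` is the same for all `B`-atoms, so the exchange is defined on facts alone,
without knowing the atom or the witness they stem from. -/
theorem MarkDominated.exists_map {q₁ q₂ : Query ar} (h : MarkDominated q₁ q₂) :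
    ∃ φ : RelTuple ar → RelTuple ar, ∀ e ∈ q₁.endo, ∃ e' ∈ q₂.endo,
      ∀ w, φ (RelTuple.subst w e) = RelTuple.subst w e' := by
  obtain ⟨A, B, ⟨hAB, hA, hB, f, hf⟩, hbody, hexo⟩ := h
  refine ⟨fun t => if ht : t.1 = B then
    ⟨A, fun i => t.2 (Fin.cast (congrArg ar ht.symm) (f i))⟩ else t, ?_⟩
  rintro ⟨S, v⟩ he
  obtain ⟨he1, he2⟩ := mem_endo.1 he
  by_cases hS : S = B
  · subst hS
    refine ⟨⟨A, fun i => v (f i)⟩, mem_endo.2 ⟨hbody ▸ hf v he1, ?_⟩, fun w => ?_⟩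
    · simp [hexo, hA, hAB]
    · simp [RelTuple.subst]
  · refine ⟨⟨S, v⟩, mem_endo.2 ⟨hbody ▸ he1, ?_⟩, fun w => ?_⟩
    · simpa [hexo, hS] using he2
    · simp [RelTuple.subst, hS]

theorem MarkDominated.body_eq {q₁ q₂ : Query ar}
    (h : Relation.ReflTransGen MarkDominated q₁ q₂) :
    q₂.body = q₁.body ∧ q₁.exo ⊆ q₂.exo := by
  induction h with
  | refl => exact ⟨rfl, subset_rfl⟩
  | tail _ h ih =>
    obtain ⟨A, B, -, hb, he⟩ := h
    exact ⟨hb.trans ih.1, ih.2.trans (he ▸ Finset.subset_insert _ _)⟩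

theorem Hits.of_markDominated {q q' : Query ar} {D : Database ar}
    (h : Relation.ReflTransGen MarkDominated q q') {Γ : Finset (RelTuple ar)}
    (hΓ : q.Hits D q.endo Γ) : ∃ Γ' : Finset (RelTuple ar), Γ'.card ≤ Γ.card ∧
      q.Hits D q'.endo Γ' := by
  induction h with
  | refl => exact ⟨Γ, le_rfl, hΓ⟩
  | tail _ h ih =>
    obtain ⟨Γ', hc, h'⟩ := ih
    obtain ⟨φ, hφ⟩ := h.exists_map
    exact ⟨Γ'.image φ, Finset.card_image_le.trans hc, h'.image φ hφ⟩

/-! #### The atoms `R(x,x)` and `R(x,y)` -/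

/-- Replaces `R(a,b)` by `R(a,a)`. -/
def toLoop (R : Fin ℓ) (t : RelTuple ar) : RelTuple ar :=
  if h : t.1 = R ∧ 0 < ar t.1 then ⟨t.1, fun _ => t.2 ⟨0, h.2⟩⟩ else t

/-- Both `R`-atoms have the same first argument, so under any substitution `toLoop` sends their
images to the image of `R(x,x)`. -/
theorem ContainsZ3.exists_atoms {q : Query ar} {R : Fin ℓ} (hz3 : q.ContainsZ3 R)
    (htwo : q.atomCount R = 2) : ∃ e₁ ∈ q.body, ∃ e₂ ∈ q.body, e₁.1 = R ∧ e₂.1 = R ∧ e₁ ≠ e₂ ∧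
      (∀ g ∈ q.body, g.1 = R → g = e₁ ∨ g = e₂) ∧ ar R = 2 ∧
      ∀ w, toLoop R (RelTuple.subst w e₁) = RelTuple.subst w e₁ ∧
        toLoop R (RelTuple.subst w e₂) = RelTuple.subst w e₁ := by
  obtain ⟨A, x, y, hxy, ⟨v, hv, hvx⟩, ⟨v', hv', hvy⟩, -⟩ := hz3
  have har : ar R = 2 := by simpa using congrArg List.length hvx
  have h1 : ∀ i, v i = x := fun i => by
    have : v i ∈ List.ofFn v := List.mem_ofFn.2 ⟨i, rfl⟩
    simpa [hvx] using this
  have h2 : v' ⟨0, by omega⟩ = x := by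
    have : (List.ofFn v')[0]'(by simp [har]) = x := by simp [hvy]
    simpa using this
  have h3 : v' ⟨1, by omega⟩ = y := by
    have : (List.ofFn v')[1]'(by simp [har]) = y := by simp [hvy]
    simpa using this
  have hne : (⟨R, v⟩ : RelTuple ar) ≠ ⟨R, v'⟩ := by
    intro h
    have : v = v' := by simpa using h
    exact hxy (by rw [← h3, ← this, h1])
  refine ⟨⟨R, v⟩, hv, ⟨R, v'⟩, hv', rfl, rfl, hne, fun g hg hgR => ?_, har, fun w => ?_⟩
  · by_contra hc
    push Not at hc
    have hsub : ({g, ⟨R, v⟩, ⟨R, v'⟩} : Finset (RelTuple ar)) ⊆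
        q.body.filter fun g => g.1 = R := by
      intro a ha
      simp only [Finset.mem_insert, Finset.mem_singleton] at ha
      rcases ha with rfl | rfl | rfl <;> simp [*]
    have := Finset.card_le_card hsub
    rw [Finset.card_insert_of_notMem (by simp [hc]), Finset.card_pair hne] at this
    rw [atomCount] at htwo
    omega
  · have h0 : 0 < ar R := by omega
    constructor
    · simp [toLoop, RelTuple.subst, h0, h1]
    · simp [toLoop, RelTuple.subst, h0, h1, h2]

/-- A witness hit in the image of `R(x,y)` is also hit by the corresponding loop. Facts outside the
database that the exchange may create are discarded afterwards. -/
theorem exists_contingencySet_of_loops {q : Query ar} {R : Fin ℓ} (hz3 : q.ContainsZ3 R)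
    (htwo : q.atomCount R = 2) {D Γ : Database ar} (h : q.IsContingencySet D Γ) :
    ∃ Γ' : Database ar, q.IsContingencySet D Γ' ∧ Γ'.card ≤ Γ.card ∧
      ∀ a b : ℕ, ∀ t ∈ Γ', t.1 = R → List.ofFn t.2 = [a, b] → a = b := by
  obtain ⟨e₁, he₁, e₂, he₂, h1, h2, -, huniq, har, hloop⟩ := hz3.exists_atoms htwo
  refine ⟨_, (h.hits.image (E' := q.endo) (toLoop R) ?_).isContingencySet,
    (Finset.card_filter_le _ _).trans Finset.card_image_le, ?_⟩
  · intro e he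
    obtain ⟨heb, hee⟩ := mem_endo.1 he
    by_cases hR : e.1 = R
    · refine ⟨e₁, mem_endo.2 ⟨he₁, by rwa [h1, ← hR]⟩, fun w => ?_⟩
      rcases huniq e heb hR with rfl | rfl
      exacts [(hloop w).1, (hloop w).2]
    · exact ⟨e, he, fun w => by simp [toLoop, RelTuple.subst, hR]⟩
  · rintro a b t ht hR hab
    obtain ⟨s, -, rfl⟩ := Finset.mem_image.1 (Finset.mem_filter.1 ht).1
    by_cases hs : s.1 = R ∧ 0 < ar s.1
    · rw [toLoop, dif_pos hs] at hab
      rw [List.ofFn_const] at hab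
      have hall : ∀ c ∈ [a, b], c = s.2 ⟨0, hs.2⟩ := fun c hc =>
        List.eq_of_mem_replicate (hab ▸ hc)
      exact (hall a (by simp)).trans (hall b (by simp)).symm
    · rw [toLoop, dif_neg hs] at hR
      exact (hs ⟨hR, by rw [hR, har]; norm_num⟩).elim

/-! #### Linear order of the endogenous atoms -/

/-- Two variables occur in a common atom. -/
def Adj (q : Query ar) (u v : ℕ) : Prop := ∃ g ∈ q.body, u ∈ g.vars ∧ v ∈ g.vars

theorem Adj.symm (q : Query ar) (u v : ℕ) : q.Adj u v → q.Adj v u :=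
  fun ⟨g, hg, hu, hv⟩ => ⟨g, hg, hv, hu⟩

/-- The atoms that make consecutive variables adjacent form the path of atoms, and the variables of
the given path become its links. -/
theorem pathAvoiding_of_linked {q : Query ar} {X : Set ℕ} {g h : RelTuple ar} (hg : g ∈ q.body)
    (hh : h ∈ q.body) (hl : Linked q.Adj X g.vars h.vars) : q.PathAvoiding X g h := by
  obtain ⟨u, hu, v, hv, huX, hvX, hc⟩ := hl
  have key : ∀ w, Conn q.Adj X u w → w ∉ X → ∀ g' ∈ q.body, w ∈ g'.vars →
      q.PathAvoiding X g g' := by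
    intro w hw
    induction hw with
    | refl => exact fun _ g' hg' hw => .single ⟨hg, hg', u, hu, hw, huX⟩
    | tail _ hbc ih =>
      intro _ g' hg' hw
      obtain ⟨hb, hc, k, hk, h1, h2⟩ := hbc
      exact (ih hb k hk h1).tail ⟨hk, hg', _, h2, hw, hc⟩
  exact key v hc hvX h hh hv

/-- The variables of an atom form a clique of `q.Adj`, with at most two elements by `hbin`; a
violation of the three-element condition is a triad. -/
theorem exists_separatingOrder_of_pseudoLinear {q : Query ar} (hbin : q.IsBinary)
    (hlin : q.PseudoLinear) {E : Finset (RelTuple ar)} (hE : E ⊆ q.endo) :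
    ∃ pos : RelTuple ar → ℤ, SeparatingOrder q.Adj RelTuple.vars E pos := by
  refine exists_separatingOrder (Adj.symm q) E
    (fun a ha u hu v hv => ⟨a, (mem_endo.1 (hE ha)).1, hu, hv⟩) ?_ ?_
  · rintro a ha _ ⟨i, rfl⟩ _ ⟨j, rfl⟩ hxy _ ⟨k, rfl⟩
    have h := hbin a (mem_endo.1 (hE ha)).1
    have hij : i ≠ j := fun h => hxy (h ▸ rfl)
    have hij' : (i : ℕ) ≠ j := fun h => hij (Fin.ext h)
    have hk : k = i ∨ k = j := by
      have := i.2; have := j.2; have := k.2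
      simp only [Fin.ext_iff]
      omega
    rcases hk with rfl | rfl <;> simp
  · intro a ha b hb c hc hab hbc hac h1 h2 h3
    have hm : ∀ {e}, e ∈ E → e ∈ q.body ∧ e.1 ∉ q.exo := fun he => mem_endo.1 (hE he)
    have hs := Adj.symm q
    have P : ∀ {x y z : RelTuple ar}, x ∈ E → y ∈ E → Linked q.Adj (RelTuple.vars z) x.vars y.vars →
      q.PathAvoiding z.vars x y := fun hx hy h => pathAvoiding_of_linked (hm hx).1 (hm hy).1 h
    refine hlin ⟨![a, b, c], ?_, ?_, ?_⟩
    · intro i j hij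
      fin_cases i <;> fin_cases j <;> simp_all
    · intro i
      fin_cases i
      exacts [hm ha, hm hb, hm hc]
    · intro i j k hij hik hjk
      fin_cases i <;> fin_cases j <;> fin_cases k <;>
        first
        | exact absurd rfl hij
        | exact absurd rfl hik
        | exact absurd rfl hjk
        | exact P ha hb h3
        | exact P hb ha (h3.symm hs)
        | exact P ha hc h2
        | exact P hc ha (h2.symm hs)
        | exact P hb hc h1
        | exact P hc hb (h1.symm hs)

/-- Two witnesses that agree on an atom can be combined along a separating order. -/
theorem Witness.splice {q : Query ar} {D : Database ar} {E : Finset (RelTuple ar)}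
    {pos : RelTuple ar → ℤ} (hpos : SeparatingOrder q.Adj RelTuple.vars E pos)
    {w w' : ℕ → ℕ} (hw : q.Witness D w) (hw' : q.Witness D w') {e : RelTuple ar} (he : e ∈ E)
    (hee : RelTuple.subst w e = RelTuple.subst w' e) :
    ∃ w'', q.Witness D w'' ∧
      (∀ a ∈ E, pos a ≤ pos e → RelTuple.subst w'' a = RelTuple.subst w a) ∧
      (∀ a ∈ E, pos e ≤ pos a → RelTuple.subst w'' a = RelTuple.subst w' a) := by
  classical
  have hagree : ∀ v ∈ e.vars, w v = w' v := by
    rintro _ ⟨i, rfl⟩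
    have : (fun i => w (e.2 i)) = fun i => w' (e.2 i) := by simpa [RelTuple.subst] using hee
    exact congrFun this i
  -- The variables that atoms left of `e` reach without crossing `e`. The new substitution follows
  -- `w` on these and `w'` elsewhere. An atom with a variable in `P` has all its other variables in
  -- `P` or in `e`, where `w` and `w'` agree, so every atom is mapped as by `w` or as by `w'`.
  let P : ℕ → Prop := fun v => v ∉ e.vars ∧
    ∃ a ∈ E, pos a < pos e ∧ ∃ u ∈ a.vars, u ∉ e.vars ∧ Conn q.Adj e.vars u v
  let w'' : ℕ → ℕ := fun v => if P v then w v else w' v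
  have hl : ∀ g : RelTuple ar, (∀ v ∈ g.vars, v ∈ e.vars ∨ P v) →
      RelTuple.subst w'' g = RelTuple.subst w g := by
    intro g hg
    have : (fun i => w'' (g.2 i)) = fun i => w (g.2 i) := by
      funext i
      by_cases hP : P (g.2 i)
      · simp [w'', hP]
      · have := (hg (g.2 i) ⟨i, rfl⟩).resolve_right hP
        simp [w'', hP, hagree _ this]
    simp only [RelTuple.subst, this]
  have hr : ∀ g : RelTuple ar, (∀ v ∈ g.vars, ¬ P v) →
      RelTuple.subst w'' g = RelTuple.subst w' g := by
    intro g hg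
    have : (fun i => w'' (g.2 i)) = fun i => w' (g.2 i) := by
      funext i
      simp [w'', hg (g.2 i) ⟨i, rfl⟩]
    simp only [RelTuple.subst, this]
  have he' : RelTuple.subst w'' e = RelTuple.subst w e := hl e fun v hv => .inl hv
  refine ⟨w'', fun g hg => ?_, fun a ha hle => ?_, fun a ha hle => ?_⟩
  · by_cases h : ∃ v ∈ g.vars, P v
    · obtain ⟨v, hv, hve, a, ha, hae, u, hu, hue, hc⟩ := h
      rw [hl g fun v' hv' => ?_]
      · exact hw g hg
      · by_cases hv'e : v' ∈ e.vars
        · exact .inl hv'e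
        · exact .inr ⟨hv'e, a, ha, hae, u, hu, hue, hc.tail ⟨hve, hv'e, g, hg, hv, hv'⟩⟩
    · push Not at h
      rw [hr g h]
      exact hw' g hg
  · rcases hle.lt_or_eq with hlt | heq
    · refine hl a fun v hv => ?_
      by_cases hve : v ∈ e.vars
      · exact .inl hve
      · exact .inr ⟨hve, a, ha, hlt, v, hv, hve, .refl⟩
    · rw [hpos.1 a ha e he heq, he']
  · rcases hle.lt_or_eq with hlt | heq
    · refine hr a fun v hv hP => ?_
      obtain ⟨hve, b, hb, hbe, u, hu, hue, hc⟩ := hP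
      exact hpos.2 b hb e he a ha hbe hlt ⟨u, hu, v, hv, hue, hve, hc⟩
    · rw [← hpos.1 e he a ha heq, he', hee]

end Query

/-! ### Hitting sets of layered systems and vertex covers of bipartite graphs -/

namespace Layered

/-- `CL` and `CR` form a vertex cover of the bipartite graph `adj`. -/
def IsCover {α : Type*} (adj : α → α → Prop) (CL CR : Finset α) : Prop :=
  ∀ u v, adj u v → u ∈ CL ∨ v ∈ CR

variable {ω α : Type*}

/-- For a system of paths that can be recombined wherever they meet, hitting sets correspond to
vertex covers of the graph whose edges are the steps of the paths and, for each vertex that is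
neither first nor last, the pair of its two copies. -/
theorem exists_hitting_iff_exists_cover {W : Set ω} {m : ℕ} (hm : 2 ≤ m) {proj : ω → ℕ → α}
    (hinj : ∀ w ∈ W, ∀ w' ∈ W, ∀ i < m, ∀ j < m, proj w i = proj w' j → i = j)
    (hsplice : ∀ w ∈ W, ∀ w' ∈ W, ∀ i < m, proj w i = proj w' i → ∃ w'' ∈ W,
      (∀ j ≤ i, proj w'' j = proj w j) ∧ ∀ j < m, i ≤ j → proj w'' j = proj w' j)
    {U I : Finset α} (hU : ∀ w ∈ W, ∀ i < m, proj w i ∈ U)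
    (hI : ∀ u, u ∈ I ↔ ∃ w ∈ W, ∃ i, 0 < i ∧ i + 1 < m ∧ proj w i = u) {adj : α → α → Prop}
    (hadj : ∀ u v, adj u v ↔ (∃ w ∈ W, ∃ i, i + 1 < m ∧ proj w i = u ∧ proj w (i + 1) = v) ∨
      (u = v ∧ u ∈ I)) (k : ℕ) :
    (∃ Γ : Finset α, Γ.card ≤ k ∧ ∀ w ∈ W, ∃ i < m, proj w i ∈ Γ) ↔
      ∃ CL CR : Finset α, CL.card + CR.card ≤ k + I.card ∧ IsCover adj CL CR := by
  classical
  let first : α → Prop := fun u => ∃ w ∈ W, proj w 0 = u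
  let last : α → Prop := fun u => ∃ w ∈ W, proj w (m - 1) = u
  have hfl : ∀ u, first u → last u → False := by
    rintro u ⟨w, hw, h1⟩ ⟨w', hw', h2⟩
    have := hinj w hw w' hw' 0 (by omega) (m - 1) (by omega) (h1.trans h2.symm)
    omega
  have hfI : ∀ u, first u → u ∉ I := by
    rintro u ⟨w, hw, h1⟩ h2
    obtain ⟨w', hw', i, h3, h4, h5⟩ := (hI u).1 h2
    have := hinj w hw w' hw' 0 (by omega) i (by omega) (h1.trans h5.symm)
    omega
  have hlI : ∀ u, last u → u ∉ I := by
    rintro u ⟨w, hw, h1⟩ h2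
    obtain ⟨w', hw', i, h3, h4, h5⟩ := (hI u).1 h2
    have := hinj w hw w' hw' (m - 1) (by omega) i (by omega) (h1.trans h5.symm)
    omega
  have hcases : ∀ w ∈ W, ∀ i < m, i = 0 ∨ i = m - 1 ∨ proj w i ∈ I := by
    intro w hw i hi
    by_cases h0 : i = 0
    · exact .inl h0
    by_cases h1 : i = m - 1
    · exact .inr (.inl h1)
    · exact .inr (.inr ((hI _).2 ⟨w, hw, i, by omega, by omega, rfl⟩))
  constructor
  · rintro ⟨Γ, hk, hΓ⟩
    -- Some path arrives at a `pre` vertex without having met `Γ`, and at a `post` vertex even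
    -- without the vertex itself being in `Γ`.
    let post : α → Prop := fun u => ∃ w ∈ W, ∃ i < m, proj w i = u ∧ ∀ j ≤ i, proj w j ∉ Γ
    let pre : α → Prop := fun u => ∃ w ∈ W, ∃ i < m, proj w i = u ∧ ∀ j < i, proj w j ∉ Γ
    -- Left copies are chosen where no unblocked path leaves, right copies where one arrives. An
    -- inner vertex with both copies chosen lies in `Γ`, as do the chosen first and last vertices,
    -- so the excess over `I.card` is at most `Γ.card`.
    let A := U.filter fun u => first u ∧ ¬ post u
    let B := U.filter fun u => last u ∧ pre u
    let P := I.filter fun u => ¬ post u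
    let Q := I.filter fun u => pre u
    have hpp : ∀ u, post u → pre u := fun u ⟨w, hw, i, hi, h1, h2⟩ =>
      ⟨w, hw, i, hi, h1, fun j hj => h2 j hj.le⟩
    refine ⟨A ∪ P, B ∪ Q, ?_, ?_⟩
    · have hA : ∀ u ∈ A, u ∈ Γ ∧ first u := by
        intro u hu
        obtain ⟨-, ⟨w, hw, h1⟩, h2⟩ := Finset.mem_filter.1 hu
        refine ⟨?_, w, hw, h1⟩
        by_contra hc
        refine h2 ⟨w, hw, 0, by omega, h1, fun j hj => ?_⟩
        obtain rfl : j = 0 := by omega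
        rwa [h1]
      have hB : ∀ u ∈ B, u ∈ Γ ∧ last u := by
        intro u hu
        obtain ⟨-, h1, w, hw, i, hi, h2, h3⟩ := Finset.mem_filter.1 hu
        obtain ⟨j, hj, hjΓ⟩ := hΓ w hw
        obtain ⟨w', hw', h4⟩ := h1
        have him := hinj w hw w' hw' i hi (m - 1) (by omega) (h2.trans h4.symm)
        have hji : ¬ j < i := fun h => h3 j h hjΓ
        obtain rfl : j = i := by omega
        exact ⟨h2 ▸ hjΓ, w', hw', h4⟩
      have hPQ : ∀ u ∈ P ∩ Q, u ∈ Γ ∧ u ∈ I := by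
        intro u hu
        obtain ⟨h1, h2⟩ := Finset.mem_inter.1 hu
        obtain ⟨hu, h3⟩ := Finset.mem_filter.1 h1
        obtain ⟨-, w, hw, i, hi, h4, h5⟩ := Finset.mem_filter.1 h2
        refine ⟨?_, hu⟩
        by_contra hc
        refine h3 ⟨w, hw, i, hi, h4, fun j hj => ?_⟩
        rcases hj.lt_or_eq with hj | rfl
        · exact h5 j hj
        · rwa [h4]
      have hdAB : Disjoint A B := Finset.disjoint_left.2 fun u h1 h2 =>
        hfl u (hA u h1).2 (hB u h2).2
      have hdABPQ : Disjoint (A ∪ B) (P ∩ Q) := Finset.disjoint_left.2 fun u h1 h2 => by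
        rcases Finset.mem_union.1 h1 with h1 | h1
        · exact hfI u (hA u h1).2 (hPQ u h2).2
        · exact hlI u (hB u h1).2 (hPQ u h2).2
      have hsub : A ∪ B ∪ P ∩ Q ⊆ Γ := by
        intro u hu
        rcases Finset.mem_union.1 hu with hu | hu
        · rcases Finset.mem_union.1 hu with hu | hu
          · exact (hA u hu).1
          · exact (hB u hu).1
        · exact (hPQ u hu).1
      have h1 := Finset.card_le_card hsub
      rw [Finset.card_union_of_disjoint hdABPQ, Finset.card_union_of_disjoint hdAB] at h1
      have h2 := Finset.card_union_add_card_inter P Q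
      have h3 : (P ∪ Q).card ≤ I.card := Finset.card_le_card
        (Finset.union_subset (Finset.filter_subset _ _) (Finset.filter_subset _ _))
      have h4 := Finset.card_union_le A P
      have h5 := Finset.card_union_le B Q
      omega
    · intro u v huv
      by_contra hc
      push Not at hc
      obtain ⟨hcL, hcR⟩ := hc
      rcases (hadj u v).1 huv with ⟨w, hw, i, hi, rfl, rfl⟩ | ⟨rfl, hu⟩
      · have hp : post (proj w i) := by
          by_contra hnp
          apply hcL
          rcases hcases w hw i (by omega) with h0 | h0 | h0
          · exact Finset.mem_union_left _
              (Finset.mem_filter.2 ⟨hU w hw i (by omega), ⟨w, hw, h0 ▸ rfl⟩, hnp⟩)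
          · omega
          · exact Finset.mem_union_right _ (Finset.mem_filter.2 ⟨h0, hnp⟩)
        obtain ⟨w', hw', i', hi', h1, h2⟩ := hp
        obtain rfl := hinj w' hw' w hw i' hi' i (by omega) h1
        -- An unblocked path to the common vertex, continued along `w`, makes the next vertex `pre`.
        obtain ⟨w'', hw'', h3, h4⟩ := hsplice w' hw' w hw i' hi' h1
        have hpre : pre (proj w (i' + 1)) :=
          ⟨w'', hw'', i' + 1, hi, h4 _ hi (by omega), fun j hj => by
            rw [h3 j (by omega)]; exact h2 j (by omega)⟩
        apply hcR
        rcases hcases w hw (i' + 1) (by omega) with h0 | h0 | h0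
        · omega
        · exact Finset.mem_union_left _
            (Finset.mem_filter.2 ⟨hU w hw _ hi, ⟨w, hw, h0 ▸ rfl⟩, hpre⟩)
        · exact Finset.mem_union_right _ (Finset.mem_filter.2 ⟨h0, hpre⟩)
      · by_cases hp : post u
        · exact hcR (Finset.mem_union_right _ (Finset.mem_filter.2 ⟨hu, hpp u hp⟩))
        · exact hcL (Finset.mem_union_right _ (Finset.mem_filter.2 ⟨hu, hp⟩))
  · rintro ⟨CL, CR, hk, hc⟩
    -- First and last vertices count with their single relevant copy, inner ones only if both copies
    -- are in the cover. The diagonal edges put at least one copy of each inner vertex into the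
    -- cover, which accounts for `I.card`.
    let A := CL.filter first
    let B := CR.filter last
    let P := I ∩ CL
    let Q := I ∩ CR
    refine ⟨A ∪ B ∪ P ∩ Q, ?_, fun w hw => ?_⟩
    · have h1 := Finset.card_union_le (A ∪ B) (P ∩ Q)
      have h2 := Finset.card_union_le A B
      have h3 := Finset.card_union_add_card_inter P Q
      have h4 : I.card ≤ (P ∪ Q).card := Finset.card_le_card fun u hu => by
        rcases hc u u ((hadj u u).2 (.inr ⟨rfl, hu⟩)) with h | h
        · exact Finset.mem_union_left _ (Finset.mem_inter.2 ⟨hu, h⟩)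
        · exact Finset.mem_union_right _ (Finset.mem_inter.2 ⟨hu, h⟩)
      have h5 : A.card + P.card ≤ CL.card := by
        rw [← Finset.card_union_of_disjoint]
        · exact Finset.card_le_card
            (Finset.union_subset (Finset.filter_subset _ _) Finset.inter_subset_right)
        · exact Finset.disjoint_left.2 fun u h1 h2 =>
            hfI u (Finset.mem_filter.1 h1).2 (Finset.mem_inter.1 h2).1
      have h6 : B.card + Q.card ≤ CR.card := by
        rw [← Finset.card_union_of_disjoint]
        · exact Finset.card_le_card
            (Finset.union_subset (Finset.filter_subset _ _) Finset.inter_subset_right)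
        · exact Finset.disjoint_left.2 fun u h1 h2 =>
            hlI u (Finset.mem_filter.1 h1).2 (Finset.mem_inter.1 h2).1
      omega
    · by_contra hno
      push Not at hno
      -- Along a path that is not hit, each left copy is missing from the cover, so the step edges
      -- force the next right copy into it, up to the last vertex.
      have key : ∀ i, i + 1 < m → proj w (i + 1) ∈ CR := by
        intro i
        induction i with
        | zero =>
          intro h
          rcases hc _ _ ((hadj _ _).2 (.inl ⟨w, hw, 0, h, rfl, rfl⟩)) with h1 | h1
          · refine (hno 0 (by omega) ?_).elim
            exact Finset.mem_union_left _ (Finset.mem_union_left _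
              (Finset.mem_filter.2 ⟨h1, w, hw, rfl⟩))
          · exact h1
        | succ i ih =>
          intro h
          have h0 := ih (by omega)
          rcases hc _ _ ((hadj _ _).2 (.inl ⟨w, hw, i + 1, h, rfl, rfl⟩)) with h1 | h1
          · have h2 : proj w (i + 1) ∈ I := (hI _).2 ⟨w, hw, i + 1, by omega, h, rfl⟩
            refine (hno (i + 1) (by omega) ?_).elim
            exact Finset.mem_union_right _ (Finset.mem_inter.2
              ⟨Finset.mem_inter.2 ⟨h2, h1⟩, Finset.mem_inter.2 ⟨h2, h0⟩⟩)
          · exact h1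
      have h1 := key (m - 2) (by omega)
      rw [show m - 2 + 1 = m - 1 by omega] at h1
      exact hno (m - 1) (by omega) (Finset.mem_union_left _ (Finset.mem_union_right _
        (Finset.mem_filter.2 ⟨h1, w, hw, rfl⟩)))

end Layered

/-! ### Minimum vertex covers of bipartite graphs by an auction -/

namespace Auction

open Layered

/-- The invariant: `o v = u + 1` says that the left vertex `u` owns the right vertex `v`, at
price `p v`. -/
structure Inv (n : ℕ) (adj : ℕ → ℕ → Prop) (p o : ℕ → ℕ) : Prop where
  price_eq_zero : ∀ v < n, p v = 0 ↔ o v = 0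
  inj : ∀ v < n, ∀ v' < n, o v ≠ 0 → o v = o v' → v = v'
  edge : ∀ v < n, ∀ u, o v = u + 1 → adj u v ∧ ∀ v' < n, adj u v' → p v ≤ p v' + 1
  price_le : ∀ v < n, p v ≤ n

/-- `u` owns nothing and bids for its cheapest neighbour `v`. -/
def Bids (n : ℕ) (adj : ℕ → ℕ → Prop) (p o : ℕ → ℕ) (u v : ℕ) : Prop :=
  adj u v ∧ (∀ v' < n, o v' ≠ u + 1) ∧ p v < n ∧ ∀ v' < n, adj u v' → p v ≤ p v'

theorem Inv.zero (n : ℕ) (adj : ℕ → ℕ → Prop) : Inv n adj (fun _ => 0) (fun _ => 0) := by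
  constructor <;> simp

theorem Inv.congr {n : ℕ} {adj : ℕ → ℕ → Prop} {p o p' o' : ℕ → ℕ} (h : Inv n adj p o)
    (hp : ∀ v < n, p' v = p v) (ho : ∀ v < n, o' v = o v) : Inv n adj p' o' where
  price_eq_zero v hv := by rw [hp v hv, ho v hv]; exact h.price_eq_zero v hv
  inj v hv v' hv' := by rw [ho v hv, ho v' hv']; exact h.inj v hv v' hv'
  edge v hv u := by
    rw [ho v hv, hp v hv]
    intro hu
    refine ⟨(h.edge v hv u hu).1, fun v' hv' hadj => ?_⟩
    rw [hp v' hv']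
    exact (h.edge v hv u hu).2 v' hv' hadj
  price_le v hv := by rw [hp v hv]; exact h.price_le v hv

/-- Prices only rise, so the remaining owners still hold a vertex within `1` of their cheapest
neighbour. The bidder picked a cheapest one, which exceeds the others by at most `1` after the
increase. -/
theorem Inv.bid {n : ℕ} {adj : ℕ → ℕ → Prop} {p o : ℕ → ℕ} (h : Inv n adj p o) {u v : ℕ}
    (hb : Bids n adj p o u v) :
    Inv n adj (Function.update p v (p v + 1)) (Function.update o v (u + 1)) := by
  obtain ⟨hadj, hfree, hlt, hmin⟩ := hb
  have hmono : ∀ x, p x ≤ Function.update p v (p v + 1) x := fun x => by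
    by_cases hx : x = v
    · subst hx; simp
    · simp [hx]
  constructor
  · intro x hx
    by_cases hxv : x = v
    · subst hxv; simp
    · simpa [hxv] using h.price_eq_zero x hx
  · intro x hx y hy
    by_cases hxv : x = v <;> by_cases hyv : y = v
    · subst hxv; subst hyv; simp
    · subst hxv
      simp only [Function.update_self, Function.update_of_ne hyv]
      exact fun _ he => (hfree y hy he.symm).elim
    · subst hyv
      simp only [Function.update_self, Function.update_of_ne hxv]
      exact fun _ he => (hfree x hx he).elim
    · simpa [hxv, hyv] using h.inj x hx y hy
  · intro x hx u' hu'
    by_cases hxv : x = v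
    · subst hxv
      simp only [Function.update_self] at hu' ⊢
      obtain rfl : u = u' := by omega
      exact ⟨hadj, fun v' hv' ha => by
        have := hmin v' hv' ha
        have := hmono v'
        omega⟩
    · simp only [Function.update_of_ne hxv] at hu' ⊢
      refine ⟨(h.edge x hx u' hu').1, fun v' hv' ha => ?_⟩
      have := (h.edge x hx u' hu').2 v' hv' ha
      have := hmono v'
      omega
  · intro x hx
    by_cases hxv : x = v
    · subst hxv; simpa using hlt
    · simpa [hxv] using h.price_le x hx

/-- When no bids are left, the number of sold vertices is the size of a minimum vertex cover. -/
theorem Inv.exists_cover_iff {n : ℕ} {adj : ℕ → ℕ → Prop} {p o : ℕ → ℕ} (h : Inv n adj p o)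
    (hn : ∀ u v, adj u v → u < n ∧ v < n) (hs : ∀ u < n, ∀ v < n, ¬ Bids n adj p o u v) (k : ℕ) :
    (∃ CL CR : Finset ℕ, CL.card + CR.card ≤ k ∧ IsCover adj CL CR) ↔
      ((Finset.range n).filter fun v => p v ≠ 0).card ≤ k := by
  have hown : ∀ v < n, p v ≠ 0 → o v = (o v - 1) + 1 := fun v hv hp => by
    have := (h.price_eq_zero v hv).not.1 hp
    omega
  set S := (Finset.range n).filter fun v => p v ≠ 0 with hS
  have memS : ∀ v, v ∈ S ↔ v < n ∧ p v ≠ 0 := fun v => by simp [hS]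
  constructor
  · rintro ⟨CL, CR, hk, hc⟩
    have hle : S.card ≤ (CL.disjSum CR).card := by
      -- Sold vertices and their owners form a matching; each matching edge is sent to an endpoint
      -- in the cover.
      refine Finset.card_le_card_of_injOn
        (fun v => if v ∈ CR then Sum.inr v else Sum.inl (o v - 1)) ?_ ?_
      · intro v hv
        obtain ⟨hv, hp⟩ := (memS v).1 hv
        by_cases hcr : v ∈ CR
        · simp [hcr]
        · have := (hc _ v (h.edge v hv (o v - 1) (hown v hv hp)).1).resolve_right hcr
          simpa [hcr] using this
      · intro v hv v' hv' he
        obtain ⟨hv, hp⟩ := (memS v).1 hv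
        obtain ⟨hv', hp'⟩ := (memS v').1 hv'
        by_cases h1 : v ∈ CR <;> by_cases h2 : v' ∈ CR <;> simp [h1, h2] at he
        · exact he
        · have h3 := hown v hv hp
          have h4 := hown v' hv' hp'
          exact h.inj v hv v' hv' (by omega) (by omega)
    rw [Finset.card_disjSum] at hle
    omega
  · intro hk
    -- The `n` right vertices cannot realise all the `n + 1` prices `0, …, n`.
    obtain ⟨j, hj, hgap⟩ : ∃ j ≤ n, ∀ v < n, p v ≠ j := by
      by_contra hcon
      push Not at hcon
      have : (Finset.range (n + 1)).card ≤ (Finset.range n).card := by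
        refine (Finset.card_le_card fun j hj => ?_).trans (Finset.card_image_le (f := p))
        obtain ⟨v, hv, hvj⟩ := hcon j (by simpa [Nat.lt_succ_iff] using hj)
        exact Finset.mem_image.2 ⟨v, by simpa using hv, hvj⟩
      simp at this
    -- Above the gap the sold vertices themselves are taken, below it their owners.
    refine ⟨(S.filter fun v => p v < j).image fun v => o v - 1, S.filter fun v => ¬ p v < j,
      ?_, fun u v huv => ?_⟩
    · have h1 := Finset.card_image_le (s := S.filter fun v => p v < j) (f := fun v => o v - 1)
      have h2 := Finset.card_filter_add_card_filter_not (s := S) (fun v => p v < j)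
      omega
    · obtain ⟨hu, hv⟩ := hn u v huv
      by_cases hpv : p v < j
      · left
        -- Otherwise `u` could bid, since its cheapest neighbour costs at most `p v < j ≤ n`. What
        -- `u` owns costs at most `p v + 1 ≤ j`, hence less than `j` by the gap.
        have hex : ∃ v' < n, o v' = u + 1 := by
          by_contra hno
          push Not at hno
          classical
          obtain ⟨x, hx, hxmin⟩ := ((Finset.range n).filter fun x => adj u x).exists_min_image p
            ⟨v, by simp [hv, huv]⟩
          simp only [Finset.mem_filter, Finset.mem_range] at hx hxmin
          refine hs u hu x hx.1 ⟨hx.2, hno, ?_, fun y hy ha => hxmin y ⟨hy, ha⟩⟩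
          have := hxmin v ⟨hv, huv⟩
          omega
        obtain ⟨v', hv', ho⟩ := hex
        have h1 := (h.edge v' hv' u ho).2 v hv huv
        have h2 := hgap v' hv'
        have h3 : p v' ≠ 0 := fun h0 => by
          have := (h.price_eq_zero v' hv').1 h0
          omega
        exact Finset.mem_image.2 ⟨v', Finset.mem_filter.2 ⟨(memS v').2 ⟨hv', h3⟩, by omega⟩,
          by omega⟩
      · right
        have h2 := hgap v hv
        exact Finset.mem_filter.2 ⟨(memS v).2 ⟨hv, by omega⟩, hpv⟩

end Auction

/-! ### A language of loop programs with polynomial running time -/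

namespace Loop

/-- Assigns to a register. -/
def setReg (s : RAMState) (i c : ℕ) : RAMState := { s with reg := Function.update s.reg i c }

/-- Assigns to a memory cell. -/
def setMem (s : RAMState) (i c : ℕ) : RAMState := { s with mem := Function.update s.mem i c }

@[simp] theorem setReg_mem (s : RAMState) (i c : ℕ) : (setReg s i c).mem = s.mem := rfl
@[simp] theorem setMem_reg (s : RAMState) (i c : ℕ) : (setMem s i c).reg = s.reg := rfl
@[simp] theorem setReg_reg_self (s : RAMState) (i c : ℕ) : (setReg s i c).reg i = c := by
  simp [setReg]
theorem setReg_reg_of_ne (s : RAMState) {i j : ℕ} (c : ℕ) (h : j ≠ i) :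
    (setReg s i c).reg j = s.reg j := by simp [setReg, h]
theorem setReg_reg (s : RAMState) (i j c : ℕ) :
    (setReg s i c).reg j = if j = i then c else s.reg j := by
  by_cases h : j = i <;> simp [setReg, h]
theorem setMem_mem (s : RAMState) (i j c : ℕ) :
    (setMem s i c).mem j = if j = i then c else s.mem j := by
  by_cases h : j = i <;> simp [setMem, h]

/-- Expressions. Sums range over all numbers below the content of register `0`. -/
inductive Ex : Type
  | num (c : ℕ)
  | var (i : ℕ)
  | add (a b : Ex)
  | sub (a b : Ex)
  | get (a : Ex)
  | cond (a b c : Ex)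
  | sum (i : ℕ) (a : Ex)

namespace Ex

/-- The value of an expression. -/
def eval : Ex → RAMState → ℕ
  | num c, _ => c
  | var i, s => s.reg i
  | add a b, s => a.eval s + b.eval s
  | sub a b, s => a.eval s - b.eval s
  | get a, s => s.mem (a.eval s)
  | cond a b c, s => if a.eval s ≠ 0 then b.eval s else c.eval s
  | sum i a, s => ∑ v ∈ Finset.range (s.reg 0), a.eval (setReg s i v)

/-- All registers in the expression are below `d`, and register `0` is not bound. -/
def Below (d : ℕ) : Ex → Prop
  | num _ => True
  | var i => i < d
  | add a b => a.Below d ∧ b.Below d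
  | sub a b => a.Below d ∧ b.Below d
  | get a => a.Below d
  | cond a b c => a.Below d ∧ b.Below d ∧ c.Below d
  | sum i a => i ≠ 0 ∧ i < d ∧ a.Below d

theorem Below.mono {d d' : ℕ} (h : d ≤ d') : ∀ {e : Ex}, e.Below d → e.Below d'
  | num _, _ => trivial
  | var _, hi => lt_of_lt_of_le hi h
  | add _ _, ha => ⟨ha.1.mono h, ha.2.mono h⟩
  | sub _ _, ha => ⟨ha.1.mono h, ha.2.mono h⟩
  | get a, ha => Below.mono (e := a) h ha
  | cond _ _ _, ha => ⟨ha.1.mono h, ha.2.1.mono h, ha.2.2.mono h⟩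
  | sum _ _, ha => ⟨ha.1, lt_of_lt_of_le ha.2.1 h, ha.2.2.mono h⟩

/-- The program that leaves the value of the expression in register `d`, with the registers from
`d` on as work space. -/
def compile : Ex → ℕ → RAMProg
  | num c, d => .const d c
  | var i, d => .seq (.const d 0) (.add d d i)
  | add a b, d => .seq (a.compile d) (.seq (b.compile (d + 1)) (.add d d (d + 1)))
  | sub a b, d => .seq (a.compile d) (.seq (b.compile (d + 1)) (.sub d d (d + 1)))
  | get a, d => .seq (a.compile d) (.load d d)
  | cond a b c, d => .seq (a.compile d) (.ite d (b.compile d) (c.compile d))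
  | sum i a, d =>
    .seq (.const d 0) <| .seq (.add (d + 1) d i) <| .seq (.add (d + 2) d 0) <|
    .seq (.const (d + 3) 1) <| .seq
      (.loop (d + 2) <| .seq (.sub (d + 2) (d + 2) (d + 3)) <| .seq (.const i 0) <|
        .seq (.add i i (d + 2)) <| .seq (a.compile (d + 4)) (.add d d (d + 4))) <|
    .seq (.const i 0) (.add i i (d + 1))

/-- A bound for the number of steps in terms of register `0`. -/
noncomputable def cost : Ex → Polynomial ℕ
  | num _ => 1
  | var _ => 2
  | add a b => a.cost + b.cost + 1
  | sub a b => a.cost + b.cost + 1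
  | get a => a.cost + 1
  | cond a b c => a.cost + b.cost + c.cost + 1
  | sum _ a => Polynomial.X * (a.cost + 5) + 7

end Ex

/-- Two states agree on the memory and on the registers below `d`. -/
def Agree (d : ℕ) (s s' : RAMState) : Prop := s.mem = s'.mem ∧ ∀ i < d, s.reg i = s'.reg i

theorem Agree.trans {d : ℕ} {s s' s'' : RAMState} (h : Agree d s s') (h' : Agree d s' s'') :
    Agree d s s'' := ⟨h.1.trans h'.1, fun i hi => (h.2 i hi).trans (h'.2 i hi)⟩

theorem Agree.mono {d d' : ℕ} {s s' : RAMState} (h : Agree d' s s') (hd : d ≤ d') :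
    Agree d s s' := ⟨h.1, fun i hi => h.2 i (hi.trans_le hd)⟩

theorem Agree.setReg {d : ℕ} {s s' : RAMState} (h : Agree d s s') (i c : ℕ) :
    Agree d (setReg s i c) (setReg s' i c) :=
  ⟨h.1, fun j hj => by simp [setReg_reg, h.2 j hj]⟩

theorem Agree.setMem {d : ℕ} {s s' : RAMState} (h : Agree d s s') (i c : ℕ) :
    Agree d (setMem s i c) (setMem s' i c) :=
  ⟨by simp [Loop.setMem, h.1], h.2⟩

theorem agree_setReg {d i : ℕ} (s : RAMState) (c : ℕ) (h : d ≤ i) : Agree d (setReg s i c) s :=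
  ⟨rfl, fun j hj => setReg_reg_of_ne s c (by omega)⟩

theorem Ex.eval_congr {d : ℕ} (hd : 0 < d) : ∀ {e : Ex}, e.Below d → ∀ {s s' : RAMState},
    Agree d s s' → e.eval s = e.eval s'
  | num _, _, _, _, _ => rfl
  | var _, hi, _, _, h => h.2 _ hi
  | add _ _, ha, _, _, h => by simp only [eval, eval_congr hd ha.1 h, eval_congr hd ha.2 h]
  | sub _ _, ha, _, _, h => by simp only [eval, eval_congr hd ha.1 h, eval_congr hd ha.2 h]
  | get a, ha, _, _, h => by simp only [eval, eval_congr (e := a) hd ha h, h.1]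
  | cond _ _ _, ha, _, _, h => by
    simp only [eval, eval_congr hd ha.1 h, eval_congr hd ha.2.1 h, eval_congr hd ha.2.2 h]
  | sum i _, ha, _, _, h => by
    simp only [eval, h.2 0 hd]
    exact Finset.sum_congr rfl fun v _ => eval_congr hd ha.2.2 (h.setReg i v)

open RAMProg

/-- `p` can be run from `s` to some state with property `Q` in at most `t` steps. -/
def Runs (p : RAMProg) (s : RAMState) (t : ℕ) (Q : RAMState → Prop) : Prop :=
  ∃ s' t', p.Exec s s' t' ∧ t' ≤ t ∧ Q s'

theorem Runs.mono {p : RAMProg} {s : RAMState} {t t' : ℕ} {Q Q' : RAMState → Prop}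
    (h : Runs p s t Q) (ht : t ≤ t') (hQ : ∀ s', Q s' → Q' s') : Runs p s t' Q' := by
  obtain ⟨s', t₁, h1, h2, h3⟩ := h
  exact ⟨s', t₁, h1, h2.trans ht, hQ s' h3⟩

theorem Runs.seq {p p' : RAMProg} {s : RAMState} {t t' : ℕ} {Q Q' : RAMState → Prop}
    (h : Runs p s t Q) (h' : ∀ s', Q s' → Runs p' s' t' Q') : Runs (.seq p p') s (t + t') Q' := by
  obtain ⟨s₁, t₁, h1, h2, h3⟩ := h
  obtain ⟨s₂, t₂, h4, h5, h6⟩ := h' s₁ h3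
  exact ⟨s₂, _, .seq h1 h4, by omega, h6⟩

theorem Runs.const {d c : ℕ} {s : RAMState} {Q : RAMState → Prop} (h : Q (setReg s d c)) :
    Runs (.const d c) s 1 Q := ⟨_, _, .const d c s, le_rfl, h⟩

theorem Runs.add {d a b : ℕ} {s : RAMState} {Q : RAMState → Prop}
    (h : Q (setReg s d (s.reg a + s.reg b))) : Runs (.add d a b) s 1 Q :=
  ⟨_, _, .add d a b s, le_rfl, h⟩

theorem Runs.sub {d a b : ℕ} {s : RAMState} {Q : RAMState → Prop}
    (h : Q (setReg s d (s.reg a - s.reg b))) : Runs (.sub d a b) s 1 Q :=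
  ⟨_, _, .sub d a b s, le_rfl, h⟩

theorem Runs.load {d a : ℕ} {s : RAMState} {Q : RAMState → Prop}
    (h : Q (setReg s d (s.mem (s.reg a)))) : Runs (.load d a) s 1 Q :=
  ⟨_, _, .load d a s, le_rfl, h⟩

theorem Runs.store {a b : ℕ} {s : RAMState} {Q : RAMState → Prop}
    (h : Q (setMem s (s.reg a) (s.reg b))) : Runs (.store a b) s 1 Q :=
  ⟨_, _, .store a b s, le_rfl, h⟩

theorem Runs.ite {a : ℕ} {p p' : RAMProg} {s : RAMState} {t t' : ℕ} {Q : RAMState → Prop}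
    (h : s.reg a ≠ 0 → Runs p s t Q) (h' : s.reg a = 0 → Runs p' s t' Q) :
    Runs (.ite a p p') s (t + t' + 1) Q := by
  by_cases ha : s.reg a = 0
  · obtain ⟨s', t₁, h1, h2, h3⟩ := h' ha
    exact ⟨s', _, .ite_false ha h1, by omega, h3⟩
  · obtain ⟨s', t₁, h1, h2, h3⟩ := h ha
    exact ⟨s', _, .ite_true ha h1, by omega, h3⟩

/-- A loop that counts down register `a`. -/
theorem Runs.loop {a : ℕ} {p : RAMProg} {T : ℕ} (J : ℕ → RAMState → Prop)
    (hJ : ∀ c s, J c s → s.reg a = c)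
    (hp : ∀ c s, J (c + 1) s → Runs p s T (J c)) (c : ℕ) (s : RAMState) (h : J c s) :
    Runs (.loop a p) s (c * (T + 1) + 1) (J 0) := by
  induction c generalizing s with
  | zero => exact ⟨s, 1, .loop_false (hJ 0 s h), by omega, h⟩
  | succ c ih =>
    obtain ⟨s₁, t₁, h1, h2, h3⟩ := hp c s h
    obtain ⟨s₂, t₂, h4, h5, h6⟩ := ih s₁ h3
    refine ⟨s₂, _, .loop_true (by rw [hJ _ s h]; omega) h1 h4, ?_, h6⟩
    rw [Nat.add_mul]
    omega

/-- The work space lies above all registers of the expression, so a second operand computed from `d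
+ 1` on leaves the first one intact. Sums are the only loops, and register `0` bounds them, so the
time depends on this register alone. -/
theorem Ex.runs_compile : ∀ {e : Ex} {d : ℕ} (s : RAMState), 0 < d → e.Below d →
    Runs (e.compile d) s (e.cost.eval (s.reg 0))
      (fun s' => Agree d s' s ∧ s'.reg d = e.eval s)
  | num c, d, s, _, _ => by
    refine Runs.mono (Runs.const (Q := fun s' => Agree d s' s ∧ s'.reg d = c) ?_)
      (by simp [cost]) fun _ h => h
    exact ⟨agree_setReg s c le_rfl, setReg_reg_self _ _ _⟩
  | var i, d, s, _, hi => by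
    have hi' : i < d := hi
    refine Runs.mono (Runs.seq (t := 1) (t' := 1) (Runs.const (Q := fun s' => s' = setReg s d 0) rfl)
      (Q' := fun s' => Agree d s' s ∧ s'.reg d = s.reg i) ?_) (by simp [cost]) fun _ h => h
    rintro _ rfl
    refine Runs.add ⟨(agree_setReg _ _ le_rfl).trans (agree_setReg _ _ le_rfl), ?_⟩
    simp [setReg_reg, hi'.ne]
  | add a b, d, s, hd, h => by
    refine Runs.mono (Runs.seq (runs_compile s hd h.1)
      (Q' := fun s' => Agree d s' s ∧ s'.reg d = a.eval s + b.eval s) ?_)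
      (t' := (cost (add a b)).eval (s.reg 0))
      (t := a.cost.eval (s.reg 0) + (b.cost.eval (s.reg 0) + 1)) ?_ fun _ h => h
    · rintro s₁ ⟨h1, h2⟩
      have h0 := h1.2 0 hd
      refine Runs.seq (h0 ▸ runs_compile s₁ (Nat.succ_pos d) (h.2.mono (Nat.le_succ d))) ?_
      rintro s₂ ⟨h3, h4⟩
      refine Runs.add ⟨(agree_setReg _ _ le_rfl).trans ((h3.mono (Nat.le_succ d)).trans h1), ?_⟩
      rw [setReg_reg_self, h3.2 d (Nat.lt_succ_self d), h2, h4, eval_congr hd h.2 h1]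
    · simp [cost]; omega
  | sub a b, d, s, hd, h => by
    refine Runs.mono (Runs.seq (runs_compile s hd h.1)
      (Q' := fun s' => Agree d s' s ∧ s'.reg d = a.eval s - b.eval s) ?_)
      (t' := (cost (sub a b)).eval (s.reg 0))
      (t := a.cost.eval (s.reg 0) + (b.cost.eval (s.reg 0) + 1)) ?_ fun _ h => h
    · rintro s₁ ⟨h1, h2⟩
      have h0 := h1.2 0 hd
      refine Runs.seq (h0 ▸ runs_compile s₁ (Nat.succ_pos d) (h.2.mono (Nat.le_succ d))) ?_
      rintro s₂ ⟨h3, h4⟩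
      refine Runs.sub ⟨(agree_setReg _ _ le_rfl).trans ((h3.mono (Nat.le_succ d)).trans h1), ?_⟩
      rw [setReg_reg_self, h3.2 d (Nat.lt_succ_self d), h2, h4, eval_congr hd h.2 h1]
    · simp [cost]; omega
  | get a, d, s, hd, h => by
    refine Runs.mono (Runs.seq (t' := 1) (runs_compile (e := a) s hd h)
      (Q' := fun s' => Agree d s' s ∧ s'.reg d = s.mem (a.eval s)) ?_) (by simp [cost])
      fun _ h => h
    rintro s₁ ⟨h1, h2⟩
    refine Runs.load ⟨(agree_setReg _ _ le_rfl).trans h1, ?_⟩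
    rw [setReg_reg_self, h1.1, h2]
  | cond a b c, d, s, hd, h => by
    refine Runs.mono (Runs.seq (runs_compile s hd h.1)
      (t' := b.cost.eval (s.reg 0) + c.cost.eval (s.reg 0) + 1)
      (Q' := fun s' => Agree d s' s ∧ s'.reg d = (cond a b c).eval s) ?_)
      (t' := (cost (cond a b c)).eval (s.reg 0)) ?_ fun _ h => h
    · rintro s₁ ⟨h1, h2⟩
      have h0 := h1.2 0 hd
      refine Runs.ite (fun ha => ?_) (fun ha => ?_)
      · refine Runs.mono (h0 ▸ runs_compile s₁ hd h.2.1) le_rfl ?_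
        rintro s₂ ⟨h3, h4⟩
        refine ⟨h3.trans h1, ?_⟩
        rw [h4, eval_congr hd h.2.1 h1, eval, if_pos (h2 ▸ ha)]
      · refine Runs.mono (h0 ▸ runs_compile s₁ hd h.2.2) le_rfl ?_
        rintro s₂ ⟨h3, h4⟩
        refine ⟨h3.trans h1, ?_⟩
        rw [h4, eval_congr hd h.2.2 h1, eval, if_neg (by rw [← h2]; simpa using ha)]
    · simp [cost]; omega
  | sum i a, d, s, hd, h => by
    obtain ⟨hi0, hid, ha⟩ := h
    let n := s.reg 0
    -- The counter descends, so the sum is accumulated from the top; `d + 1` saves the register that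
    -- the sum binds.
    let J : ℕ → RAMState → Prop := fun c s' => s'.mem = s.mem ∧
      (∀ j < d, j ≠ i → s'.reg j = s.reg j) ∧
      s'.reg d = ∑ v ∈ Finset.Ico c n, a.eval (setReg s i v) ∧ s'.reg (d + 1) = s.reg i ∧
      s'.reg (d + 2) = c ∧ s'.reg (d + 3) = 1 ∧ c ≤ n
    have hstep : ∀ c s', J (c + 1) s' → Runs (.seq (.sub (d + 2) (d + 2) (d + 3)) <|
        .seq (.const i 0) <| .seq (.add i i (d + 2)) <| .seq (a.compile (d + 4))
          (.add d d (d + 4))) s' (a.cost.eval n + 4) (J c) := by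
      rintro c s' ⟨h1, h2, h3, h4, h5, h6, h7⟩
      refine Runs.mono (t := 1 + (1 + (1 + (a.cost.eval n + 1)))) (Runs.seq (Runs.sub
        (Q := fun s₁ => s₁ = setReg s' (d + 2) c) (by simp [h5, h6])) ?_) (by omega) fun _ h => h
      rintro _ rfl
      refine Runs.seq (Runs.const (Q := fun s₁ => s₁ = setReg (setReg s' (d + 2) c) i 0) rfl) ?_
      rintro _ rfl
      refine Runs.seq (Runs.add (Q := fun s₁ => s₁.mem = s'.mem ∧ s₁.reg i = c ∧
        (∀ j, j ≠ i → s₁.reg j = if j = d + 2 then c else s'.reg j)) ?_) ?_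
      · refine ⟨rfl, ?_, fun j hj => ?_⟩
        · simp [setReg_reg, show d + 2 ≠ i by omega]
        · simp [setReg_reg, hj]
      rintro s₁ ⟨g1, g2, g3⟩
      have hag : Agree d s₁ (setReg s i c) := by
        refine ⟨g1.trans h1, fun j hj => ?_⟩
        by_cases hji : j = i
        · subst hji; simp [g2]
        · rw [g3 j hji, if_neg (by omega), h2 j hj hji, setReg_reg, if_neg hji]
      have h0 : s₁.reg 0 = n := by
        rw [hag.2 0 hd, setReg_reg, if_neg (Ne.symm hi0)]
      refine Runs.seq (h0 ▸ runs_compile s₁ (by omega) (ha.mono (by omega))) ?_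
      rintro s₂ ⟨g4, g5⟩
      refine Runs.add ?_
      have hreg : ∀ j < d + 4, s₂.reg j = s₁.reg j := g4.2
      refine ⟨g4.1.trans (g1.trans h1), fun j hj hji => ?_, ?_, ?_, ?_, ?_, by omega⟩
      · rw [setReg_reg, if_neg (by omega), hreg j (by omega), hag.2 j hj, setReg_reg, if_neg hji]
      · rw [setReg_reg_self, hreg d (by omega), g3 d (by omega), if_neg (by omega), h3, g5,
          eval_congr hd ha hag, ← Finset.insert_Ico_add_one_left_eq_Ico (by omega : c < n),
          Finset.sum_insert (by simp), add_comm]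
      · rw [setReg_reg, if_neg (by omega), hreg _ (by omega), g3 _ (by omega), if_neg (by omega),
          h4]
      · rw [setReg_reg, if_neg (by omega), hreg _ (by omega), g3 _ (by omega), if_pos rfl]
      · rw [setReg_reg, if_neg (by omega), hreg _ (by omega), g3 _ (by omega), if_neg (by omega),
          h6]
    refine Runs.mono (t := 1 + (1 + (1 + (1 + (n * (a.cost.eval n + 4 + 1) + 1 + (1 + 1)))))) ?_ ?_
      fun _ h => h
    · refine Runs.seq (Runs.const (Q := fun s₁ => s₁ = setReg s d 0) rfl) ?_
      rintro _ rfl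
      refine Runs.seq (Runs.add (Q := fun s₁ => s₁ = setReg (setReg s d 0) (d + 1) (s.reg i))
        (by simp [setReg_reg, hid.ne])) ?_
      rintro _ rfl
      refine Runs.seq (Runs.add (Q := fun s₁ => s₁ = setReg (setReg (setReg s d 0) (d + 1)
        (s.reg i)) (d + 2) n) (by simp [setReg_reg, hd.ne, n])) ?_
      rintro _ rfl
      refine Runs.seq (Runs.const (Q := J n) ?_) ?_
      · refine ⟨rfl, fun j hj _ => ?_, ?_, ?_, ?_, ?_, le_rfl⟩
        · simp only [setReg_reg]
          rw [if_neg (by omega), if_neg (by omega), if_neg (by omega), if_neg (by omega)]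
        · simp [setReg_reg]
        · simp [setReg_reg]
        · simp [setReg_reg]
        · simp
      intro s₁ hs₁
      refine Runs.seq (Runs.loop J (fun c s' h => h.2.2.2.2.1) hstep n s₁ hs₁) ?_
      rintro s₂ ⟨h1, h2, h3, h4, -, -, -⟩
      refine Runs.seq (Runs.const (Q := fun s₁ => s₁ = setReg s₂ i 0) rfl) ?_
      rintro _ rfl
      refine Runs.add ⟨⟨h1, fun j hj => ?_⟩, ?_⟩
      · by_cases hji : j = i
        · subst hji
          simp [setReg_reg, h4, show d + 1 ≠ j by omega]
        · simp [setReg_reg, hji, h2 j hj hji]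
      · simp only [setReg_reg, eval]
        rw [if_neg (by omega), if_neg (by omega), h3, Finset.range_eq_Ico]
    · simp only [cost, Polynomial.eval_add, Polynomial.eval_mul, Polynomial.eval_X,
        Polynomial.eval_ofNat]
      rw [show a.cost.eval n + 4 + 1 = a.cost.eval n + 5 by omega]
      change _ ≤ n * (a.cost.eval n + 5) + 7
      omega

/-- Statements. `rep i p` repeats `p` once for each number below the content of register `0`, in
descending order, with this number in register `i`. -/
inductive St : Type
  | skip
  | set (i : ℕ) (a : Ex)
  | put (a b : Ex)
  | seq (p p' : St)
  | ite (a : Ex) (p p' : St)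
  | rep (i : ℕ) (p : St)

/-- Applies `f c`, …, `f 0` one after the other. -/
def iter {σ : Type*} (f : ℕ → σ → σ) : ℕ → σ → σ
  | 0, s => s
  | c + 1, s => iter f c (f c s)

namespace St

/-- The effect of a statement. -/
def run : St → RAMState → RAMState
  | skip, s => s
  | set i a, s => setReg s i (a.eval s)
  | put a b, s => setMem s (a.eval s) (b.eval s)
  | seq p p', s => p'.run (p.run s)
  | ite a p p', s => if a.eval s ≠ 0 then p.run s else p'.run s
  | rep i p, s => iter (fun v s => p.run (setReg s i v)) (s.reg 0) s

/-- All registers are below `d`, and register `0` is not changed. -/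
def Below (d : ℕ) : St → Prop
  | skip => True
  | set i a => i ≠ 0 ∧ i < d ∧ a.Below d
  | put a b => a.Below d ∧ b.Below d
  | seq p p' => p.Below d ∧ p'.Below d
  | ite a p p' => a.Below d ∧ p.Below d ∧ p'.Below d
  | rep i p => i ≠ 0 ∧ i < d ∧ p.Below d

theorem Below.mono {d d' : ℕ} (h : d ≤ d') : ∀ {p : St}, p.Below d → p.Below d'
  | skip, _ => trivial
  | set _ _, hp => ⟨hp.1, lt_of_lt_of_le hp.2.1 h, hp.2.2.mono h⟩
  | put _ _, hp => ⟨hp.1.mono h, hp.2.mono h⟩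
  | seq _ _, hp => ⟨hp.1.mono h, hp.2.mono h⟩
  | ite _ _ _, hp => ⟨hp.1.mono h, hp.2.1.mono h, hp.2.2.mono h⟩
  | rep _ _, hp => ⟨hp.1, lt_of_lt_of_le hp.2.1 h, hp.2.2.mono h⟩

/-- Registers outside `1, …, d - 1` are not changed. -/
theorem run_reg {d : ℕ} : ∀ {p : St}, p.Below d → ∀ (s : RAMState) {j : ℕ}, (j = 0 ∨ d ≤ j) →
    (p.run s).reg j = s.reg j
  | skip, _, _, _, _ => rfl
  | set i a, hp, s, j, hj => setReg_reg_of_ne _ _ (by have := hp.1; have := hp.2.1; omega)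
  | put _ _, _, _, _, _ => rfl
  | seq _ _, hp, s, _, hj => (run_reg hp.2 _ hj).trans (run_reg hp.1 s hj)
  | ite a p p', hp, s, j, hj => by
    simp only [run]
    split_ifs
    · exact run_reg hp.2.1 s hj
    · exact run_reg hp.2.2 s hj
  | rep i p, hp, s, j, hj => by
    have key : ∀ c s, (iter (fun v s => p.run (setReg s i v)) c s).reg j = s.reg j := by
      intro c
      induction c with
      | zero => exact fun _ => rfl
      | succ c ih =>
        intro s
        rw [iter, ih, run_reg hp.2.2 _ hj, setReg_reg_of_ne]
        have := hp.1; have := hp.2.1; omega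
    exact key _ s

theorem run_congr {d : ℕ} (hd : 0 < d) : ∀ {p : St}, p.Below d → ∀ {s s' : RAMState},
    Agree d s s' → Agree d (p.run s) (p.run s')
  | skip, _, _, _, h => h
  | set i a, hp, s, s', h => by
    simp only [run, Ex.eval_congr hd hp.2.2 h]
    exact h.setReg _ _
  | put a b, hp, s, s', h => by
    simp only [run, Ex.eval_congr hd hp.1 h, Ex.eval_congr hd hp.2 h]
    exact h.setMem _ _
  | seq _ _, hp, _, _, h => run_congr hd hp.2 (run_congr hd hp.1 h)
  | ite a p p', hp, s, s', h => by
    simp only [run, Ex.eval_congr hd hp.1 h]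
    split_ifs
    · exact run_congr hd hp.2.1 h
    · exact run_congr hd hp.2.2 h
  | rep i p, hp, s, s', h => by
    have key : ∀ c s s', Agree d s s' → Agree d (iter (fun v s => p.run (setReg s i v)) c s)
        (iter (fun v s => p.run (setReg s i v)) c s') := by
      intro c
      induction c with
      | zero => exact fun _ _ h => h
      | succ c ih => exact fun s s' h => ih _ _ (run_congr hd hp.2.2 (h.setReg _ _))
    simp only [run, h.2 0 hd]
    exact key _ _ _ h

/-- The program for a statement, with the registers from `d` on as work space. -/
def compile : St → ℕ → RAMProg
  | skip, d => .const d 0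
  | set i a, d => .seq (a.compile d) (.seq (.const i 0) (.add i i d))
  | put a b, d => .seq (a.compile d) (.seq (b.compile (d + 1)) (.store d (d + 1)))
  | seq p p', d => .seq (p.compile d) (p'.compile d)
  | ite a p p', d => .seq (a.compile d) (.ite d (p.compile d) (p'.compile d))
  | rep i p, d =>
    .seq (.const d 0) <| .seq (.add d d 0) <| .seq (.const (d + 1) 1) <|
    .loop d <| .seq (.sub d d (d + 1)) <| .seq (.const i 0) <| .seq (.add i i d) <|
      p.compile (d + 2)

/-- A bound for the number of steps in terms of register `0`. -/
noncomputable def cost : St → Polynomial ℕ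
  | skip => 1
  | set _ a => a.cost + 2
  | put a b => a.cost + b.cost + 1
  | seq p p' => p.cost + p'.cost
  | ite a p p' => a.cost + p.cost + p'.cost + 1
  | rep _ p => Polynomial.X * (p.cost + 4) + 4

/-- Statements never change register `0`, so the bounds for consecutive parts refer to the same
number and simply add up. -/
theorem runs_compile : ∀ {p : St} {d : ℕ} (s : RAMState), 0 < d → p.Below d →
    Runs (p.compile d) s (p.cost.eval (s.reg 0)) (fun s' => Agree d s' (p.run s))
  | skip, d, s, _, _ => by
    refine Runs.mono (Runs.const (Q := fun s' => Agree d s' s) ?_) (by simp [cost]) fun _ h => h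
    exact agree_setReg s 0 le_rfl
  | set i a, d, s, hd, hp => by
    refine Runs.mono (t := a.cost.eval (s.reg 0) + (1 + 1)) (Runs.seq (Ex.runs_compile s hd hp.2.2)
      (Q' := fun s' => Agree d s' ((set i a).run s)) ?_) (by simp [cost]) fun _ h => h
    rintro s₁ ⟨h1, h2⟩
    refine Runs.seq (Runs.const (Q := fun s' => s' = setReg s₁ i 0) rfl) ?_
    rintro _ rfl
    refine Runs.add ⟨h1.1, fun j hj => ?_⟩
    have := hp.2.1
    by_cases hji : j = i
    · subst hji
      simp [setReg_reg, run, h2, show d ≠ j by omega]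
    · simp [setReg_reg, run, hji, h1.2 j hj]
  | put a b, d, s, hd, hp => by
    refine Runs.mono (t := a.cost.eval (s.reg 0) + (b.cost.eval (s.reg 0) + 1))
      (Runs.seq (Ex.runs_compile s hd hp.1) (Q' := fun s' => Agree d s' ((put a b).run s)) ?_)
      (by simp [cost]; omega) fun _ h => h
    rintro s₁ ⟨h1, h2⟩
    have h0 := h1.2 0 hd
    refine Runs.seq (h0 ▸ Ex.runs_compile s₁ (Nat.succ_pos d) (hp.2.mono (Nat.le_succ d))) ?_
    rintro s₂ ⟨h3, h4⟩
    refine Runs.store ?_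
    rw [h3.2 d (Nat.lt_succ_self d), h2, h4, Ex.eval_congr hd hp.2 h1]
    exact ((h3.mono (Nat.le_succ d)).trans h1).setMem _ _
  | seq p p', d, s, hd, hp => by
    refine Runs.mono (Runs.seq (t' := p'.cost.eval (s.reg 0)) (runs_compile s hd hp.1)
      (Q' := fun s' => Agree d s' ((seq p p').run s)) ?_) (by simp [cost]) fun _ h => h
    intro s₁ h1
    have h0 : s₁.reg 0 = s.reg 0 := (h1.2 0 hd).trans (run_reg hp.1 s (.inl rfl))
    exact Runs.mono (h0 ▸ runs_compile s₁ hd hp.2) le_rfl fun s₂ h2 =>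
      h2.trans (run_congr hd hp.2 h1)
  | ite a p p', d, s, hd, hp => by
    refine Runs.mono (Runs.seq (t' := p.cost.eval (s.reg 0) + p'.cost.eval (s.reg 0) + 1)
      (Ex.runs_compile s hd hp.1) (Q' := fun s' => Agree d s' ((ite a p p').run s)) ?_)
      (by simp [cost]; omega) fun _ h => h
    rintro s₁ ⟨h1, h2⟩
    have h0 := h1.2 0 hd
    refine Runs.ite (fun ha => ?_) (fun ha => ?_)
    · refine Runs.mono (h0 ▸ runs_compile s₁ hd hp.2.1) le_rfl fun s₂ h3 => ?_
      rw [run, if_pos (h2 ▸ ha)]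
      exact h3.trans (run_congr hd hp.2.1 h1)
    · refine Runs.mono (h0 ▸ runs_compile s₁ hd hp.2.2) le_rfl fun s₂ h3 => ?_
      rw [run, if_neg (by rw [← h2]; simpa using ha)]
      exact h3.trans (run_congr hd hp.2.2 h1)
  | rep i p, d, s, hd, hp => by
    obtain ⟨hi0, hid, hp⟩ := hp
    set n := s.reg 0 with hn
    set f : ℕ → RAMState → RAMState := fun v s => p.run (setReg s i v) with hf
    -- Performing the remaining `c` rounds from the current state gives the intended final state.
    let J : ℕ → RAMState → Prop := fun c s' => s'.reg d = c ∧ s'.reg (d + 1) = 1 ∧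
      s'.reg 0 = n ∧ Agree d (iter f c s') (iter f n s)
    have hiter : ∀ c s s', Agree d s s' → Agree d (iter f c s) (iter f c s') := by
      intro c
      induction c with
      | zero => exact fun _ _ h => h
      | succ c ih => exact fun s s' h => ih _ _ (run_congr hd hp (h.setReg _ _))
    have hstep : ∀ c s', J (c + 1) s' → Runs (.seq (.sub d d (d + 1)) <| .seq (.const i 0) <|
        .seq (.add i i d) <| p.compile (d + 2)) s' (p.cost.eval n + 3) (J c) := by
      rintro c s' ⟨h1, h2, h3, h4⟩
      refine Runs.mono (t := 1 + (1 + (1 + p.cost.eval n))) (Runs.seq (Runs.sub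
        (Q := fun s₁ => s₁ = setReg s' d c) (by simp [h1, h2])) ?_) (by omega) fun _ h => h
      rintro _ rfl
      refine Runs.seq (Runs.const (Q := fun s₁ => s₁ = setReg (setReg s' d c) i 0) rfl) ?_
      rintro _ rfl
      refine Runs.seq (Runs.add (Q := fun s₁ => s₁ = setReg (setReg (setReg s' d c) i 0) i c) ?_) ?_
      · simp [setReg_reg, show d ≠ i by omega]
      rintro _ rfl
      set s₁ := setReg (setReg (setReg s' d c) i 0) i c with hs₁
      have h0 : s₁.reg 0 = n := by
        simp [hs₁, setReg_reg, Ne.symm hi0, hd.ne, h3]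
      refine Runs.mono (h0 ▸ runs_compile s₁ (by omega) (hp.mono (by omega))) le_rfl
        fun s₂ h5 => ⟨?_, ?_, ?_, ?_⟩
      · rw [h5.2 d (by omega), run_reg hp _ (.inr le_rfl)]
        simp [hs₁, setReg_reg, show d ≠ i by omega]
      · rw [h5.2 (d + 1) (by omega), run_reg hp _ (.inr (by omega))]
        simp [hs₁, setReg_reg, show d + 1 ≠ i by omega, h2]
      · rw [h5.2 0 (by omega), run_reg hp _ (.inl rfl), h0]
      · refine Agree.trans ?_ h4
        rw [iter]
        refine hiter _ _ _ ((h5.mono (by omega)).trans (run_congr hd hp ⟨rfl, fun j hj => ?_⟩))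
        by_cases hji : j = i
        · subst hji; simp [hs₁]
        · simp [hs₁, setReg_reg, hji, hj.ne]
    refine Runs.mono (t := 1 + (1 + (1 + (n * (p.cost.eval n + 3 + 1) + 1)))) ?_ ?_ fun _ h => h
    · refine Runs.seq (Runs.const (Q := fun s₁ => s₁ = setReg s d 0) rfl) ?_
      rintro _ rfl
      refine Runs.seq (Runs.add (Q := fun s₁ => s₁ = setReg (setReg s d 0) d n)
        (by simp [setReg_reg, hd.ne, hn])) ?_
      rintro _ rfl
      refine Runs.seq (Runs.const (Q := J n) ⟨?_, ?_, ?_, ?_⟩) ?_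
      · simp [setReg_reg]
      · simp
      · simp [setReg_reg, hd.ne, hn]
      · exact hiter _ _ _ (((agree_setReg _ _ (by omega)).trans (agree_setReg _ _ le_rfl)).trans
          (agree_setReg _ _ le_rfl))
      intro s₁ hs₁
      refine Runs.mono (Runs.loop J (fun c s' h => h.1) hstep n s₁ hs₁) le_rfl fun s₂ h => h.2.2.2
    · simp only [cost, Polynomial.eval_add, Polynomial.eval_mul, Polynomial.eval_X,
        Polynomial.eval_ofNat]
      rw [show p.cost.eval n + 3 + 1 = p.cost.eval n + 4 by omega]
      omega

end St

/-! ### From loop programs to the class `P` -/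

theorem length_le_inputSize (w : List ℕ) : w.length ≤ inputSize w := by
  induction w with
  | nil => simp [inputSize]
  | cons a w ih =>
    simp only [inputSize, List.map_cons, List.sum_cons, List.length_cons] at ih ⊢
    omega

theorem polynomial_eval_mono (P : Polynomial ℕ) {a b : ℕ} (h : a ≤ b) : P.eval a ≤ P.eval b := by
  rw [Polynomial.eval_eq_sum, Polynomial.eval_eq_sum]
  exact Finset.sum_le_sum fun i _ => Nat.mul_le_mul_left _ (Nat.pow_le_pow_left h i)

/-- A language that is decided by a loop program, with the result in register `1`, is in `P`. -/
theorem inP_of_run {L : Set (List ℕ)} (p : St) {d : ℕ} (hd : 1 < d) (hp : p.Below d)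
    (h : ∀ w, (p.run (RAMState.init w)).reg 1 ≠ 0 ↔ w ∈ L) : InP L := by
  -- Register `0` holds the input length during the run, so the answer is moved there only at the
  -- end.
  refine ⟨.seq (p.compile d) (.seq (.const 0 0) (.add 0 0 1)), p.cost + 2, fun w => ?_⟩
  have key : Runs (.seq (p.compile d) (.seq (.const 0 0) (.add 0 0 1))) (RAMState.init w)
      (p.cost.eval w.length + (1 + 1)) (fun s' => s'.reg 0 = (p.run (RAMState.init w)).reg 1) := by
    refine Runs.seq (St.runs_compile (RAMState.init w) (by omega) hp) fun s₁ h1 => ?_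
    refine Runs.seq (Runs.const (Q := fun s' => s' = setReg s₁ 0 0) rfl) ?_
    rintro _ rfl
    refine Runs.add ?_
    simp [setReg_reg, h1.2 1 hd]
  obtain ⟨s, t, h1, h2, h3⟩ := key
  refine ⟨s, t, h1, h2.trans ?_, by rw [h3, h w]⟩
  have := polynomial_eval_mono p.cost (length_le_inputSize w)
  simp only [Polynomial.eval_add, Polynomial.eval_ofNat]
  omega

end Loop

namespace Loop

/-! ### Logical connectives for loop programs -/

namespace Ex

/-- Nonzero values count as true. -/
def Holds (e : Ex) (s : RAMState) : Prop := e.eval s ≠ 0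

def bool (a : Ex) : Ex := cond a (num 1) (num 0)
def not (a : Ex) : Ex := cond a (num 0) (num 1)
def and (a b : Ex) : Ex := cond a b (num 0)
def or (a b : Ex) : Ex := cond a (num 1) b
def eq (a b : Ex) : Ex := not (add (sub a b) (sub b a))
def lt (a b : Ex) : Ex := sub b a
def all (l : List Ex) : Ex := l.foldr and (num 1)
def any (l : List Ex) : Ex := l.foldr or (num 0)

variable {a b : Ex} {s : RAMState}

theorem eval_bool [Decidable (a.Holds s)] : (bool a).eval s = if a.Holds s then 1 else 0 := by
  by_cases h : a.eval s = 0 <;> simp [bool, eval, Holds, h]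

@[simp] theorem holds_num {c : ℕ} : (num c).Holds s ↔ c ≠ 0 := Iff.rfl

@[simp] theorem holds_not : (not a).Holds s ↔ ¬ a.Holds s := by
  by_cases h : a.eval s = 0 <;> simp [not, eval, Holds, h]

@[simp] theorem holds_and : (and a b).Holds s ↔ a.Holds s ∧ b.Holds s := by
  by_cases h : a.eval s = 0 <;> simp [and, eval, Holds, h]

@[simp] theorem holds_or : (or a b).Holds s ↔ a.Holds s ∨ b.Holds s := by
  by_cases h : a.eval s = 0 <;> simp [or, eval, Holds, h]

@[simp] theorem holds_eq : (eq a b).Holds s ↔ a.eval s = b.eval s := by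
  rw [eq, holds_not]
  simp only [Holds, eval]
  omega

@[simp] theorem holds_lt : (lt a b).Holds s ↔ a.eval s < b.eval s := by
  simp only [lt, Holds, eval]
  omega

@[simp] theorem holds_all {l : List Ex} : (all l).Holds s ↔ ∀ e ∈ l, e.Holds s := by
  induction l with
  | nil => simp [all]
  | cons e l ih => simpa [all] using fun _ => ih

@[simp] theorem holds_any {l : List Ex} : (any l).Holds s ↔ ∃ e ∈ l, e.Holds s := by
  induction l with
  | nil => simp [any]
  | cons e l ih => simpa [any] using or_congr Iff.rfl ih

@[simp] theorem holds_sum {i : ℕ} :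
    (sum i a).Holds s ↔ ∃ v < s.reg 0, a.Holds (setReg s i v) := by
  simp [Holds, eval, Finset.sum_eq_zero_iff]

theorem eval_sum_bool {i : ℕ} (P : ℕ → Prop) [DecidablePred P]
    (h : ∀ v < s.reg 0, a.Holds (setReg s i v) ↔ P v) :
    (sum i (bool a)).eval s = ((Finset.range (s.reg 0)).filter P).card := by
  classical
  rw [eval, Finset.card_filter]
  refine Finset.sum_congr rfl fun v hv => ?_
  rw [eval_bool]
  simp only [h v (Finset.mem_range.1 hv)]

variable {d : ℕ}

@[simp] theorem below_num {c : ℕ} : (num c).Below d := trivial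
@[simp] theorem below_var {i : ℕ} : (var i).Below d ↔ i < d := Iff.rfl
@[simp] theorem below_add : (add a b).Below d ↔ a.Below d ∧ b.Below d := Iff.rfl
@[simp] theorem below_sub : (sub a b).Below d ↔ a.Below d ∧ b.Below d := Iff.rfl
@[simp] theorem below_get : (get a).Below d ↔ a.Below d := Iff.rfl
@[simp] theorem below_sum {i : ℕ} : (sum i a).Below d ↔ i ≠ 0 ∧ i < d ∧ a.Below d := Iff.rfl
@[simp] theorem below_cond {c : Ex} :
    (cond a b c).Below d ↔ a.Below d ∧ b.Below d ∧ c.Below d := Iff.rfl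
@[simp] theorem below_bool : (bool a).Below d ↔ a.Below d := by simp [bool]
@[simp] theorem below_not : (not a).Below d ↔ a.Below d := by simp [not]
@[simp] theorem below_and : (and a b).Below d ↔ a.Below d ∧ b.Below d := by simp [and]
@[simp] theorem below_or : (or a b).Below d ↔ a.Below d ∧ b.Below d := by simp [or]
@[simp] theorem below_eq : (eq a b).Below d ↔ a.Below d ∧ b.Below d := by
  simp [eq, and_comm]
@[simp] theorem below_lt : (lt a b).Below d ↔ b.Below d ∧ a.Below d := by simp [lt]

@[simp] theorem below_all {l : List Ex} : (all l).Below d ↔ ∀ e ∈ l, e.Below d := by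
  induction l with
  | nil => simp [all]
  | cons e l ih => simpa [all] using fun _ => ih

@[simp] theorem below_any {l : List Ex} : (any l).Below d ↔ ∀ e ∈ l, e.Below d := by
  induction l with
  | nil => simp [any]
  | cons e l ih => simpa [any] using fun _ => ih

end Ex

theorem St.run_ite_pos {a : Ex} {p p' : St} {s : RAMState} (h : a.Holds s) :
    (St.ite a p p').run s = p.run s := if_pos h

theorem St.run_ite_neg {a : Ex} {p p' : St} {s : RAMState} (h : ¬ a.Holds s) :
    (St.ite a p p').run s = p'.run s := if_neg h

/-- The invariant rule for repetitions. -/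
theorem St.run_rep {i : ℕ} {p : St} {s : RAMState} (J : ℕ → RAMState → Prop)
    (h : J (s.reg 0) s)
    (hstep : ∀ c < s.reg 0, ∀ s', J (c + 1) s' → J c (p.run (setReg s' i c))) :
    J 0 ((St.rep i p).run s) := by
  have key : ∀ c ≤ s.reg 0, ∀ s', J c s' →
      J 0 (iter (fun v s => p.run (setReg s i v)) c s') := by
    intro c
    induction c with
    | zero => exact fun _ _ h => h
    | succ c ih => exact fun hc s' h => ih (by omega) _ (hstep c (by omega) s' h)
  exact key _ le_rfl s h

/-! ### The auction as a loop program -/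

open Ex

/-- The price of the vertex in register `y`. -/
def priceEx (y : ℕ) : Ex := get (add (add (var 0) (var 0)) (var y))

/-- The owner of the vertex in register `y`. -/
def ownerEx (y : ℕ) : Ex := get (add (add (add (var 0) (var 0)) (var 0)) (var y))

/-- The left vertex in register `4` bids for the right vertex in register `5`. -/
def bidsEx (adjE : ℕ → ℕ → Ex) : Ex :=
  and (adjE 4 5) <| and (not (sum 9 (eq (ownerEx 9) (add (var 4) (num 1))))) <|
    and (lt (priceEx 5) (var 0)) (not (sum 9 (and (adjE 4 9) (lt (priceEx 9) (priceEx 5)))))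

/-- Overwriting the owner evicts the previous one, who may bid again later. -/
def bidSt (adjE : ℕ → ℕ → Ex) : St :=
  .ite (bidsEx adjE) (.seq
    (.put (add (add (var 0) (var 0)) (var 5)) (add (priceEx 5) (num 1)))
    (.put (add (add (add (var 0) (var 0)) (var 0)) (var 5)) (add (var 4) (num 1)))) .skip

def sweepSt (adjE : ℕ → ℕ → Ex) : St := .rep 4 (.rep 5 (bidSt adjE))

def auctionSt (adjE : ℕ → ℕ → Ex) : St := .rep 7 (.rep 8 (sweepSt adjE))

theorem below_auctionSt {adjE : ℕ → ℕ → Ex} {d : ℕ} (hd : 10 ≤ d)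
    (h : ∀ x < 10, ∀ y < 10, (adjE x y).Below d) : (auctionSt adjE).Below d := by
  have h1 := h 4 (by omega) 5 (by omega)
  have h2 := h 4 (by omega) 9 (by omega)
  simp [auctionSt, sweepSt, bidSt, bidsEx, St.Below, priceEx, ownerEx, h1, h2]
  omega

/-- The prices stored in the memory. -/
def price (n : ℕ) (m : ℕ → ℕ) (v : ℕ) : ℕ := m (n + n + v)

/-- The owners stored in the memory. -/
def owner (n : ℕ) (m : ℕ → ℕ) (v : ℕ) : ℕ := m (n + n + n + v)

/-- States with the right input and lists of marks. -/
def Good (n : ℕ) (m₀ : ℕ → ℕ) (s : RAMState) : Prop := s.reg 0 = n ∧ ∀ i < n + n, s.mem i = m₀ i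

theorem Good.setReg {n : ℕ} {m₀ : ℕ → ℕ} {s : RAMState} (h : Good n m₀ s) {i : ℕ} (hi : i ≠ 0)
    (c : ℕ) : Good n m₀ (setReg s i c) :=
  ⟨(setReg_reg_of_ne s c hi.symm).trans h.1, h.2⟩

section Auction

open Auction

variable {n : ℕ} {m₀ : ℕ → ℕ} {adjE : ℕ → ℕ → Ex} {adj : ℕ → ℕ → Prop}
  (hadj : ∀ s, Good n m₀ s → ∀ x < 10, ∀ y < 10, s.reg x < n → s.reg y < n →
    ((adjE x y).Holds s ↔ adj (s.reg x) (s.reg y)))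

include hadj

theorem holds_bidsEx {s : RAMState} (hs : Good n m₀ s) (h4 : s.reg 4 < n) (h5 : s.reg 5 < n) :
    (bidsEx adjE).Holds s ↔
      Bids n adj (price n s.mem) (owner n s.mem) (s.reg 4) (s.reg 5) := by
  have h0 := hs.1
  simp only [bidsEx, holds_and, holds_not, holds_sum, holds_eq, holds_lt, Bids]
  refine and_congr (hadj s hs 4 (by omega) 5 (by omega) h4 h5) (and_congr ?_ (and_congr ?_ ?_))
  · simp [ownerEx, eval, setReg_reg, owner, h0]
  · simp [priceEx, eval, price, h0]
  · rw [h0]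
    push Not
    refine forall_congr' fun v => forall_congr' fun hv => ?_
    rw [hadj _ (hs.setReg (by omega) v) 4 (by omega) 9 (by omega) (by simpa [setReg_reg] using h4)
      (by simpa using hv)]
    simp [priceEx, eval, setReg_reg, price, h0]

theorem run_bidSt {s : RAMState} (hs : Good n m₀ s) (h4 : s.reg 4 < n) (h5 : s.reg 5 < n) :
    (¬ Bids n adj (price n s.mem) (owner n s.mem) (s.reg 4) (s.reg 5) ∧
      (bidSt adjE).run s = s) ∨
    (Bids n adj (price n s.mem) (owner n s.mem) (s.reg 4) (s.reg 5) ∧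
      Good n m₀ ((bidSt adjE).run s) ∧ ((bidSt adjE).run s).reg = s.reg ∧
      (∀ v < n, price n ((bidSt adjE).run s).mem v = Function.update (price n s.mem) (s.reg 5)
        (price n s.mem (s.reg 5) + 1) v) ∧
      ∀ v < n, owner n ((bidSt adjE).run s).mem v = Function.update (owner n s.mem) (s.reg 5)
        (s.reg 4 + 1) v) := by
  have hb := holds_bidsEx hadj hs h4 h5
  have h0 := hs.1
  by_cases h : (bidsEx adjE).Holds s
  · right
    -- Prices occupy the addresses from `2n` on and owners those from `3n` on, so input and marks
    -- are untouched.
    have hrun : (bidSt adjE).run s = setMem (setMem s (n + n + s.reg 5)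
        (price n s.mem (s.reg 5) + 1)) (n + n + n + s.reg 5) (s.reg 4 + 1) := by
      rw [bidSt, St.run_ite_pos h]
      simp [St.run, eval, priceEx, price, h0]
    refine ⟨hb.1 h, ?_, ?_, fun v hv => ?_, fun v hv => ?_⟩
    · rw [hrun]
      refine ⟨h0, fun i hi => ?_⟩
      rw [setMem_mem, setMem_mem, if_neg (by omega), if_neg (by omega), hs.2 i hi]
    · rw [hrun]; rfl
    · rw [hrun, price, setMem_mem, setMem_mem, if_neg (by omega)]
      by_cases hv5 : v = s.reg 5
      · simp [hv5]
      · simp [hv5, price]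
    · rw [hrun, owner, setMem_mem, setMem_mem]
      by_cases hv5 : v = s.reg 5
      · simp [hv5]
      · rw [if_neg (by omega), if_neg (by omega)]
        simp [hv5, owner]
  · left
    refine ⟨fun h' => h (hb.2 h'), ?_⟩
    rw [bidSt, St.run_ite_neg h]
    rfl

/-- The sum of all prices. -/
def total (n : ℕ) (m : ℕ → ℕ) : ℕ := ∑ v ∈ Finset.range n, price n m v

omit hadj in
theorem total_bid {m m' : ℕ → ℕ} {v : ℕ} (hv : v < n) (h : ∀ x < n, price n m' x =
    Function.update (price n m) v (price n m v + 1) x) : total n m' = total n m + 1 := by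
  have hv' : v ∈ Finset.range n := Finset.mem_range.2 hv
  have h1 : ∑ x ∈ (Finset.range n).erase v, price n m' x =
      ∑ x ∈ (Finset.range n).erase v, price n m x := Finset.sum_congr rfl fun x hx => by
    obtain ⟨hxv, hx⟩ := Finset.mem_erase.1 hx
    rw [h x (Finset.mem_range.1 hx), Function.update_of_ne hxv]
  rw [total, total, ← Finset.add_sum_erase _ _ hv', ← Finset.add_sum_erase _ _ hv', h1, h v hv,
    Function.update_self]
  omega

/-- Until the first bid the memory is unchanged, so the tests refer to the initial state; a sweep
without bids has therefore checked all pairs, and any other sweep raises `total`. -/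
theorem run_sweepSt {s : RAMState} (hs : Good n m₀ s)
    (hi : Inv n adj (price n s.mem) (owner n s.mem)) :
    Good n m₀ ((sweepSt adjE).run s) ∧
      Inv n adj (price n ((sweepSt adjE).run s).mem) (owner n ((sweepSt adjE).run s).mem) ∧
      ((((sweepSt adjE).run s).mem = s.mem ∧
        ∀ u < n, ∀ v < n, ¬ Bids n adj (price n s.mem) (owner n s.mem) u v) ∨
      (total n s.mem < total n ((sweepSt adjE).run s).mem ∧
        ∃ u < n, ∃ v < n, Bids n adj (price n s.mem) (owner n s.mem) u v)) := by
  have h0 := hs.1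
  let B : ℕ → ℕ → Prop := Bids n adj (price n s.mem) (owner n s.mem)
  let J : (ℕ → ℕ → Prop) → RAMState → Prop := fun done s' => Good n m₀ s' ∧
    Inv n adj (price n s'.mem) (owner n s'.mem) ∧
    ((s'.mem = s.mem ∧ ∀ u < n, ∀ v < n, done u v → ¬ B u v) ∨
      (total n s.mem < total n s'.mem ∧ ∃ u < n, ∃ v < n, B u v))
  have hmono : ∀ P Q : ℕ → ℕ → Prop, (∀ u < n, ∀ v < n, Q u v → P u v) → ∀ s', J P s' → J Q s' := by
    rintro P Q hPQ s' ⟨h1, h2, h3⟩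
    refine ⟨h1, h2, h3.imp_left fun h => ⟨h.1, fun u hu v hv hQ => h.2 u hu v hv (hPQ u hu v hv hQ)⟩⟩
  have hJ : J (fun _ _ => True) ((sweepSt adjE).run s) := by
    refine hmono (fun u _ => 0 ≤ u) _ (by simp) _ ?_
    refine St.run_rep (fun c s' => J (fun u _ => c ≤ u) s') ?_ ?_
    · refine ⟨hs, hi, .inl ⟨rfl, fun u hu v _ h => ?_⟩⟩
      omega
    · intro c hc s' hs'
      have hs'' : J (fun u _ => c + 1 ≤ u) (setReg s' 4 c) :=
        ⟨hs'.1.setReg (by omega) c, hs'.2.1, hs'.2.2⟩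
      -- The pairs already treated form a final segment of the lexicographic order, since both
      -- counters descend.
      refine hmono (fun u v => c + 1 ≤ u ∨ (c = u ∧ 0 ≤ v)) _ (fun u _ v _ h => by omega) _ ?_
      refine (St.run_rep (fun c' s' => s'.reg 4 = c ∧
        J (fun u v => c + 1 ≤ u ∨ (c = u ∧ c' ≤ v)) s') ?_ ?_).2
      · refine ⟨by simp, hmono _ _ (fun u hu v hv h => ?_) _ hs''⟩
        have := hs''.1.1
        omega
      · rintro c' hc' s₁ ⟨h4, h1, h2, h3⟩
        rw [hs''.1.1] at hc'
        have g1 : Good n m₀ (setReg s₁ 5 c') := h1.setReg (by omega) c'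
        have g4 : (setReg s₁ 5 c').reg 4 = c := by simp [setReg_reg, h4]
        have g5 : (setReg s₁ 5 c').reg 5 = c' := by simp
        rw [h0] at hc
        have hstep := run_bidSt hadj g1 (by omega) (by omega)
        rw [g4, g5, setReg_mem] at hstep
        rcases hstep with ⟨hb, hr⟩ | ⟨hb, k1, k2, k3, k4⟩
        · rw [hr]
          refine ⟨g4, g1, h2, ?_⟩
          rcases h3 with ⟨e1, e2⟩ | h3
          · refine .inl ⟨e1, fun u hu v hv huv => ?_⟩
            rw [e1] at hb
            by_cases hcase : u = c ∧ v = c'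
            · rw [hcase.1, hcase.2]; exact hb
            · exact e2 u hu v hv (by omega)
          · exact .inr h3
        · refine ⟨by rw [k2, g4], k1, (h2.bid hb).congr k3 k4, .inr ?_⟩
          have htot := total_bid hc' k3
          rcases h3 with ⟨e1, e2⟩ | ⟨e1, e2⟩
          · rw [e1] at hb htot
            exact ⟨by omega, c, by omega, c', hc', hb⟩
          · exact ⟨by omega, e2⟩
  obtain ⟨h1, h2, h3⟩ := hJ
  exact ⟨h1, h2, h3.imp_left fun h => ⟨h.1, fun u hu v hv => h.2 u hu v hv trivial⟩⟩

/-- Every sweep with a bid raises the sum of the prices. After `n²` sweeps either bidding has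
stopped, or the sum is at least `n²`; then all prices equal the ceiling `n` and nobody may bid. -/
theorem run_auctionSt {s : RAMState} (hs : Good n m₀ s)
    (hi : Inv n adj (price n s.mem) (owner n s.mem)) :
    Good n m₀ ((auctionSt adjE).run s) ∧
      Inv n adj (price n ((auctionSt adjE).run s).mem) (owner n ((auctionSt adjE).run s).mem) ∧
      ∀ u < n, ∀ v < n, ¬ Bids n adj (price n ((auctionSt adjE).run s).mem)
        (owner n ((auctionSt adjE).run s).mem) u v := by
  have h0 := hs.1
  let J : ℕ → RAMState → Prop := fun t s' => Good n m₀ s' ∧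
    Inv n adj (price n s'.mem) (owner n s'.mem) ∧
    ((∀ u < n, ∀ v < n, ¬ Bids n adj (price n s'.mem) (owner n s'.mem) u v) ∨
      t ≤ total n s'.mem)
  have hstep : ∀ t s', J t s' → J (t + 1) ((sweepSt adjE).run s') := by
    rintro t s' ⟨h1, h2, h3⟩
    obtain ⟨k1, k2, k3⟩ := run_sweepSt hadj h1 h2
    refine ⟨k1, k2, ?_⟩
    rcases k3 with ⟨e1, e2⟩ | ⟨e1, u, hu, v, hv, e2⟩
    · left; rw [e1]; exact e2
    · right
      rcases h3 with h3 | h3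
      · exact (h3 u hu v hv e2).elim
      · omega
  have hreg : ∀ t s' i c, i ≠ 0 → J t s' → J t (setReg s' i c) := fun t s' i c hi hJ =>
    ⟨hJ.1.setReg hi c, hJ.2⟩
  have hJ : J (n * n) ((auctionSt adjE).run s) := by
    -- With the outer counter at `c`, `(n - c) * n` sweeps are complete.
    have := St.run_rep (i := 7) (p := .rep 8 (sweepSt adjE)) (s := s)
      (fun c s' => J ((n - c) * n) s') ⟨hs, hi, by simp [h0]⟩ ?_
    · rw [Nat.sub_zero] at this
      exact this
    intro c hc s' hs'
    rw [h0] at hc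
    have hs₁ := hreg _ _ 7 c (by omega) hs'
    have := St.run_rep (i := 8) (p := sweepSt adjE) (s := setReg s' 7 c)
      (fun c' s' => J ((n - (c + 1)) * n + (n - c')) s') ?_ ?_
    · have he : (n - (c + 1)) * n + (n - 0) = (n - c) * n := by
        rw [show n - c = n - (c + 1) + 1 by omega, Nat.add_mul]
        omega
      rwa [he] at this
    · rw [hs₁.1.1]
      simpa using hs₁
    · intro c' hc' s₂ hs₂
      rw [hs₁.1.1] at hc'
      have := hstep _ _ (hreg _ _ 8 c' (by omega) hs₂)
      rwa [show (n - (c + 1)) * n + (n - (c' + 1)) + 1 = (n - (c + 1)) * n + (n - c') by omega]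
        at this
  obtain ⟨h1, h2, h3⟩ := hJ
  refine ⟨h1, h2, ?_⟩
  rcases h3 with h3 | h3
  · exact h3
  · rintro u hu v hv ⟨-, -, hlt, -⟩
    have : total n ((auctionSt adjE).run s).mem < ∑ x ∈ Finset.range n, n :=
      Finset.sum_lt_sum (fun x hx => h2.price_le x (Finset.mem_range.1 hx))
        ⟨v, Finset.mem_range.2 hv, hlt⟩
    simp at this
    omega

end Auction

end Loop

namespace Loop

/-! ### Reading the input -/

open Ex

variable {ℓ : ℕ} {ar : Fin ℓ → ℕ}

/-- The encoding of a list of facts. -/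
def encodeFacts (l : List (RelTuple ar)) : List ℕ := l.flatMap fun t => (t.1 : ℕ) :: List.ofFn t.2

theorem encodeFacts_cons (t : RelTuple ar) (l : List (RelTuple ar)) :
    encodeFacts (t :: l) = (t.1 : ℕ) :: (List.ofFn t.2 ++ encodeFacts l) := by
  simp [encodeFacts]

theorem encodeFacts_append (l l' : List (RelTuple ar)) :
    encodeFacts (l ++ l') = encodeFacts l ++ encodeFacts l' := by
  simp [encodeFacts]

/-- The relation symbol fixes the number of arguments, so facts are read off uniquely from the left.
Any decoding of the word must then extend the part already read, which also justifies rejecting a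
word. -/
theorem encodeFacts_prefix {l l' : List (RelTuple ar)} {r : List ℕ}
    (h : encodeFacts l ++ r = encodeFacts l') : ∃ l₂, l' = l ++ l₂ ∧ r = encodeFacts l₂ := by
  induction l generalizing l' with
  | nil => exact ⟨l', rfl, by simpa [encodeFacts] using h⟩
  | cons t l ih =>
    rcases l' with _ | ⟨t', l'⟩
    · simp [encodeFacts] at h
    · obtain ⟨S, v⟩ := t
      obtain ⟨S', v'⟩ := t'
      rw [encodeFacts_cons, encodeFacts_cons, List.cons_append, List.cons.injEq] at h
      obtain ⟨h1, h2⟩ := h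
      obtain rfl : S = S' := Fin.ext h1
      rw [List.append_assoc] at h2
      obtain ⟨h3, h4⟩ := List.append_inj h2 (by simp)
      obtain rfl : v = v' := List.ofFn_injective h3
      obtain ⟨l₂, rfl, rfl⟩ := ih h4
      exact ⟨l₂, rfl, rfl⟩

theorem encodeInstance_inj {l l' : List (RelTuple ar)} {k k' : ℕ}
    (h : encodeInstance l k = encodeInstance l' k') : l = l' ∧ k = k' := by
  obtain ⟨rfl, -⟩ := List.cons.inj h
  have h' : encodeFacts l = encodeFacts l' := (List.cons.inj h).2
  obtain ⟨l₂, rfl, h2⟩ := encodeFacts_prefix (l := l) (r := []) ((List.append_nil _).trans h')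
  rcases l₂ with _ | ⟨t, l₂⟩
  · simp
  · simp [encodeFacts] at h2

/-- The fact `t` is listed in the input from position `p` on. -/
def FactIn (w : List ℕ) (p : ℕ) (t : RelTuple ar) : Prop :=
  p + ar t.1 < w.length ∧ w.getD p 0 = t.1 ∧ ∀ i : Fin (ar t.1), w.getD (p + 1 + i) 0 = t.2 i

theorem FactIn.unique {w : List ℕ} {p : ℕ} {t t' : RelTuple ar} (h : FactIn w p t)
    (h' : FactIn w p t') : t = t' := by
  obtain ⟨S, v⟩ := t
  obtain ⟨S', v'⟩ := t'
  obtain rfl : S = S' := Fin.ext (h.2.1.symm.trans h'.2.1)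
  congr 1
  funext i
  exact (h.2.2 i).symm.trans (h'.2.2 i)

/-- The memory `m` contains the input `w`, followed by marks for the positions where the facts in
`l` are first listed. -/
structure Marks (w : List ℕ) (l : List (RelTuple ar)) (m : ℕ → ℕ) : Prop where
  input : ∀ i < w.length, m i = w.getD i 0
  zero : ∀ i, w.length + w.length ≤ i → m i = 0
  sound : ∀ p < w.length, m (w.length + p) ≠ 0 → ∃ t ∈ l, FactIn w p t
  complete : ∀ t ∈ l, ∃ p < w.length, m (w.length + p) ≠ 0 ∧ FactIn w p t
  unique : ∀ p < w.length, ∀ p' < w.length, m (w.length + p) ≠ 0 → m (w.length + p') ≠ 0 →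
    ∀ t : RelTuple ar, FactIn w p t → FactIn w p' t → p = p'

variable (ar) in
/-- The facts listed at the positions `x` and `y` are the same. -/
def sameEx (x y : Ex) : Ex :=
  any <| (List.finRange ℓ).map fun S : Fin ℓ => and (eq (get x) (num S)) <| and (eq (get y) (num S)) <|
    all <| (List.finRange (ar S)).map fun i : Fin (ar S) =>
      eq (get (add (add x (num 1)) (num i))) (get (add (add y (num 1)) (num i)))

theorem holds_sameEx {w : List ℕ} {s : RAMState} (hm : ∀ i < w.length, s.mem i = w.getD i 0)
    {x y : Ex} {t t' : RelTuple ar} (h : FactIn w (x.eval s) t) (h' : FactIn w (y.eval s) t') :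
    (sameEx ar x y).Holds s ↔ t = t' := by
  have hx := h.1
  have hy := h'.1
  have e1 : s.mem (x.eval s) = t.1 := (hm _ (by omega)).trans h.2.1
  have e2 : s.mem (y.eval s) = t'.1 := (hm _ (by omega)).trans h'.2.1
  have e3 : ∀ i : Fin (ar t.1), s.mem (x.eval s + 1 + i) = t.2 i := fun i =>
    (hm _ (by have := i.2; omega)).trans (h.2.2 i)
  have e4 : ∀ i : Fin (ar t'.1), s.mem (y.eval s + 1 + i) = t'.2 i := fun i =>
    (hm _ (by have := i.2; omega)).trans (h'.2.2 i)
  obtain ⟨S, v⟩ := t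
  obtain ⟨S', v'⟩ := t'
  constructor
  · intro hs
    simp only [sameEx, holds_any, List.mem_map, List.mem_finRange, true_and, exists_exists_eq_and,
      holds_and, holds_eq, eval, holds_all, forall_exists_index, forall_apply_eq_imp_iff] at hs
    obtain ⟨T, h1, h2, h3⟩ := hs
    obtain rfl : S = T := Fin.ext (e1.symm.trans h1)
    obtain rfl : S' = S := Fin.ext (e2.symm.trans h2)
    congr 1
    funext i
    exact (e3 i).symm.trans ((h3 i).trans (e4 i))
  · intro he
    obtain ⟨rfl, he⟩ := Sigma.mk.inj he
    obtain rfl := eq_of_heq he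
    simp only [sameEx, holds_any, List.mem_map, List.mem_finRange, true_and, exists_exists_eq_and,
      holds_and, holds_eq, eval, holds_all, forall_exists_index, forall_apply_eq_imp_iff]
    exact ⟨S, e1, e2, fun i => (e3 i).trans (e4 i).symm⟩

theorem below_sameEx {x y : Ex} {d : ℕ} (hx : x.Below d) (hy : y.Below d) :
    (sameEx ar x y).Below d := by
  simp [sameEx, hx, hy]

variable (ar) in
/-- The arity of a relation symbol. -/
def arityEx (x : Ex) : Ex :=
  (List.finRange ℓ).foldr (fun (S : Fin ℓ) e => cond (eq x (num S)) (num (ar S)) e) (num 0)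

theorem eval_arityEx {s : RAMState} {x : Ex} {S : Fin ℓ} (h : x.eval s = S) :
    (arityEx ar x).eval s = ar S := by
  have key : ∀ L : List (Fin ℓ), S ∈ L →
      (L.foldr (fun (S : Fin ℓ) e => cond (eq x (num S)) (num (ar S)) e) (num 0)).eval s = ar S := by
    intro L hL
    induction L with
    | nil => simp at hL
    | cons T L ih =>
      simp only [List.foldr_cons]
      rw [eval]
      by_cases hT : (eq x (num T)).Holds s
      · refine (if_pos hT).trans ?_
        obtain rfl : S = T := Fin.ext (h.symm.trans (holds_eq.1 hT))
        rfl
      · refine (if_neg hT).trans (ih ((List.mem_cons.1 hL).resolve_left ?_))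
        rintro rfl
        exact hT (holds_eq.2 h)
  exact key _ (List.mem_finRange S)

theorem below_arityEx {x : Ex} {d : ℕ} (hx : x.Below d) : (arityEx ar x).Below d := by
  rw [arityEx]
  induction List.finRange ℓ with
  | nil => simp
  | cons T L ih => simpa [hx] using ih

variable (ar) in
/-- Reads the fact at the position in register `2` and marks this position, unless an earlier
position with the same fact is marked. -/
def scanStep : St :=
  .ite (lt (var 2) (var 0))
    (.ite (lt (get (var 2)) (num ℓ))
      (.seq (.ite (sum 9 (and (get (add (var 0) (var 9))) (sameEx ar (var 9) (var 2)))) .skip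
          (.put (add (var 0) (var 2)) (num 1)))
        (.set 2 (add (add (var 2) (num 1)) (arityEx ar (get (var 2))))))
      (.seq (.set 3 (num 1)) (.set 2 (var 0))))
    .skip

-- Position `0` holds the bound `k`, so reading starts at `1`. Every fact takes at least one number,
-- so as many rounds as the input is long suffice.
variable (ar) in
def scanSt : St := .seq (.set 2 (num 1)) (.rep 7 (scanStep ar))

/-- The input has been read to its end. -/
def validEx : Ex := and (not (var 3)) (eq (var 2) (var 0))

theorem below_scanSt {d : ℕ} (hd : 10 ≤ d) : (scanSt ar).Below d := by
  have h1 : (sameEx ar (var 9) (var 2)).Below d := below_sameEx (by simp; omega) (by simp; omega)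
  have h2 : (arityEx ar (get (var 2))).Below d := below_arityEx (by simp; omega)
  simp [scanSt, scanStep, St.Below, h1, h2]
  omega

/-- The reading of the input has failed. -/
def Failed (ar : Fin ℓ → ℕ) (w : List ℕ) (s : RAMState) : Prop :=
  w.length ≤ s.reg 2 ∧ (s.reg 3 ≠ 0 ∨ s.reg 2 ≠ w.length) ∧
    ∀ (l : List (RelTuple ar)) (k : ℕ), w ≠ encodeInstance l k

/-- At most `c` numbers are left to be read. -/
def Parsed (ar : Fin ℓ → ℕ) (w : List ℕ) (c : ℕ) (s : RAMState) : Prop :=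
  s.reg 3 = 0 ∧ ∃ (l : List (RelTuple ar)) (k : ℕ) (r : List ℕ), w = k :: (encodeFacts l ++ r) ∧
    s.reg 2 = 1 + (encodeFacts l).length ∧ Marks w l s.mem ∧ r.length ≤ c

theorem Marks.mark {w : List ℕ} {l : List (RelTuple ar)} {m : ℕ → ℕ} (h : Marks w l m)
    {p : ℕ} {t : RelTuple ar} (hp : FactIn w p t)
    (hnew : ¬ ∃ p' < w.length, m (w.length + p') ≠ 0 ∧ FactIn w p' t) :
    Marks w (l ++ [t]) (Function.update m (w.length + p) 1) := by
  have hpl : p < w.length := by have := hp.1; omega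
  have hu : ∀ p', Function.update m (w.length + p) 1 (w.length + p') ≠ 0 ↔
      p' = p ∨ m (w.length + p') ≠ 0 := fun p' => by
    by_cases hpp : p' = p
    · subst hpp; simp
    · rw [Function.update_of_ne (by omega)]; simp [hpp]
  refine ⟨fun i hi => ?_, fun i hi => ?_, fun p' hp' hm => ?_, fun t' ht' => ?_, ?_⟩
  · rw [Function.update_of_ne (by omega), h.input i hi]
  · rw [Function.update_of_ne (by omega), h.zero i hi]
  · rcases (hu p').1 hm with rfl | hm
    · exact ⟨t, by simp, hp⟩
    · obtain ⟨t', ht', hf⟩ := h.sound p' hp' hm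
      exact ⟨t', by simp [ht'], hf⟩
  · rcases List.mem_append.1 ht' with ht' | ht'
    · obtain ⟨p', hp', hm, hf⟩ := h.complete t' ht'
      exact ⟨p', hp', (hu p').2 (.inr hm), hf⟩
    · obtain rfl : t' = t := by simpa using ht'
      exact ⟨p, hpl, (hu p).2 (.inl rfl), hp⟩
  · intro p₁ hp₁ p₂ hp₂ h₁ h₂ t' hf₁ hf₂
    rcases (hu p₁).1 h₁ with e₁ | k₁ <;> rcases (hu p₂).1 h₂ with e₂ | k₂
    · rw [e₁, e₂]
    · subst e₁
      exact (hnew ⟨p₂, hp₂, k₂, hf₁.unique hp ▸ hf₂⟩).elim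
    · subst e₂
      exact (hnew ⟨p₁, hp₁, k₁, hf₂.unique hp ▸ hf₁⟩).elim
    · exact h.unique p₁ hp₁ p₂ hp₂ k₁ k₂ t' hf₁ hf₂

theorem Marks.append_of_marked {w : List ℕ} {l : List (RelTuple ar)} {m : ℕ → ℕ}
    (h : Marks w l m) {t : RelTuple ar}
    (hold : ∃ p' < w.length, m (w.length + p') ≠ 0 ∧ FactIn w p' t) : Marks w (l ++ [t]) m := by
  refine ⟨h.input, h.zero, fun p hp hm => ?_, fun t' ht' => ?_, h.unique⟩
  · obtain ⟨t', ht', hf⟩ := h.sound p hp hm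
    exact ⟨t', by simp [ht'], hf⟩
  · rcases List.mem_append.1 ht' with ht' | ht'
    · exact h.complete t' ht'
    · obtain rfl : t' = t := by simpa using ht'
      exact hold

/-- Reading a relation symbol and its arguments. -/
theorem run_scan_fact {w : List ℕ} {s : RAMState} (h0 : s.reg 0 = w.length)
    {l : List (RelTuple ar)} {k a c : ℕ} {r : List ℕ} (hw : w = k :: (encodeFacts l ++ a :: r))
    (h3 : s.reg 3 = 0) (h2 : s.reg 2 = 1 + (encodeFacts l).length) (hm : Marks w l s.mem)
    (hr : r.length ≤ c) :
    Failed ar w ((scanStep ar).run s) ∨ Parsed ar w c ((scanStep ar).run s) := by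
  have hlen : w.length = 1 + (encodeFacts l).length + 1 + r.length := by rw [hw]; simp; omega
  have hga : w.getD (s.reg 2) 0 = a := by
    rw [hw, h2, Nat.add_comm 1, List.getD_cons_succ,
      List.getD_append_right _ _ _ _ (by omega)]
    simp
  have hma : s.mem (s.reg 2) = a := (hm.input _ (by omega)).trans hga
  have hcur : (lt (var 2) (var 0)).Holds s := by
    rw [holds_lt]
    simp only [eval]
    omega
  by_cases hal : a < ℓ
  · have hcode : (lt (get (var 2)) (num ℓ)).Holds s := by
      rw [holds_lt]
      simpa only [eval, hma] using hal
    let S : Fin ℓ := ⟨a, hal⟩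
    obtain ⟨s₁, hs₁def⟩ : ∃ s₁, s₁ = (St.ite (sum 9 (and (get (add (var 0) (var 9)))
        (sameEx ar (var 9) (var 2)))) .skip (.put (add (var 0) (var 2)) (num 1))).run s := ⟨_, rfl⟩
    -- Marks are written behind the input, so the symbol is still there when its arity is looked up.
    have hs₁ : s₁.reg = s.reg ∧ s₁.mem (s.reg 2) = a := by
      by_cases hd : (sum 9 (and (get (add (var 0) (var 9)))
          (sameEx ar (var 9) (var 2)))).Holds s
      · rw [hs₁def, St.run_ite_pos hd]
        exact ⟨rfl, hma⟩
      · rw [hs₁def, St.run_ite_neg hd]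
        refine ⟨rfl, ?_⟩
        change (setMem s (s.reg 0 + s.reg 2) 1).mem (s.reg 2) = a
        rw [setMem_mem, if_neg (by omega), hma]
    have hrun : (scanStep ar).run s = setReg s₁ 2 (s.reg 2 + 1 + ar S) := by
      rw [scanStep, St.run_ite_pos hcur, St.run_ite_pos hcode, St.run, ← hs₁def, St.run]
      congr 1
      rw [eval, eval_arityEx (S := S)]
      · simp only [eval, hs₁.1]
      · simp only [eval, hs₁.1]
        exact hs₁.2
    by_cases har : ar S ≤ r.length
    · right
      let t : RelTuple ar := ⟨S, fun i => r.getD i 0⟩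
      have hsplit : a :: r = encodeFacts [t] ++ r.drop (ar S) := by
        rw [encodeFacts_cons]
        simp only [List.cons_append, List.append_assoc]
        congr 1
        conv_lhs => rw [← List.take_append_drop (ar S) r]
        simp only [encodeFacts, List.flatMap_nil, List.nil_append]
        congr 1
        refine List.ext_getElem (by simp [t, har]) fun i h1 h2 => ?_
        have : i < r.length := by simp at h1; omega
        simp [t, this]
      have hfact : FactIn w (s.reg 2) t := by
        refine ⟨?_, hga, fun i => ?_⟩
        · change s.reg 2 + ar S < _
          omega
        · rw [hw, h2, show 1 + (encodeFacts l).length + 1 + (i : ℕ) =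
            (encodeFacts l).length + 1 + i + 1 by omega, List.getD_cons_succ,
            List.getD_append_right _ _ _ _ (by omega),
            show (encodeFacts l).length + 1 + (i : ℕ) - (encodeFacts l).length = i + 1 by omega,
            List.getD_cons_succ]
      have hdup : (sum 9 (and (get (add (var 0) (var 9))) (sameEx ar (var 9) (var 2)))).Holds s ↔
          ∃ p' < w.length, s.mem (w.length + p') ≠ 0 ∧ FactIn w p' t := by
        rw [holds_sum, h0]
        refine exists_congr fun p => and_congr_right fun hp => ?_
        rw [holds_and]
        have e1 : (get (add (var 0) (var 9))).Holds (setReg s 9 p) ↔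
            s.mem (w.length + p) ≠ 0 := by
          simp [Holds, eval, setReg_reg, h0]
        rw [e1]
        refine and_congr_right fun hmp => ?_
        obtain ⟨t', -, ht'⟩ := hm.sound p hp hmp
        have e2 : FactIn w ((var 9).eval (setReg s 9 p)) t' := by
          simpa [eval] using ht'
        have e3 : FactIn w ((var 2).eval (setReg s 9 p)) t := by
          simpa [eval, setReg_reg] using hfact
        rw [holds_sameEx (s := setReg s 9 p) hm.input e2 e3]
        exact ⟨fun h => h ▸ ht', fun h => ht'.unique h⟩
      have hmarks : Marks w (l ++ [t]) s₁.mem := by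
        by_cases hd : (sum 9 (and (get (add (var 0) (var 9)))
            (sameEx ar (var 9) (var 2)))).Holds s
        · rw [hs₁def, St.run_ite_pos hd]
          exact hm.append_of_marked (hdup.1 hd)
        · rw [hs₁def, St.run_ite_neg hd]
          have := hm.mark hfact fun h => hd (hdup.2 h)
          simpa [St.run, setMem, eval, h0] using this
      rw [hrun]
      refine ⟨by simp [setReg_reg, hs₁.1, h3], l ++ [t], k, r.drop (ar S), ?_, ?_, hmarks, ?_⟩
      · rw [hw, hsplit, encodeFacts_append, List.append_assoc]
      · have : (encodeFacts [t]).length = 1 + ar S := by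
          rw [encodeFacts_cons]
          simp [encodeFacts, t, add_comm]
        rw [setReg_reg_self, encodeFacts_append, List.length_append, this]
        omega
      · simp
        omega
    · left
      rw [hrun]
      -- Too few arguments are left, so the reading position ends up beyond the input, which
      -- `validEx` detects without an error flag.
      refine ⟨by simp; omega, .inr (by simp; omega), fun l' k' he => ?_⟩
      rw [hw] at he
      obtain ⟨l₂, -, h5⟩ := encodeFacts_prefix (List.cons.inj he).2
      rcases l₂ with _ | ⟨t, l₂⟩
      · simp [encodeFacts] at h5
      · rw [encodeFacts_cons, List.cons.injEq] at h5
        have e1 : t.1 = S := Fin.ext h5.1.symm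
        have e2 := congrArg List.length h5.2
        rw [List.length_append, List.length_ofFn, e1] at e2
        omega
  · left
    have hcode : ¬ (lt (get (var 2)) (num ℓ)).Holds s := by
      rw [holds_lt]
      simpa only [eval, hma] using hal
    rw [scanStep, St.run_ite_pos hcur, St.run_ite_neg hcode]
    refine ⟨?_, .inl ?_, fun l' k' he => ?_⟩
    · simp [St.run, eval, setReg_reg, h0]
    · simp [St.run, eval, setReg_reg]
    · rw [hw] at he
      obtain ⟨l₂, -, h5⟩ := encodeFacts_prefix (List.cons.inj he).2
      rcases l₂ with _ | ⟨t, l₂⟩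
      · simp [encodeFacts] at h5
      · rw [encodeFacts_cons, List.cons.injEq] at h5
        exact hal (h5.1 ▸ t.1.2)

theorem run_scanStep_of_le {s : RAMState} (h : s.reg 0 ≤ s.reg 2) : (scanStep ar).run s = s := by
  rw [scanStep, St.run_ite_neg]
  · rfl
  · rw [holds_lt]
    simp only [eval]
    omega

theorem run_scanSt (w : List ℕ) :
    ((scanSt ar).run (RAMState.init w)).reg 0 = w.length ∧
    ((validEx.Holds ((scanSt ar).run (RAMState.init w)) ∧
      ∃ (l : List (RelTuple ar)) (k : ℕ), w = encodeInstance l k ∧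
        Marks w l ((scanSt ar).run (RAMState.init w)).mem) ∨
    (¬ validEx.Holds ((scanSt ar).run (RAMState.init w)) ∧
      ∀ (l : List (RelTuple ar)) (k : ℕ), w ≠ encodeInstance l k)) := by
  let J : ℕ → RAMState → Prop := fun c s =>
    s.reg 0 = w.length ∧ (Failed ar w s ∨ Parsed ar w c s)
  let s₀ := setReg (RAMState.init w) 2 1
  have h00 : s₀.reg 0 = w.length := by simp [s₀, setReg_reg, RAMState.init]
  have key : J 0 ((scanSt ar).run (RAMState.init w)) := by
    change J 0 ((St.rep 7 (scanStep ar)).run s₀)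
    refine St.run_rep J ⟨h00, ?_⟩ ?_
    · rw [h00]
      rcases w with _ | ⟨k, r⟩
      · left
        -- The empty word lacks even the bound; the starting position `1` already exceeds its
        -- length.
        refine ⟨by simp, .inr (by simp [s₀]), fun l k => by simp [encodeInstance]⟩
      · right
        refine ⟨by simp [s₀, setReg_reg, RAMState.init], [], k, r, by simp [encodeFacts],
          by simp [s₀, encodeFacts], ?_, by simp⟩
        have hz : ∀ i, (k :: r).length ≤ i → s₀.mem i = 0 := fun i hi => by
          simp only [s₀, setReg_mem, RAMState.init]
          exact List.getD_eq_default _ _ hi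
        refine ⟨fun i _ => rfl, fun i hi => hz i (by omega), fun p _ hp => ?_,
          fun t ht => by simp at ht, fun p _ _ _ hp => ?_⟩
        · exact (hp (hz _ (by omega))).elim
        · exact (hp (hz _ (by omega))).elim
    · rintro c - s ⟨h0, hs⟩
      have h0' : (setReg s 7 c).reg 0 = w.length := by simp [setReg_reg, h0]
      refine ⟨?_, ?_⟩
      · rw [St.run_reg (d := 10) (below_scanSt le_rfl).2.2.2 _ (.inl rfl), h0']
      rcases hs with hs | ⟨h3, l, k, r, hw, h2, hm, hr⟩
      · left
        rw [run_scanStep_of_le]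
        · simpa [Failed, setReg_reg] using hs
        · have := hs.1
          simp [setReg_reg]
          omega
      · rcases r with _ | ⟨a, r⟩
        · right
          rw [run_scanStep_of_le]
          · exact ⟨by simpa [setReg_reg] using h3, l, k, [], hw, by simpa [setReg_reg] using h2, hm,
              by simp⟩
          · rw [h0', hw]
            simp [setReg_reg, h2]
        · exact run_scan_fact h0' hw (by simpa [setReg_reg] using h3)
            (by simpa [setReg_reg] using h2) hm (by simpa using hr)
  obtain ⟨h0, h | ⟨h3, l, k, r, hw, h2, hm, hr⟩⟩ := key
  · refine ⟨h0, .inr ⟨fun hv => ?_, h.2.2⟩⟩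
    simp only [validEx, holds_and, holds_not, holds_eq] at hv
    have e1 : ((scanSt ar).run (RAMState.init w)).reg 3 = 0 := not_not.1 hv.1
    have e2 : ((scanSt ar).run (RAMState.init w)).reg 2 = w.length := hv.2.trans h0
    rcases h.2.1 with h | h
    · exact h e1
    · exact h e2
  · obtain rfl : r = [] := List.length_eq_zero_iff.1 (Nat.le_zero.1 hr)
    rw [List.append_nil] at hw
    refine ⟨h0, .inl ⟨?_, l, k, hw, hm⟩⟩
    simp only [validEx, holds_and, holds_not, holds_eq]
    refine ⟨fun h => h h3, ?_⟩
    simp only [eval]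
    rw [h2, h0, hw]
    simp
    omega

end Loop

namespace Loop

/-! ### Witnesses as families of positions -/

open Ex Query

variable {ℓ : ℕ} {ar : Fin ℓ → ℕ}

/-- Facts may be listed repeatedly, but only one occurrence is marked; this makes positions faithful
names for the facts of the database. -/
theorem Marks.exists_pos {w : List ℕ} {l : List (RelTuple ar)} {m : ℕ → ℕ} (h : Marks w l m) :
    ∃ pos : RelTuple ar → ℕ, (∀ t ∈ l, pos t < w.length ∧ m (w.length + pos t) ≠ 0 ∧
      FactIn w (pos t) t) ∧ ∀ p < w.length, m (w.length + p) ≠ 0 → ∀ t : RelTuple ar,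
        FactIn w p t → t ∈ l ∧ pos t = p := by
  classical
  choose pos hpos using h.complete
  refine ⟨fun t => if ht : t ∈ l then pos t ht else 0, fun t ht => ?_, fun p hp hm t ht => ?_⟩
  · simpa only [dif_pos ht] using hpos t ht
  · obtain ⟨t', ht'l, ht'⟩ := h.sound p hp hm
    obtain rfl := ht.unique ht'
    refine ⟨ht'l, ?_⟩
    simp only [dif_pos ht'l]
    obtain ⟨h1, h2, h3⟩ := hpos t ht'l
    exact h.unique _ h1 p hp h2 hm t h3 ht

/-- Existential quantification over the registers `10, …, 9 + a`. -/
def exAll : ℕ → Ex → Ex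
  | 0, e => e
  | a + 1, e => sum (10 + a) (exAll a e)

/-- Assigns to the registers `10, …, 9 + a`. -/
def setMany (s : RAMState) (P : ℕ → ℕ) (a : ℕ) : RAMState :=
  { s with reg := fun i => if 10 ≤ i ∧ i < 10 + a then P (i - 10) else s.reg i }

theorem setMany_reg_of_lt (s : RAMState) (P : ℕ → ℕ) (a : ℕ) {i : ℕ} (h : i < 10) :
    (setMany s P a).reg i = s.reg i := if_neg (by omega)

theorem setMany_reg (s : RAMState) (P : ℕ → ℕ) {a j : ℕ} (h : j < a) :
    (setMany s P a).reg (10 + j) = P j := by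
  rw [setMany]
  simp only
  rw [if_pos (by omega), Nat.add_sub_cancel_left]

theorem setMany_setReg (s : RAMState) {P P' : ℕ → ℕ} {a v : ℕ} (h : ∀ j < a, P' j = P j)
    (hv : P' a = v) : setMany (setReg s (10 + a) v) P a = setMany s P' (a + 1) := by
  simp only [setMany, setReg, RAMState.mk.injEq, and_true]
  funext i
  by_cases hi : 10 ≤ i ∧ i < 10 + a
  · rw [if_pos hi, if_pos (by omega), h _ (by omega)]
  · rw [if_neg hi]
    by_cases hia : i = 10 + a
    · subst hia
      rw [if_pos (by omega), Nat.add_sub_cancel_left, hv, Function.update_self]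
    · rw [if_neg (by omega), Function.update_of_ne hia]

theorem holds_exAll {a : ℕ} {e : Ex} {s : RAMState} : (exAll a e).Holds s ↔
    ∃ P : ℕ → ℕ, (∀ j < a, P j < s.reg 0) ∧ e.Holds (setMany s P a) := by
  induction a generalizing s with
  | zero =>
    have : ∀ P, setMany s P 0 = s := fun P => by
      simp only [setMany]
      congr 1
      funext i
      rw [if_neg (by omega)]
    simp [exAll, this]
  | succ a ih =>
    simp only [exAll, holds_sum, ih]
    constructor
    · rintro ⟨v, hv, P, hP, he⟩
      have h0 : (setReg s (10 + a) v).reg 0 = s.reg 0 := setReg_reg_of_ne _ _ (by omega)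
      rw [h0] at hP
      refine ⟨Function.update P a v, fun j hj => ?_, ?_⟩
      · by_cases hja : j = a
        · subst hja; simpa using hv
        · rw [Function.update_of_ne hja]
          exact hP j (by omega)
      · rwa [← setMany_setReg s (P := P) (v := v) (fun j hj => by
          rw [Function.update_of_ne hj.ne]) (by simp)]
    · rintro ⟨P, hP, he⟩
      have h0 : (setReg s (10 + a) (P a)).reg 0 = s.reg 0 := setReg_reg_of_ne _ _ (by omega)
      exact ⟨P a, hP a (by omega), P, fun j hj => h0 ▸ hP j (by omega),
        by rwa [setMany_setReg s (fun _ _ => rfl) rfl]⟩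

theorem below_exAll {a d : ℕ} {e : Ex} (h : e.Below d) (hd : 10 + a ≤ d) :
    (exAll a e).Below d := by
  induction a with
  | zero => exact h
  | succ a ih => exact ⟨by omega, by omega, ih (by omega)⟩

/-- The content of the input `c + 1` places after the position in register `10 + j`. -/
def argEx (j c : ℕ) : Ex := get (add (add (var (10 + j)) (num 1)) (num c))

/-- The registers `10, 11, …` contain positions of facts that arise from the atoms in `gs` by a
common substitution. -/
def witnessEx (gs : List (RelTuple ar)) : Ex :=
  and
    (all <| (List.finRange gs.length).map fun j : Fin gs.length =>
      and (get (add (var 0) (var (10 + j)))) (eq (get (var (10 + j))) (num (gs.get j).1)))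
    (all <| (List.finRange gs.length).map fun j : Fin gs.length =>
      all <| (List.finRange gs.length).map fun j' : Fin gs.length =>
        all <| (List.finRange (ar (gs.get j).1)).map fun i : Fin (ar (gs.get j).1) =>
          all <| (List.finRange (ar (gs.get j').1)).map fun i' : Fin (ar (gs.get j').1) =>
            if (gs.get j).2 i = (gs.get j').2 i' then eq (argEx j i) (argEx j' i') else num 1)

theorem below_witnessEx {gs : List (RelTuple ar)} {d : ℕ} (hd : 10 + gs.length ≤ d) :
    (witnessEx gs).Below d := by
  have hj : ∀ j : Fin gs.length, 10 + (j : ℕ) < d := fun j => by have := j.2; omega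
  have h0 : 0 < d := by omega
  simp only [witnessEx, below_and, below_all, List.mem_map, List.mem_finRange, true_and,
    forall_exists_index, forall_apply_eq_imp_iff, below_get, below_add, below_var, below_eq,
    below_num, hj, h0, and_true, implies_true]
  intro j j' i i'
  split_ifs <;> simp [argEx, hj]

theorem holds_witnessEx {gs : List (RelTuple ar)} {w : List ℕ} {l : List (RelTuple ar)}
    {s : RAMState} (h0 : s.reg 0 = w.length) {m : ℕ → ℕ} (hm : Marks w l m)
    (hsm : ∀ i < w.length + w.length, s.mem i = m i)
    (hP : ∀ j < gs.length, s.reg (10 + j) < w.length) :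
    (witnessEx gs).Holds s ↔ ∃ v : ℕ → ℕ, ∀ j : Fin gs.length,
      m (w.length + s.reg (10 + j)) ≠ 0 ∧
        FactIn w (s.reg (10 + j)) (RelTuple.subst v (gs.get j)) := by
  have hin : ∀ i < w.length, s.mem i = w.getD i 0 := fun i hi =>
    (hsm i (by omega)).trans (hm.input i hi)
  have hmark : ∀ j : Fin gs.length, s.mem (w.length + s.reg (10 + j)) =
      m (w.length + s.reg (10 + j)) := fun j => hsm _ (by have := hP j j.2; omega)
  have hread : ∀ (j : Fin gs.length) (t : RelTuple ar), FactIn w (s.reg (10 + j)) t →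
      s.mem (s.reg (10 + j)) = t.1 ∧ ∀ i : Fin (ar t.1), s.mem (s.reg (10 + j) + 1 + i) = t.2 i := by
    intro j t ht
    have := ht.1
    exact ⟨(hin _ (by omega)).trans ht.2.1,
      fun i => (hin _ (by have := i.2; omega)).trans (ht.2.2 i)⟩
  have hiff : (witnessEx gs).Holds s ↔ (∀ j : Fin gs.length,
      m (w.length + s.reg (10 + j)) ≠ 0 ∧ s.mem (s.reg (10 + j)) = (gs.get j).1) ∧
      ∀ j j' : Fin gs.length, ∀ (i : Fin (ar (gs.get j).1)) (i' : Fin (ar (gs.get j').1)),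
        (gs.get j).2 i = (gs.get j').2 i' →
          s.mem (s.reg (10 + j) + 1 + i) = s.mem (s.reg (10 + j') + 1 + i') := by
    simp only [witnessEx, holds_and, holds_all, List.mem_map, List.mem_finRange, true_and,
      forall_exists_index, forall_apply_eq_imp_iff, holds_eq]
    refine and_congr (forall_congr' fun j => and_congr ?_ Iff.rfl)
      (forall_congr' fun j => forall_congr' fun j' => forall_congr' fun i =>
        forall_congr' fun i' => ?_)
    · simp only [Holds, eval]
      rw [h0, hmark j]
    · split_ifs with h
      · simp only [holds_eq, argEx, eval]
        exact ⟨fun hh _ => hh, fun hh => hh h⟩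
      · exact ⟨fun _ hh => absurd hh h, fun _ => Nat.one_ne_zero⟩
  rw [hiff]
  constructor
  · rintro ⟨h1, h2⟩
    have h3 : ∀ j : Fin gs.length, ∃ u : Fin (ar (gs.get j).1) → ℕ,
        FactIn w (s.reg (10 + j)) (⟨(gs.get j).1, u⟩ : RelTuple ar) := by
      intro j
      obtain ⟨t, -, ht⟩ := hm.sound _ (hP j j.2) (h1 j).1
      have he : t.1 = (gs.get j).1 := Fin.ext ((hread j t ht).1.symm.trans (h1 j).2)
      obtain ⟨S, u⟩ := t
      subst he
      exact ⟨u, ht⟩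
    choose u hu using h3
    have hread' : ∀ (j : Fin gs.length) (i : Fin (ar (gs.get j).1)), s.mem (s.reg (10 + j) + 1 + i) = u j i :=
      fun j i => (hread j _ (hu j)).2 i
    classical
    -- The value of a variable is read at any of its occurrences; `h2` makes the choice irrelevant.
    let v : ℕ → ℕ := fun x =>
      if h : ∃ c : (j : Fin gs.length) × Fin (ar (gs.get j).1), (gs.get c.1).2 c.2 = x then
        u h.choose.1 h.choose.2 else 0
    refine ⟨v, fun j => ⟨(h1 j).1, ?_⟩⟩
    have hv : (fun i => v ((gs.get j).2 i)) = u j := by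
      funext i
      have hex : ∃ c : (j : Fin gs.length) × Fin (ar (gs.get j).1),
          (gs.get c.1).2 c.2 = (gs.get j).2 i := ⟨⟨j, i⟩, rfl⟩
      simp only [v]
      rw [dif_pos hex, ← hread', ← hread']
      exact h2 _ _ _ _ hex.choose_spec
    rw [RelTuple.subst, hv]
    exact hu j
  · rintro ⟨v, hv⟩
    refine ⟨fun j => ⟨(hv j).1, (hread j _ (hv j).2).1⟩, fun j j' i i' h => ?_⟩
    refine ((hread j _ (hv j).2).2 i).trans (Eq.trans ?_ ((hread j' _ (hv j').2).2 i').symm)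
    simp only [RelTuple.subst, h]

/-! ### The decision program and its correctness -/

section Decision

variable (q : Query ar)

/-- The atoms as a list. -/
noncomputable def atoms : List (RelTuple ar) := q.body.toList

/-- Some witness satisfies `e`, which may refer to the position of the fact for the `j`-th atom as
register `10 + j`. -/
noncomputable def existsWitnessEx (e : Ex) : Ex :=
  exAll (atoms q).length (and (witnessEx (atoms q)) e)

/-- The register for the position of the fact for the atom `g`. -/
noncomputable def atomReg (g : RelTuple ar) : ℕ := 10 + (atoms q).idxOf g

theorem idxOf_lt {g : RelTuple ar} (hg : g ∈ q.body) :
    (atoms q).idxOf g < (atoms q).length :=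
  List.idxOf_lt_length_iff.2 (Finset.mem_toList.2 hg)

/-- Marked positions correspond to facts, so choosing positions for all atoms consistently amounts
to choosing a witness. The meaning of `e` is only needed in states whose registers hold the
positions of the facts of a witness. -/
theorem holds_existsWitnessEx {e : Ex} {w : List ℕ} {l : List (RelTuple ar)} {s : RAMState}
    (h0 : s.reg 0 = w.length) {m : ℕ → ℕ} (hm : Marks w l m)
    (hsm : ∀ i < w.length + w.length, s.mem i = m i) {pos : RelTuple ar → ℕ}
    (hpos : ∀ t ∈ l, pos t < w.length ∧ m (w.length + pos t) ≠ 0 ∧ FactIn w (pos t) t)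
    (hpos' : ∀ p < w.length, m (w.length + p) ≠ 0 → ∀ t : RelTuple ar, FactIn w p t →
      t ∈ l ∧ pos t = p) {Q : (ℕ → ℕ) → Prop}
    (he : ∀ v s', s'.mem = s.mem → (∀ i < 10, s'.reg i = s.reg i) →
      (∀ g ∈ q.body, s'.reg (atomReg q g) = pos (RelTuple.subst v g)) → (e.Holds s' ↔ Q v)) :
    (existsWitnessEx q e).Holds s ↔ ∃ v, q.Witness l.toFinset v ∧ Q v := by
  rw [existsWitnessEx, holds_exAll, h0]
  have hwit : ∀ P : ℕ → ℕ, (∀ j < (atoms q).length, P j < w.length) →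
      ((witnessEx (atoms q)).Holds (setMany s P (atoms q).length) ↔
        ∃ v : ℕ → ℕ, ∀ j : Fin (atoms q).length, m (w.length + P j) ≠ 0 ∧
          FactIn w (P j) (RelTuple.subst v ((atoms q).get j))) := by
    intro P hP
    have h1 : ∀ j < (atoms q).length, (setMany s P (atoms q).length).reg (10 + j) = P j :=
      fun j hj => setMany_reg s P hj
    rw [holds_witnessEx ((setMany_reg_of_lt s P _ (by omega)).trans h0) hm hsm
      fun j hj => (h1 j hj).symm ▸ hP j hj]
    refine exists_congr fun v => forall_congr' fun j => ?_
    rw [h1 j j.2]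
  constructor
  · rintro ⟨P, hP, h⟩
    rw [holds_and, hwit P hP] at h
    obtain ⟨⟨v, hv⟩, hE⟩ := h
    have hv' : ∀ j : Fin (atoms q).length, RelTuple.subst v ((atoms q).get j) ∈ l ∧
        pos (RelTuple.subst v ((atoms q).get j)) = P j := fun j =>
      hpos' _ (hP j j.2) (hv j).1 _ (hv j).2
    have hget : ∀ g ∈ q.body, ∃ j : Fin (atoms q).length,
        (atoms q).get j = g ∧ atomReg q g = 10 + j := fun g hg =>
      ⟨⟨_, idxOf_lt q hg⟩, List.idxOf_get _, rfl⟩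
    refine ⟨v, fun g hg => ?_, (he v (setMany s P (atoms q).length) rfl
      (fun i hi => setMany_reg_of_lt s P _ hi)
      fun g hg => ?_).1 hE⟩
    · obtain ⟨j, hj, -⟩ := hget g hg
      exact List.mem_toFinset.2 (hj ▸ (hv' j).1)
    · obtain ⟨j, hj, hr⟩ := hget g hg
      rw [hr, setMany_reg s P j.2, ← hj, (hv' j).2]
  · rintro ⟨v, hv, hQ⟩
    have hv' : ∀ g ∈ q.body, RelTuple.subst v g ∈ l := fun g hg => List.mem_toFinset.1 (hv g hg)
    have hmem : ∀ j : Fin (atoms q).length, (atoms q).get j ∈ q.body := fun j =>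
      Finset.mem_toList.1 (List.get_mem _ _)
    let P : ℕ → ℕ := fun j => if h : j < (atoms q).length then
      pos (RelTuple.subst v ((atoms q).get ⟨j, h⟩)) else 0
    have hPj : ∀ j : Fin (atoms q).length, P j = pos (RelTuple.subst v ((atoms q).get j)) :=
      fun j => dif_pos j.2
    have hP : ∀ j < (atoms q).length, P j < w.length := fun j hj => by
      have := (hpos _ (hv' _ (hmem ⟨j, hj⟩))).1
      rwa [← hPj ⟨j, hj⟩] at this
    refine ⟨P, hP, ?_⟩
    rw [holds_and, hwit P hP]
    refine ⟨⟨v, fun j => ?_⟩, (he v (setMany s P (atoms q).length) rfl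
      (fun i hi => setMany_reg_of_lt s P _ hi)
      fun g hg => ?_).2 hQ⟩
    · rw [hPj j]
      exact (hpos _ (hv' _ (hmem j))).2
    · rw [atomReg, setMany_reg s P (idxOf_lt q hg), hPj ⟨_, idxOf_lt q hg⟩, List.idxOf_get]

theorem below_existsWitnessEx {e : Ex} {d : ℕ} (hd : 10 + (atoms q).length ≤ d) (h : e.Below d) :
    (existsWitnessEx q e).Below d :=
  below_exAll (below_and.2 ⟨below_witnessEx hd, h⟩) hd

/-- Some witness maps `g` and `g'` to the facts at the positions in the registers `x` and `y`. -/
noncomputable def stepEx (g g' : RelTuple ar) (x y : ℕ) : Ex :=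
  existsWitnessEx q (and (eq (var (atomReg q g)) (var x)) (eq (var (atomReg q g')) (var y)))

variable (edges : List (RelTuple ar × RelTuple ar)) (inner : List (RelTuple ar))

noncomputable def innerEx (x : ℕ) : Ex := any (inner.map fun g => stepEx q g g x x)

/-- No table of edges is stored: each test searches all witnesses again, at polynomial cost because
the number of atoms is fixed. -/
noncomputable def adjEx (x y : ℕ) : Ex :=
  or (any (edges.map fun e => stepEx q e.1 e.2 x y)) (and (eq (var x) (var y)) (innerEx q inner x))

/-- The query is true, and at most `k` plus the number of inner vertices have been sold. -/
noncomputable def resultEx : Ex :=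
  and (existsWitnessEx q (num 1)) <|
    not (lt (add (get (num 0)) (sum 5 (bool (innerEx q inner 5)))) (sum 5 (bool (priceEx 5))))

noncomputable def decideSt : St :=
  .seq (scanSt ar) <| .ite validEx
    (.seq (auctionSt (adjEx q edges inner)) (.set 1 (resultEx q inner))) (.set 1 (num 0))

/-- The position `u` belongs to the image of an inner atom under some witness. -/
def InnerPos (D : Database ar) (pos : RelTuple ar → ℕ) (u : ℕ) : Prop :=
  ∃ g ∈ inner, ∃ v, q.Witness D v ∧ pos (RelTuple.subst v g) = u

/-- The bipartite graph of the steps of all witnesses. -/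
def AdjPos (D : Database ar) (pos : RelTuple ar → ℕ) (u u' : ℕ) : Prop :=
  (∃ e ∈ edges, ∃ v, q.Witness D v ∧ pos (RelTuple.subst v e.1) = u ∧
    pos (RelTuple.subst v e.2) = u') ∨ (u = u' ∧ InnerPos q inner D pos u)

variable {q edges inner}

theorem below_decideSt (hedges : ∀ e ∈ edges, e.1 ∈ q.body ∧ e.2 ∈ q.body)
    (hinner : ∀ g ∈ inner, g ∈ q.body) :
    (decideSt q edges inner).Below (10 + (atoms q).length) := by
  have hreg : ∀ g ∈ q.body, atomReg q g < 10 + (atoms q).length := fun g hg => by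
    have := idxOf_lt q hg
    rw [atomReg]
    omega
  have hstep : ∀ g ∈ q.body, ∀ g' ∈ q.body, ∀ x < 10, ∀ y < 10,
      (stepEx q g g' x y).Below (10 + (atoms q).length) := fun g hg g' hg' x hx y hy => by
    refine below_existsWitnessEx q le_rfl ?_
    simp only [below_and, below_eq, below_var, hreg g hg, hreg g' hg', true_and]
    omega
  have hin : ∀ x < 10, (innerEx q inner x).Below (10 + (atoms q).length) := fun x hx => by
    simp only [innerEx, below_any, List.mem_map, forall_exists_index, and_imp,
      forall_apply_eq_imp_iff₂]
    exact fun g hg => hstep g (hinner g hg) g (hinner g hg) x hx x hx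
  have hadj : ∀ x < 10, ∀ y < 10, (adjEx q edges inner x y).Below (10 + (atoms q).length) := by
    intro x hx y hy
    simp only [adjEx, below_or, below_any, List.mem_map, forall_exists_index, and_imp,
      forall_apply_eq_imp_iff₂, below_and, below_eq, below_var, hin x hx, and_true]
    exact ⟨fun e he => hstep _ (hedges e he).1 _ (hedges e he).2 x hx y hy, by omega, by omega⟩
  have hres : (resultEx q inner).Below (10 + (atoms q).length) := by
    have h1 := hin 5 (by omega)
    have h2 := below_existsWitnessEx q (e := num 1) (le_refl (10 + (atoms q).length)) trivial
    simp [resultEx, h1, h2, priceEx]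
    omega
  refine ⟨below_scanSt (by omega), ?_, ⟨below_auctionSt (by omega) hadj, by omega, by omega, hres⟩,
    by omega, by omega, trivial⟩
  simp [validEx]
  omega

/-- A criterion for `RES(q)` to be in `P`. -/
theorem inP_resLanguage (hedges : ∀ e ∈ edges, e.1 ∈ q.body ∧ e.2 ∈ q.body)
    (hinner : ∀ g ∈ inner, g ∈ q.body)
    (H : ∀ (D : Database ar) (k n : ℕ) (pos : RelTuple ar → ℕ), (∀ t ∈ D, pos t < n) →
      (∀ t ∈ D, ∀ t' ∈ D, pos t = pos t' → t = t') → q.Sat D → ∀ I : Finset ℕ,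
      (∀ u, u ∈ I ↔ InnerPos q inner D pos u) →
      ((∃ Γ, q.IsContingencySet D Γ ∧ Γ.card ≤ k) ↔ ∃ CL CR : Finset ℕ,
        CL.card + CR.card ≤ k + I.card ∧ Layered.IsCover (AdjPos q edges inner D pos) CL CR)) :
    InP q.resLanguage := by
  classical
  refine inP_of_run (decideSt q edges inner) (by omega) (below_decideSt hedges hinner) fun w => ?_
  obtain ⟨h0, ⟨hv, l, k, rfl, hm⟩ | ⟨hv, hno⟩⟩ := run_scanSt (ar := ar) w
  · set w := encodeInstance l k with hw
    set s := (scanSt ar).run (RAMState.init w) with hs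
    obtain ⟨pos, hpos, hpos'⟩ := hm.exists_pos
    set D := l.toFinset with hD
    have hposD : ∀ t ∈ D, pos t < w.length := fun t ht => (hpos t (List.mem_toFinset.1 ht)).1
    have hinj : ∀ t ∈ D, ∀ t' ∈ D, pos t = pos t' → t = t' := fun t ht t' ht' he =>
      (hpos t (List.mem_toFinset.1 ht)).2.2.unique
        (he ▸ (hpos t' (List.mem_toFinset.1 ht')).2.2)
    have hstep : ∀ g ∈ q.body, ∀ g' ∈ q.body, ∀ s', Good w.length s.mem s' → ∀ x < 10, ∀ y < 10,
        ((stepEx q g g' x y).Holds s' ↔ ∃ v, q.Witness D v ∧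
          pos (RelTuple.subst v g) = s'.reg x ∧ pos (RelTuple.subst v g') = s'.reg y) := by
      intro g hg g' hg' s' hs' x hx y hy
      refine holds_existsWitnessEx q hs'.1 hm hs'.2 hpos hpos' fun v s'' _ h2 h3 => ?_
      simp only [holds_and, holds_eq, eval]
      rw [h3 g hg, h3 g' hg', h2 x hx, h2 y hy]
    have hin : ∀ s', Good w.length s.mem s' → ∀ x < 10,
        ((innerEx q inner x).Holds s' ↔ InnerPos q inner D pos (s'.reg x)) := by
      intro s' hs' x hx
      simp only [innerEx, holds_any, List.mem_map, exists_exists_and_eq_and, InnerPos]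
      refine exists_congr fun g => and_congr_right fun hg => ?_
      rw [hstep g (hinner g hg) g (hinner g hg) s' hs' x hx x hx]
      simp only [and_self]
    have hadj : ∀ s', Good w.length s.mem s' → ∀ x < 10, ∀ y < 10, s'.reg x < w.length →
        s'.reg y < w.length → ((adjEx q edges inner x y).Holds s' ↔
          AdjPos q edges inner D pos (s'.reg x) (s'.reg y)) := by
      intro s' hs' x hx y hy _ _
      simp only [adjEx, holds_or, holds_any, List.mem_map, exists_exists_and_eq_and, holds_and,
        holds_eq, AdjPos]
      rw [hin s' hs' x hx]
      refine or_congr (exists_congr fun e => and_congr_right fun he => ?_) Iff.rfl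
      exact hstep _ (hedges e he).1 _ (hedges e he).2 s' hs' x hx y hy
    have hgood : Good w.length s.mem s := ⟨h0, fun _ _ => rfl⟩
    -- The memory behind the marks is still zero, which is the start of the auction.
    have hInv : Auction.Inv w.length (AdjPos q edges inner D pos) (price w.length s.mem)
        (owner w.length s.mem) := by
      refine (Auction.Inv.zero _ _).congr (fun v _ => hm.zero _ (by omega))
        (fun v _ => hm.zero _ (by omega))
    obtain ⟨hg', hInv', hstable⟩ := run_auctionSt hadj hgood hInv
    set s' := (auctionSt (adjEx q edges inner)).run s with hs'
    have hrun : (decideSt q edges inner).run (RAMState.init w) =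
        setReg s' 1 ((resultEx q inner).eval s') := by
      rw [decideSt, St.run, St.run_ite_pos hv, St.run, St.run]
    set I := (Finset.range w.length).filter fun u => InnerPos q inner D pos u with hI
    have hsubD : ∀ {v g}, q.Witness D v → g ∈ q.body → pos (RelTuple.subst v g) < w.length :=
      fun hv hg => hposD _ (hv _ hg)
    have hI' : ∀ u, u ∈ I ↔ InnerPos q inner D pos u := fun u => by
      rw [hI, Finset.mem_filter, Finset.mem_range, and_iff_right_iff_imp]
      rintro ⟨g, hg, v, hv, rfl⟩
      exact hsubD hv (hinner g hg)
    have hcover := hInv'.exists_cover_iff (k := k + I.card) (fun u u' h => by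
      rcases h with ⟨e, he, v, hv, rfl, rfl⟩ | ⟨rfl, g, hg, v, hv, rfl⟩
      · exact ⟨hsubD hv (hedges e he).1, hsubD hv (hedges e he).2⟩
      · exact ⟨hsubD hv (hinner g hg), hsubD hv (hinner g hg)⟩) hstable
    have hsat : (existsWitnessEx q (num 1)).Holds s' ↔ q.Sat D := by
      rw [holds_existsWitnessEx q hg'.1 hm hg'.2 hpos hpos' (Q := fun _ => True)
        fun _ _ _ _ _ => by simp]
      simp only [and_true]
      rfl
    have hk : s'.mem 0 = k := by
      have h1 : 0 < w.length := by rw [hw]; simp [encodeInstance]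
      rw [hg'.2 0 (by omega), hm.input 0 h1, hw]
      rfl
    have hlt : (lt (add (get (num 0)) (sum 5 (bool (innerEx q inner 5))))
        (sum 5 (bool (priceEx 5)))).Holds s' ↔ k + I.card <
          ((Finset.range w.length).filter fun v => price w.length s'.mem v ≠ 0).card := by
      rw [holds_lt, eval_sum_bool (fun v => price w.length s'.mem v ≠ 0), eval, eval, eval, hk,
        eval_sum_bool (fun u => InnerPos q inner D pos u), hg'.1]
      · intro v hv
        rw [hin _ (hg'.setReg (by omega) v) 5 (by omega), setReg_reg_self]
      · intro v hv
        simp [Holds, priceEx, eval, setReg_reg, price, hg'.1]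
    rw [hrun, setReg_reg_self]
    change (resultEx q inner).Holds s' ↔ _
    rw [resultEx, holds_and, holds_not, hsat, hlt, not_lt, ← hcover]
    constructor
    · rintro ⟨h1, h2⟩
      exact ⟨l, k, rfl, h1, (H D k _ pos hposD hinj h1 I hI').2 h2⟩
    · rintro ⟨l', k', he, h1, h2⟩
      obtain ⟨rfl, rfl⟩ := encodeInstance_inj he
      exact ⟨h1, (H D k _ pos hposD hinj h1 I hI').1 h2⟩
  · have hrun : (decideSt q edges inner).run (RAMState.init w) =
        setReg ((scanSt ar).run (RAMState.init w)) 1 0 := by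
      rw [decideSt, St.run, St.run_ite_neg hv, St.run, eval]
    rw [hrun, setReg_reg_self]
    simp only [ne_eq, not_true_eq_false, false_iff]
    rintro ⟨l, k, he, -⟩
    exact hno l k he

end Decision

end Loop

/-! ### The main theorem -/

namespace Query

open Separation Layered

variable {ℓ : ℕ} {ar : Fin ℓ → ℕ}

/-- Hitting sets of facts correspond to hitting sets of positions. -/
theorem exists_hits_iff {q : Query ar} {D : Database ar} {E : Finset (RelTuple ar)}
    (hE : E ⊆ q.body) {m : ℕ} {es : ℕ → RelTuple ar} (hes : ∀ i < m, es i ∈ E)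
    (hsurj : ∀ e ∈ E, ∃ i < m, es i = e) {pos : RelTuple ar → ℕ}
    (hinj : ∀ t ∈ D, ∀ t' ∈ D, pos t = pos t' → t = t') (k : ℕ) :
    (∃ Γ : Finset (RelTuple ar), q.Hits D E Γ ∧ Γ.card ≤ k) ↔
      ∃ Γ : Finset ℕ, Γ.card ≤ k ∧ ∀ w ∈ {w | q.Witness D w}, ∃ i < m,
        pos (RelTuple.subst w (es i)) ∈ Γ := by
  constructor
  · rintro ⟨Γ, h, hk⟩
    refine ⟨Γ.image pos, Finset.card_image_le.trans hk, fun w hw => ?_⟩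
    obtain ⟨e, he, hΓ⟩ := h w hw
    obtain ⟨i, hi, rfl⟩ := hsurj e he
    exact ⟨i, hi, Finset.mem_image_of_mem _ hΓ⟩
  · rintro ⟨Γ, hk, h⟩
    refine ⟨D.filter fun t => pos t ∈ Γ, fun w hw => ?_, (Finset.card_le_card_of_injOn pos
      (fun t ht => (Finset.mem_filter.1 ht).2) fun t ht t' ht' => hinj t
        (Finset.mem_filter.1 ht).1 t' (Finset.mem_filter.1 ht').1).trans hk⟩
    obtain ⟨i, hi, hΓ⟩ := h w hw
    exact ⟨es i, hes i hi, Finset.mem_filter.2 ⟨hw _ (hE (hes i hi)), hΓ⟩⟩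

theorem exists_sequence {E : Finset (RelTuple ar)} (hE : E.Nonempty) {pos : RelTuple ar → ℤ}
    (hinj : ∀ a ∈ E, ∀ b ∈ E, pos a = pos b → a = b) : ∃ es : ℕ → RelTuple ar,
      (∀ i < E.card, es i ∈ E) ∧ (∀ e ∈ E, ∃ i < E.card, es i = e) ∧
      ∀ i j, i < j → j < E.card → pos (es i) < pos (es j) := by
  classical
  have hcard : (E.image pos).card = E.card := Finset.card_image_of_injOn hinj
  let f := (E.image pos).orderEmbOfFin hcard
  have hf : ∀ i, ∃ e ∈ E, pos e = f i := fun i =>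
    Finset.mem_image.1 (Finset.orderEmbOfFin_mem _ hcard i)
  choose g hg hgf using hf
  obtain ⟨e₀, -⟩ := hE
  -- `e₀` is a dummy value for indices out of range.
  refine ⟨fun i => if h : i < E.card then g ⟨i, h⟩ else e₀, fun i hi => ?_, fun e he => ?_,
    fun i j hij hj => ?_⟩
  · simp only [dif_pos hi, hg]
  · have : pos e ∈ Set.range f := by
      rw [Finset.range_orderEmbOfFin]
      exact Finset.mem_coe.2 (Finset.mem_image_of_mem _ he)
    obtain ⟨i, hi⟩ := this
    refine ⟨i, i.2, ?_⟩
    simp only [dif_pos i.2]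
    exact hinj _ (hg i) _ he ((hgf i).trans hi)
  · simp only [dif_pos hj, dif_pos (hij.trans hj), hgf]
    exact f.strictMono hij

/-- If the hitting sets for atoms with different relation symbols, ordered linearly, determine the
contingency sets, then `RES(q)` is in `P`. -/
theorem inP_of_separatingOrder {q : Query ar} {E : Finset (RelTuple ar)} (hE : E ⊆ q.body)
    (hsym : ∀ a ∈ E, ∀ b ∈ E, a.1 = b.1 → a = b) {pos : RelTuple ar → ℤ}
    (hpos : SeparatingOrder q.Adj RelTuple.vars E pos)
    (H : ∀ (D : Database ar) (k : ℕ), (∃ Γ, q.IsContingencySet D Γ ∧ Γ.card ≤ k) ↔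
      ∃ Γ : Finset (RelTuple ar), q.Hits D E Γ ∧ Γ.card ≤ k) : InP q.resLanguage := by
  rcases Nat.eq_zero_or_pos E.card with h0 | hpos0
  · have hempty : q.resLanguage = ∅ := by
      rw [Set.eq_empty_iff_forall_notMem]
      rintro w ⟨l, k, -, ⟨v, hv⟩, hΓ⟩
      obtain ⟨Γ, h, -⟩ := (H _ _).1 hΓ
      obtain ⟨e, he, -⟩ := h v hv
      rw [Finset.card_eq_zero] at h0
      simp [h0] at he
    rw [hempty]
    refine Loop.inP_of_run (d := 2) (.set 1 (.num 0)) (by omega) ⟨by omega, by omega, trivial⟩ ?_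
    simp [Loop.St.run, Loop.Ex.eval]
  obtain ⟨es, hes, hsurj, hmono⟩ := exists_sequence (Finset.card_pos.1 hpos0) hpos.1
  have hbody : ∀ i < E.card, es i ∈ q.body := fun i hi => hE (hes i hi)
  have hidx : ∀ i < E.card, ∀ j < E.card, es i = es j → i = j := by
    intro i hi j hj hij
    rcases lt_trichotomy i j with h | h | h
    · exact (lt_irrefl _ (hij ▸ hmono i j h hj)).elim
    · exact h
    · exact (lt_irrefl _ (hij ▸ hmono j i h hi)).elim
  -- With a single atom the only layer is both first and last. The graph then has just diagonal
  -- edges at its facts, and nothing is added to the bound.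
  by_cases h1 : E.card = 1
  · refine Loop.inP_resLanguage (edges := [(es 0, es 0)]) (inner := [])
      (by simpa using hbody 0 (by omega)) (by simp) ?_
    intro D k n P hP hinj _ I hI
    rw [H, exists_hits_iff hE hes hsurj hinj]
    have hadj : ∀ u v, Loop.AdjPos q [(es 0, es 0)] [] D P u v ↔
        u = v ∧ ∃ w, q.Witness D w ∧ P (RelTuple.subst w (es 0)) = u := by
      intro u v
      simp only [Loop.AdjPos, Loop.InnerPos, List.mem_singleton, exists_eq_left, List.not_mem_nil,
        false_and, exists_false, and_false, or_false]
      constructor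
      · rintro ⟨w, hw, h2, h3⟩
        exact ⟨h2.symm.trans h3, w, hw, h2⟩
      · rintro ⟨rfl, w, hw, h2⟩
        exact ⟨w, hw, h2, h2⟩
    have hI0 : I = ∅ := by
      rw [Finset.eq_empty_iff_forall_notMem]
      intro u hu
      simpa [Loop.InnerPos] using (hI u).1 hu
    rw [hI0, Finset.card_empty, Nat.add_zero]
    constructor
    · rintro ⟨Γ, hk, h⟩
      refine ⟨Γ, ∅, by simpa using hk, fun u v huv => .inl ?_⟩
      obtain ⟨rfl, w, hw, rfl⟩ := (hadj u v).1 huv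
      obtain ⟨i, hi, hΓ⟩ := h w hw
      obtain rfl : i = 0 := by omega
      exact hΓ
    · rintro ⟨CL, CR, hk, h⟩
      refine ⟨CL ∪ CR, (Finset.card_union_le _ _).trans hk, fun w hw => ⟨0, by omega, ?_⟩⟩
      exact Finset.mem_union.2 (h _ _ ((hadj _ _).2 ⟨rfl, w, hw, rfl⟩))
  · refine Loop.inP_resLanguage
      (edges := (List.range (E.card - 1)).map fun i => (es i, es (i + 1)))
      (inner := (List.range (E.card - 2)).map fun i => es (i + 1)) ?_ ?_ ?_
    · simp only [List.mem_map, List.mem_range, forall_exists_index, and_imp,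
        forall_apply_eq_imp_iff₂]
      exact fun i hi => ⟨hbody i (by omega), hbody (i + 1) (by omega)⟩
    · simp only [List.mem_map, List.mem_range, forall_exists_index, and_imp,
        forall_apply_eq_imp_iff₂]
      exact fun i hi => hbody (i + 1) (by omega)
    intro D k n P hP hinj _ I hI
    rw [H, exists_hits_iff hE hes hsurj hinj]
    have hinner : ∀ u, Loop.InnerPos q ((List.range (E.card - 2)).map fun i => es (i + 1)) D P u ↔
        ∃ w ∈ {w | q.Witness D w}, ∃ i, 0 < i ∧ i + 1 < E.card ∧
          P (RelTuple.subst w (es i)) = u := by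
      intro u
      simp only [Loop.InnerPos, List.mem_map, List.mem_range, exists_exists_and_eq_and]
      constructor
      · rintro ⟨i, hi, w, hw, rfl⟩
        exact ⟨w, hw, i + 1, by omega, by omega, rfl⟩
      · rintro ⟨w, hw, i, hi0, hi, rfl⟩
        exact ⟨i - 1, by omega, w, hw, by rw [Nat.sub_add_cancel hi0]⟩
    refine exists_hitting_iff_exists_cover (W := {w | q.Witness D w})
      (proj := fun w i => P (RelTuple.subst w (es i))) (by omega) ?_ ?_ (U := Finset.range n) ?_
      (fun u => (hI u).trans (hinner u)) (fun u v => ?_) k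
    -- Equal facts have equal relation symbols, and these determine the atom by `hsym`.
    · intro w hw w' hw' i hi j hj hij
      have := hinj _ (hw _ (hbody i hi)) _ (hw' _ (hbody j hj)) hij
      have hS : (RelTuple.subst w (es i)).1 = (RelTuple.subst w' (es j)).1 := by rw [this]
      exact hidx i hi j hj (hsym _ (hes i hi) _ (hes j hj) hS)
    · intro w hw w' hw' i hi hii
      have he := hinj _ (hw _ (hbody i hi)) _ (hw' _ (hbody i hi)) hii
      obtain ⟨w'', hw'', h2, h3⟩ := Witness.splice hpos hw hw' (hes i hi) he
      have hle : ∀ a b, a ≤ b → b < E.card → pos (es a) ≤ pos (es b) := fun a b hab hb => by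
        rcases hab.lt_or_eq with h | rfl
        exacts [(hmono a b h hb).le, le_rfl]
      exact ⟨w'', hw'', fun j hj => by simp only [h2 (es j) (hes j (by omega)) (hle j i hj hi)],
        fun j hj hij => by simp only [h3 (es j) (hes j hj) (hle i j hij hj)]⟩
    · exact fun w hw i hi => Finset.mem_range.2 (hP _ (hw _ (hbody i hi)))
    · rw [hI u, Loop.AdjPos]
      refine or_congr ?_ Iff.rfl
      simp only [List.mem_map, List.mem_range, exists_exists_and_eq_and, Set.mem_ofPred_eq]
      constructor
      · rintro ⟨i, hi, w, hw, h2, h3⟩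
        exact ⟨w, hw, i, by omega, h2, h3⟩
      · rintro ⟨w, hw, i, hi, h2, h3⟩
        exact ⟨i, by omega, w, hw, h2, h3⟩

end Query

theorem mainTheorem9 {ℓ : ℕ} (ar : Fin ℓ → ℕ) (q q' : Query ar) (R : Fin ℓ)
    (hbin : q.IsBinary) (hconn : q.Connected)
    (hssj : ∀ S : Fin ℓ, S ≠ R → q.atomCount S ≤ 1) (htwo : q.atomCount R = 2)
    (hz3 : q.ContainsZ3 R)
    (hdom : Relation.ReflTransGen Query.MarkDominated q q') (hlin : q'.PseudoLinear) :
    (∀ D Γ : Database ar, q.Sat D → q.IsContingencySet D Γ →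
      ∃ Γ' : Database ar, q.IsContingencySet D Γ' ∧ Γ'.card ≤ Γ.card ∧
        ∀ a b : ℕ, ∀ t ∈ Γ', t.1 = R → List.ofFn t.2 = [a, b] → a = b) ∧
    InP q.resLanguage := by
  refine ⟨fun D Γ _ hΓ => Query.exists_contingencySet_of_loops hz3 htwo hΓ, ?_⟩
  obtain ⟨e₁, he₁, e₂, he₂, h1, h2, hne, huniq, -, hloop⟩ := hz3.exists_atoms htwo
  obtain ⟨hbody, hexo⟩ := Query.MarkDominated.body_eq hdom
  have hsub : q'.endo.erase e₂ ⊆ q'.endo := Finset.erase_subset _ _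
  have hendo : q'.endo ⊆ q.endo := fun e he => by
    obtain ⟨h3, h4⟩ := Query.mem_endo.1 he
    exact Query.mem_endo.2 ⟨hbody ▸ h3, fun h => h4 (hexo h)⟩
  have hE : q'.endo.erase e₂ ⊆ q.body := fun e he => (Query.mem_endo.1 (hendo (hsub he))).1
  have hbin' : q'.IsBinary := fun g hg => hbin g (hbody ▸ hg)
  obtain ⟨pos, hpos⟩ := Query.exists_separatingOrder_of_pseudoLinear hbin' hlin hsub
  have hadj : q'.Adj = q.Adj := by
    funext u v
    simp only [Query.Adj, hbody]
  rw [hadj] at hpos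
  refine Query.inP_of_separatingOrder hE ?_ hpos fun D k => ⟨?_, ?_⟩
  · intro a ha b hb hab
    by_cases haR : a.1 = R
    · have h3 := (huniq a (hE ha) haR).resolve_right (Finset.ne_of_mem_erase ha)
      have h4 := (huniq b (hE hb) (hab ▸ haR)).resolve_right (Finset.ne_of_mem_erase hb)
      rw [h3, h4]
    · exact Finset.card_le_one.1 (hssj a.1 haR) a (Finset.mem_filter.2 ⟨hE ha, rfl⟩) b
        (Finset.mem_filter.2 ⟨hE hb, hab.symm⟩)
  -- Domination is applied before the passage to loops. If a loop is needed here, `R` has remained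
  -- endogenous in `q'`, so `R(x,x)` belongs to the reduced set of atoms.
  · rintro ⟨Γ, hΓ, hk⟩
    obtain ⟨Γ', hk', hΓ'⟩ := hΓ.hits.of_markDominated hdom
    refine ⟨Γ'.image (Query.toLoop R), hΓ'.image _ fun e he => ?_,
      Finset.card_image_le.trans (hk'.trans hk)⟩
    obtain ⟨heb, hee⟩ := Query.mem_endo.1 he
    by_cases heR : e.1 = R
    · refine ⟨e₁, Finset.mem_erase.2 ⟨hne, Query.mem_endo.2 ⟨hbody ▸ he₁, ?_⟩⟩, fun w => ?_⟩
      · rwa [h1, ← heR]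
      · rcases huniq e (hbody ▸ heb) heR with rfl | rfl
        exacts [(hloop w).1, (hloop w).2]
    · refine ⟨e, Finset.mem_erase.2 ⟨?_, he⟩, fun w => ?_⟩
      · rintro rfl
        exact heR h2
      · simp [Query.toLoop, RelTuple.subst, heR]
  · rintro ⟨Γ, hΓ, hk⟩
    exact ⟨_, (hΓ.mono (hsub.trans hendo)).isContingencySet,
      (Finset.card_filter_le _ _).trans hk⟩
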